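/- **Setting.** Kernels $k(x,y)\in L^2(\mathbb R^3\times\mathbb R^3)$ are identified with the Hilbert–Schmidt operators $(kf)(x)=\int k(x,y)f(y)\,dy$ on $L^2(\mathbb R^3)$; products of kernels are compositions, $\overline k$ is the complex conjugate kernel, $k^T(x,y)=k(y,x)$, and $k$ is symmetric if $k^T=k$. Let $v:\mathbb R^3\to\mathbb R$ be an even potential in $L^2(\mathbb R^3)$ (for instance $v=\chi(|x|)/|x|$ with $\chi$ a smooth compactly supported cut-off) and let $\phi(t,x)$ be a measurable complex function on $[0,T]\times\mathbb R^3$ with $\|\phi\|_{L^2([0,T])L^4(\mathbb R^3)}<\infty$ (for instance a smooth solution of the Hartree equation $i\phi_t+\Delta\phi-(v*|\phi|^2)\phi=0$). Put $$m(t,x,y)=-v(x-y)\overline\phi(t,x)\overline\phi(t,y),$$ $$g(t,x,y)=-\Delta_x\delta(x-y)+v(x-y)\phi(t,x)\overline\phi(t,y)+(v*|\phi|^2)(t,x)\,\delta(x-y),$$ and $S(u)=iu_t+gu+ug^T$. For a symmetric $u\in L^2(\mathbb R^6)$ put $q=u\overline u$, $1+p=\sqrt{1+u\overline u}$ (positive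 operator square root), $r=(1+p)^{-1}$, $F=m\overline u(1+p)-(1+p)u\overline m$ and $$W=\frac1{2\pi i}\oint_\Gamma (q-z)^{-1}F(q-z)^{-1}\sqrt{1+z}\,dz,$$ where $\Gamma$ is a positively oriented contour in $\mathbb C\setminus(-\infty,-1]$ enclosing the spectrum of the non-negative operator $q$. The semilinear equation is $$S(u)=(1+p)m+\tfrac12[W,r]u+\tfrac12\left(rm\overline u+u\overline m r\right)u.\qquad(*)$$ **Theorem.** Let $u_0\in L^2(\mathbb R^6)$ be symmetric. There is $\varepsilon_0>0$, depending only on $u_0$, such that for all $v$ as above and all $A\ge0$ there is a constant $C$, depending only on $u_0$, $v$ and $A$, with the following property. If $T>0$, $\phi$ is as above with $\|\phi\|^2_{L^2([0,T])L^4}\le A$, and $\|m\|_{L^1([0,T])L^2(dx\,dy)}\le\varepsilon_0$, then there is $u\in C([0,T];L^2(\mathbb R^6))$ with $u(t)$ symmetric and $\|u(t)\|_{L^2}\le C$ for all $t\in[0,T]$ (so $u\in L^\infty([0,T])L^2$), which satisfies $u(0)=u_0$ and solves $(*)$ in the sense of distributions on $(0,T)\times\mathbb R^6$, the right-hand side of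 $(*)$ being in $L^1([0,T])L^2$. Moreover, 1. $\left\|\left(i\partial_t-\Delta_x-\Delta_y\right)u\right\|_{L^1([0,T])L^2(dx\,dy)}\le C$; 2. $p=\sqrt{1+u\overline u}-1$ has a kernel in $L^2(\mathbb R^6)$ for every $t\in[0,T]$, and $\left\|\left(i\partial_t-\Delta_x+\Delta_y\right)p\right\|_{L^1([0,T])L^2(dx\,dy)}\le C$. -/

import Mathlib

open MeasureTheory Set
open scoped ENNReal NNReal ContDiff

noncomputable section

namespace PairExcitation

/-- Physical space `ℝ³`. -/
abbrev E3 : Type := EuclideanSpace ℝ (Fin 3)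

/-- The one-particle space `L²(ℝ³)`. -/
abbrev H : Type := Lp ℂ 2 (volume : Measure E3)

/-- `L²(ℝ⁶)`: square-integrable (Hilbert–Schmidt) kernels `K(x, y)` on `ℝ³ × ℝ³`. -/
abbrev Kern : Type := Lp ℂ 2 (volume : Measure (E3 × E3))

/-! ### The integral operator with a given square-integrable kernel -/

lemma sq_eLpNorm_two {α : Type*} [MeasurableSpace α] {μ : Measure α} (f : α → ℂ) :
    eLpNorm f 2 μ ^ 2 = ∫⁻ x, ‖f x‖ₑ ^ 2 ∂μ := by
  have h := eLpNorm_nnreal_pow_eq_lintegral (μ := μ) (f := f) (p := 2) (by norm_num)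
  simpa using h

lemma sq_lintegral_mul_le {α : Type*} [MeasurableSpace α] {μ : Measure α} {f g : α → ℝ≥0∞}
    (hf : AEMeasurable f μ) (hg : AEMeasurable g μ) :
    (∫⁻ x, f x * g x ∂μ) ^ 2 ≤ (∫⁻ x, f x ^ 2 ∂μ) * ∫⁻ x, g x ^ 2 ∂μ := by
  have h := ENNReal.lintegral_mul_le_Lp_mul_Lq μ Real.HolderConjugate.two_two hf hg
  have h2 := pow_le_pow_left' h 2
  refine h2.trans (le_of_eq ?_)
  rw [mul_pow, ← ENNReal.rpow_natCast, ← ENNReal.rpow_natCast, ← ENNReal.rpow_mul,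
    ← ENNReal.rpow_mul]
  norm_num

lemma aesm_kernel_mul (K : Kern) (f : H) :
    AEStronglyMeasurable (fun z : E3 × E3 => K z * f z.2)
      ((volume : Measure E3).prod (volume : Measure E3)) :=
  (Lp.aestronglyMeasurable K).mul
    ((Lp.aestronglyMeasurable f).comp_quasiMeasurePreserving
      Measure.quasiMeasurePreserving_snd)

lemma lintegral_slice (K : Kern) :
    ∫⁻ x : E3, ∫⁻ y : E3, ‖K (x, y)‖ₑ ^ 2 = eLpNorm K 2 volume ^ 2 := by
  rw [sq_eLpNorm_two]
  exact (lintegral_prod (μ := (volume : Measure E3)) (ν := (volume : Measure E3))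
    (fun z : E3 × E3 => ‖K z‖ₑ ^ 2) ((Lp.aestronglyMeasurable K).enorm.pow_const 2)).symm

lemma ae_slice_memLp (K : Kern) :
    ∀ᵐ x : E3, MemLp (fun y : E3 => K (x, y)) 2 volume := by
  have h1 : ∀ᵐ x : E3, AEStronglyMeasurable (fun y : E3 => K (x, y)) volume :=
    AEStronglyMeasurable.prodMk_left (Lp.aestronglyMeasurable K)
  have h2 : ∀ᵐ x : E3, ∫⁻ y : E3, ‖K (x, y)‖ₑ ^ 2 < ⊤ := by
    refine ae_lt_top' ?_ ?_
    · exact AEMeasurable.lintegral_prod_right' ((Lp.aestronglyMeasurable K).enorm.pow_const 2)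
    · rw [lintegral_slice]
      exact ENNReal.pow_ne_top (Lp.eLpNorm_ne_top K)
  filter_upwards [h1, h2] with x hx1 hx2
  refine ⟨hx1, ?_⟩
  rw [← sq_eLpNorm_two] at hx2
  by_contra hcon
  rw [not_lt, top_le_iff] at hcon
  simp [hcon] at hx2

lemma ae_integrable_slice (K : Kern) (f : H) :
    ∀ᵐ x : E3, Integrable (fun y : E3 => K (x, y) * f y) volume := by
  filter_upwards [ae_slice_memLp K] with x hx
  exact hx.integrable_mul (Lp.memLp f)

lemma eLpNorm_kernel_integral_le (K : Kern) (f : H) :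
    eLpNorm (fun x : E3 => ∫ y : E3, K (x, y) * f y) 2 volume
      ≤ eLpNorm K 2 volume * eLpNorm f 2 volume := by
  refine (ENNReal.pow_le_pow_left_iff (n := 2) (by norm_num)).1 ?_
  rw [mul_pow, sq_eLpNorm_two, ← lintegral_slice, sq_eLpNorm_two,
    ← lintegral_mul_const'' _
      (AEMeasurable.lintegral_prod_right' ((Lp.aestronglyMeasurable K).enorm.pow_const 2))]
  refine lintegral_mono_ae ?_
  filter_upwards [ae_slice_memLp K] with x hx
  calc ‖∫ y : E3, K (x, y) * f y‖ₑ ^ 2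
      ≤ (∫⁻ y : E3, ‖K (x, y) * f y‖ₑ) ^ 2 :=
        pow_le_pow_left' (enorm_integral_le_lintegral_enorm _) 2
    _ = (∫⁻ y : E3, ‖K (x, y)‖ₑ * ‖f y‖ₑ) ^ 2 := by simp only [enorm_mul]
    _ ≤ _ := sq_lintegral_mul_le hx.1.enorm (Lp.aestronglyMeasurable f).enorm

lemma memLp_kernel_integral (K : Kern) (f : H) :
    MemLp (fun x : E3 => ∫ y : E3, K (x, y) * f y) 2 volume :=
  ⟨(aesm_kernel_mul K f).integral_prod_right',
    (eLpNorm_kernel_integral_le K f).trans_lt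
      (ENNReal.mul_lt_top (Lp.eLpNorm_lt_top K) (Lp.eLpNorm_lt_top f))⟩

/-- The bounded operator on `L²(ℝ³)` with kernel `K ∈ L²(ℝ⁶)`:
`(K f)(x) = ∫ K(x, y) f(y) dy`. -/
def kernelOp (K : Kern) : H →L[ℂ] H :=
  LinearMap.mkContinuous
    { toFun := fun f => (memLp_kernel_integral K f).toLp _
      map_add' := fun f g => by
        rw [← MemLp.toLp_add]
        refine MemLp.toLp_congr _ _ ?_
        filter_upwards [ae_integrable_slice K f, ae_integrable_slice K g] with x hf hg
        rw [Pi.add_apply, ← integral_add hf hg]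
        refine integral_congr_ae ?_
        filter_upwards [Lp.coeFn_add f g] with y hy
        rw [hy, Pi.add_apply, mul_add]
      map_smul' := fun c f => by
        rw [RingHom.id_apply, ← MemLp.toLp_const_smul]
        refine MemLp.toLp_congr _ _ (Filter.Eventually.of_forall fun x => ?_)
        simp only [Pi.smul_apply]
        rw [← integral_smul]
        refine integral_congr_ae ?_
        filter_upwards [Lp.coeFn_smul c f] with y hy
        rw [hy, Pi.smul_apply, smul_eq_mul, smul_eq_mul]
        ring }
    ‖K‖
    (fun f => by
      change ‖(memLp_kernel_integral K f).toLp _‖ ≤ ‖K‖ * ‖f‖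
      rw [Lp.norm_toLp, Lp.norm_def, Lp.norm_def, ← ENNReal.toReal_mul]
      exact ENNReal.toReal_mono
        (ENNReal.mul_ne_top (Lp.eLpNorm_ne_top K) (Lp.eLpNorm_ne_top f))
        (eLpNorm_kernel_integral_le K f))

lemma kernelOp_apply_ae (K : Kern) (f : H) :
    (kernelOp K f : E3 → ℂ) =ᵐ[volume] fun x => ∫ y : E3, K (x, y) * f y :=
  (memLp_kernel_integral K f).coeFn_toLp

open Classical in
/-- The class in `L²(ℝ⁶)` of a square-integrable function (and `0` if the function is not
square-integrable). -/
def toKern (k : E3 × E3 → ℂ) : Kern :=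
  if h : MemLp k 2 volume then h.toLp k else 0

/-- `K(y, x) = K(x, y)`. -/
def IsSymm (K : Kern) : Prop := ∀ᵐ z : E3 × E3, K z.swap = K z

/-! ### The operators entering the semilinear equation

Products are compositions of operators; `star K` is the complex conjugate kernel. -/

/-- `q = u ū`. -/
def qOp (u : Kern) : H →L[ℂ] H := kernelOp u * kernelOp (star u)

/-- The positive square root of a positive bounded operator on a Hilbert space. -/
def opSqrt {X : Type*} [NormedAddCommGroup X] [InnerProductSpace ℂ X] [CompleteSpace X]
    (a : X →L[ℂ] X) : X →L[ℂ] X := CFC.sqrt a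

/-- `1 + p = √(1 + u ū)`. -/
def chOp (u : Kern) : H →L[ℂ] H := opSqrt (1 + qOp u)

/-- `r = (1 + p)⁻¹`. -/
def rOp (u : Kern) : H →L[ℂ] H := Ring.inverse (chOp u)

/-- `F = m ū (1 + p) - (1 + p) u m̄`. -/
def FOp (u m : Kern) : H →L[ℂ] H :=
  kernelOp m * kernelOp (star u) * chOp u - chOp u * kernelOp u * kernelOp (star m)

/-- `W = (2πi)⁻¹ ∮_Γ (q - z)⁻¹ F (q - z)⁻¹ √(1 + z) dz`. For symmetric `u` the spectrum of `q` lies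
in `[0, ‖q‖]`; the contour `Γ` is the counterclockwise circle with centre `‖q‖` and radius
`‖q‖ + 1/2`, which encloses that interval and stays in the half-plane `Re z ≥ -1/2`, where the
principal branch of `√(1 + z)` is holomorphic. -/
def WOp (u m : Kern) : H →L[ℂ] H :=
  (2 * Real.pi * Complex.I : ℂ)⁻¹ •
    ∮ z in C((‖qOp u‖ : ℂ), ‖qOp u‖ + 1 / 2),
      ((1 + z) ^ (1 / 2 : ℂ)) •
        (Ring.inverse (qOp u - z • 1) * FOp u m * Ring.inverse (qOp u - z • 1))

/-- The right-hand side
`(1 + p) m + ½ [W, r] u + ½ (r m ū + u m̄ r) u` of the semilinear equation. -/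
def rhsOp (u m : Kern) : H →L[ℂ] H :=
  chOp u * kernelOp m
    + (1 / 2 : ℂ) • ((WOp u m * rOp u - rOp u * WOp u m) * kernelOp u)
    + (1 / 2 : ℂ) • ((rOp u * kernelOp m * kernelOp (star u)
        + kernelOp u * kernelOp (star m) * rOp u) * kernelOp u)

/-! ### The coefficients built from the potential `v` and the condensate `φ` -/

/-- `m(t, x, y) = -v(x - y) φ̄(t, x) φ̄(t, y)`. -/
def mFun (v : E3 → ℝ) (φ : ℝ → E3 → ℂ) (t : ℝ) (z : E3 × E3) : ℂ :=
  -((v (z.1 - z.2) : ℂ) * star (φ t z.1) * star (φ t z.2))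

/-- `w(t, x, y) = v(x - y) φ(t, x) φ̄(t, y)`, the exchange part of the kernel `g`. -/
def wFun (v : E3 → ℝ) (φ : ℝ → E3 → ℂ) (t : ℝ) (x y : E3) : ℂ :=
  (v (x - y) : ℂ) * φ t x * star (φ t y)

/-- `(v * |φ|²)(t, x)`, the direct part of `g`. -/
def hartreePot (v : E3 → ℝ) (φ : ℝ → E3 → ℂ) (t : ℝ) (x : E3) : ℝ :=
  ∫ y : E3, v (x - y) * ‖φ t y‖ ^ 2

/-- The part of `g u + u gᵀ` without derivatives, where
`g(t, x, y) = -Δ_x δ(x - y) + v(x - y) φ(t, x) φ̄(t, y) + (v * |φ|²)(t, x) δ(x - y)`. -/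
def lowerOrder (v : E3 → ℝ) (φ : ℝ → E3 → ℂ) (t : ℝ) (u : Kern) (x y : E3) : ℂ :=
  (∫ z : E3, wFun v φ t x z * u (z, y)) + (∫ z : E3, u (x, z) * wFun v φ t y z)
    + ((hartreePot v φ t x : ℂ) + (hartreePot v φ t y : ℂ)) * u (x, y)

/-! ### Equations in the sense of distributions -/

/-- Test functions on `(0, T) × ℝ³ × ℝ³`. -/
structure IsTestFunction (T : ℝ) (ψ : ℝ × E3 × E3 → ℂ) : Prop where
  smooth : ContDiff ℝ ∞ ψ
  compact : HasCompactSupport ψ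
  support : tsupport ψ ⊆ Ioo 0 T ×ˢ univ

/-- `(i ∂_t - Δ_x - σ Δ_y) f = G` in the sense of distributions on `(0, T) × ℝ⁶`, for
`f, G ∈ L¹([0, T]; L²(ℝ⁶))`. -/
def SchrodingerEq (σ : ℝ) (T : ℝ) (f G : ℝ → Kern) : Prop :=
  IntegrableOn f (Icc 0 T) ∧ IntegrableOn G (Icc 0 T) ∧
  ∀ ψ : ℝ × E3 × E3 → ℂ, IsTestFunction T ψ →
    ∫ t in Icc 0 T, ∫ z : E3 × E3, f t z *
        (-(Complex.I * deriv (fun s : ℝ => ψ (s, z.1, z.2)) t)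
          - Laplacian.laplacian (fun x : E3 => ψ (t, x, z.2)) z.1
          - (σ : ℂ) * Laplacian.laplacian (fun y : E3 => ψ (t, z.1, y)) z.2)
      = ∫ t in Icc 0 T, ∫ z : E3 × E3, G t z * ψ (t, z.1, z.2)

/-- `u` solves `S(u) = (1 + p) m + ½ [W, r] u + ½ (r m ū + u m̄ r) u` on `[0, T]`, where
`S(u) = i u_t + g u + u gᵀ`. The kernel of the right-hand side is `N ∈ L¹([0, T]; L²(ℝ⁶))`. -/
def SolvesSemilinear (v : E3 → ℝ) (φ : ℝ → E3 → ℂ) (T : ℝ) (u : ℝ → Kern) : Prop :=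
  ∃ N G : ℝ → Kern,
    IntegrableOn N (Icc 0 T) ∧
    (∀ᵐ t ∂(volume.restrict (Icc 0 T)),
      MemLp (mFun v φ t) 2 volume ∧ kernelOp (N t) = rhsOp (u t) (toKern (mFun v φ t))) ∧
    SchrodingerEq 1 T u G ∧
    (∀ᵐ t ∂(volume.restrict (Icc 0 T)), ∀ᵐ z : E3 × E3,
      G t z + lowerOrder v φ t (u t) z.1 z.2 = N t z)

end PairExcitation

end

open MeasureTheory Set
open scoped ENNReal NNReal ContDiff

noncomputable section

namespace PairExcitation

/-! ### Hilbert–Schmidt operators and their kernels -/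

/-! The point is that the right-hand side of the equation is harmless on L²(ℝ⁶). For fixed `u` it is
real-linear in `m`. As a bounded operator `NMap u` acting on `m` it is bounded and Lipschitz in `u`
on every ball of L². The only term for which this is not evident is the contour integral `W`.
Formally `W` is the derivative of q ↦ √(1+q) in the direction F, so with c = √(1+q) it solves the
Sylvester equation c W + W c = F (`circleIntegral_sylvester`). Since c ≥ 1, the map X ↦ cX + Xc on
kernels is bounded below by the identity. Its inverse therefore has norm at most 1 and depends on
`u` in a Lipschitz way (`one_le_sylv`, `bddLip_NMap`). The same Sylvester operator gives the
Lipschitz bound and the derivative of the square root itself (`norm_pKern_sub_le`,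
`norm_pKern_sub_sub_le`).

In the interaction picture u(t) = e^{-itΔ} a(t) e^{-itΔ} the equation becomes an ordinary
differential equation a' = -i e^{itΔ}(N(u,m) - Vu) e^{itΔ}. Here V collects the exchange and direct
terms of g. The time dependence is only integrable, through ‖m(t)‖₂ and ‖v‖₂‖φ(t)‖₄². With the
nonlinearity cut off outside a ball of radius R = ‖u₀‖ + 1 the field is globally Lipschitz, and
Picard iteration in a weighted norm gives a solution on all of [0,T]
(`exists_isPrimitive_of_lipschitz`). Because V is symmetric it drops out of d/dt ‖a‖², so ‖a‖ can
grow only through ∫‖m‖. Smallness of this integral keeps ‖a‖ ≤ R, and the cut-off is never active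
(`norm_interaction_le`). This is why ε₀ depends on u₀ alone.

Symmetry of the solution rests on symmetry of the nonlinearity (`isSymm_NMap`), an algebraic
identity whose key step is again uniqueness for a Sylvester equation. The two space-time bounds are
L¹L² bounds of the force: the one for u is immediate, and the one for p follows from the chain rule
along a. Indeed p = e^{-itΔ}(√(1+aa*) - 1)e^{itΔ}, and the derivative of the square root has norm at
most 1. The passage from integral equations to distributions is `IsPrimitive.schrodingerEq`. -/

instance fact_two_ne_top : Fact ((2 : ℝ≥0∞) ≠ ⊤) := ⟨by norm_num⟩

section Conj

variable {α : Type*} [MeasurableSpace α] {μ : Measure α}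

lemma star_add_Lp (f g : Lp ℂ 2 μ) : star (f + g) = star f + star g := by
  refine Lp.ext ?_
  filter_upwards [Lp.coeFn_star (f + g), Lp.coeFn_add (star f) (star g), Lp.coeFn_star f,
    Lp.coeFn_star g, Lp.coeFn_add f g] with x h1 h2 h3 h4 h5
  rw [h1, h2, Pi.star_apply, h5, Pi.add_apply, Pi.add_apply, h3, h4, star_add]; rfl

lemma star_smul_Lp (c : ℂ) (f : Lp ℂ 2 μ) : star (c • f) = star c • star f := by
  refine Lp.ext ?_
  filter_upwards [Lp.coeFn_star (c • f), Lp.coeFn_smul (star c) (star f), Lp.coeFn_star f,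
    Lp.coeFn_smul c f] with x h1 h2 h3 h4
  rw [h1, h2, Pi.star_apply, h4, Pi.smul_apply, Pi.smul_apply, h3, star_smul]; rfl

lemma inner_star_star (f g : Lp ℂ 2 μ) : inner ℂ (star f) (star g) = inner ℂ g f := by
  rw [L2.inner_def, L2.inner_def]
  refine integral_congr_ae ?_
  filter_upwards [Lp.coeFn_star f, Lp.coeFn_star g] with x h1 h2
  simp [h1, h2, mul_comm]

lemma norm_star_Lp (f : Lp ℂ 2 μ) : ‖star f‖ = ‖f‖ := by
  have h := inner_star_star f f
  rw [inner_self_eq_norm_sq_to_K, inner_self_eq_norm_sq_to_K] at h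
  have h2 : ‖star f‖ ^ 2 = ‖f‖ ^ 2 := by exact_mod_cast h
  exact (pow_left_inj₀ (norm_nonneg _) (norm_nonneg _) two_ne_zero).1 h2

/-- Complex conjugation on `L²`. -/
def conjL : Lp ℂ 2 μ →L⋆[ℂ] Lp ℂ 2 μ :=
  LinearMap.mkContinuous
    { toFun := fun f => star f
      map_add' := star_add_Lp
      map_smul' := star_smul_Lp } 1 (fun f => by simp [norm_star_Lp])

@[simp] lemma conjL_apply (f : Lp ℂ 2 μ) : conjL f = star f := rfl

end Conj

lemma star_ae_eq {α : Type*} [MeasurableSpace α] {μ : Measure α} (f : Lp ℂ 2 μ) :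
    (star f : Lp ℂ 2 μ) =ᵐ[μ] fun x => (starRingEnd ℂ) (f x) := Lp.coeFn_star f

lemma memLp_tensor (f g : H) :
    MemLp (fun z : E3 × E3 => f z.1 * (starRingEnd ℂ) (g z.2)) 2 volume := by
  refine ⟨?_, ?_⟩
  · exact ((Lp.stronglyMeasurable f).comp_measurable measurable_fst).mul
      (Complex.continuous_conj.comp_stronglyMeasurable
        ((Lp.stronglyMeasurable g).comp_measurable measurable_snd)) |>.aestronglyMeasurable
  · refine lt_top_iff_ne_top.2 fun htop => ?_
    have hsq := sq_eLpNorm_two (μ := (volume : Measure (E3 × E3)))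
      (fun z : E3 × E3 => f z.1 * (starRingEnd ℂ) (g z.2))
    rw [htop] at hsq
    refine absurd hsq.symm (ne_of_lt ?_)
    rw [ENNReal.top_pow two_ne_zero]
    have h : ∀ z : E3 × E3, ‖f z.1 * (starRingEnd ℂ) (g z.2)‖ₑ ^ 2 = ‖f z.1‖ₑ ^ 2 * ‖g z.2‖ₑ ^ 2 :=
      fun z => by rw [enorm_mul, mul_pow, RCLike.enorm_conj]
    simp_rw [h]
    rw [Measure.volume_eq_prod, lintegral_prod_mul (f := fun x => ‖f x‖ₑ ^ 2)
      (g := fun x => ‖g x‖ₑ ^ 2) ((Lp.aestronglyMeasurable f).enorm.pow_const 2)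
      ((Lp.aestronglyMeasurable g).enorm.pow_const 2), ← sq_eLpNorm_two, ← sq_eLpNorm_two]
    exact ENNReal.mul_lt_top (ENNReal.pow_lt_top (Lp.eLpNorm_lt_top f))
      (ENNReal.pow_lt_top (Lp.eLpNorm_lt_top g))

/-- The rank one kernel `f(x) ḡ(y)`. -/
def tensor (f g : H) : Kern := (memLp_tensor f g).toLp _

lemma tensor_ae (f g : H) :
    (tensor f g : E3 × E3 → ℂ) =ᵐ[volume] fun z => f z.1 * (starRingEnd ℂ) (g z.2) :=
  (memLp_tensor f g).coeFn_toLp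

/-- Fubini. Matrix coefficients of an operator become inner products in L²(ℝ⁶), so identities
between kernels and identities between operators can be exchanged freely. -/
lemma inner_tensor (f g : H) (K : Kern) :
    inner ℂ (tensor f g) K = inner ℂ f (kernelOp K g) := by
  have h0 : (fun z : E3 × E3 => inner ℂ (tensor f g z) (K z)) =ᵐ[volume]
      fun z => (starRingEnd ℂ) (f z.1) * (K z * g z.2) := by
    filter_upwards [tensor_ae f g] with z hz
    rw [hz]
    simp only [RCLike.inner_apply, map_mul, RCLike.conj_conj]
    ring
  have hint := (integrable_congr h0).1 (L2.integrable_inner (𝕜 := ℂ) (tensor f g) K)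
  rw [L2.inner_def, L2.inner_def, integral_congr_ae h0]
  refine (integral_prod _ hint).trans ?_
  refine integral_congr_ae ?_
  filter_upwards [kernelOp_apply_ae K g] with x hx
  rw [hx, integral_const_mul, RCLike.inner_apply, mul_comm]

lemma kernelOp_add (K L : Kern) : kernelOp (K + L) = kernelOp K + kernelOp L := by
  ext1 g
  refine ext_inner_left ℂ fun f => ?_
  rw [add_apply, inner_add_right, ← inner_tensor, ← inner_tensor,
    ← inner_tensor, inner_add_right]

lemma kernelOp_smul (c : ℂ) (K : Kern) : kernelOp (c • K) = c • kernelOp K := by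
  ext1 g
  refine ext_inner_left ℂ fun f => ?_
  rw [smul_apply, inner_smul_right, ← inner_tensor,
    ← inner_tensor, inner_smul_right]

lemma norm_kernelOp_le (K : Kern) : ‖kernelOp K‖ ≤ ‖K‖ :=
  LinearMap.mkContinuous_norm_le _ (norm_nonneg _) _

/-- The operator with a given kernel, as a linear map in the kernel. -/
def kernelOpL : Kern →L[ℂ] (H →L[ℂ] H) :=
  LinearMap.mkContinuous
    { toFun := kernelOp
      map_add' := kernelOp_add
      map_smul' := kernelOp_smul } 1 (fun K => by simpa using norm_kernelOp_le K)

@[simp] lemma kernelOpL_apply (K : Kern) : kernelOpL K = kernelOp K := rfl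

lemma kernelOp_sub (K L : Kern) : kernelOp (K - L) = kernelOp K - kernelOp L :=
  map_sub kernelOpL K L

@[simp] lemma kernelOp_zero : kernelOp 0 = 0 := map_zero kernelOpL

/-- The null set of x on which ∫ K(x,y) g(y) dy fails to vanish depends on g. Separability reduces
to countably many g, hence to one null set; off it the slice K(x,·) is orthogonal to a dense
sequence. -/
lemma eq_zero_of_kernelOp_eq_zero {K : Kern} (hK : kernelOp K = 0) : K = 0 := by
  have h1 : ∀ g : H, ∀ᵐ x : E3, ∫ y : E3, K (x, y) * g y = 0 := by
    intro g
    have h2 : kernelOp K g = 0 := by rw [hK]; rfl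
    filter_upwards [kernelOp_apply_ae K g, Lp.coeFn_zero ℂ 2 (volume : Measure E3)] with x hx h0
    rw [← hx, h2, h0]; rfl
  have h3 : ∀ᵐ x : E3, ∀ n : ℕ, ∫ y : E3, K (x, y) * TopologicalSpace.denseSeq H n y = 0 :=
    ae_all_iff.2 fun n => h1 _
  have h4 : ∀ᵐ x : E3, ∀ᵐ y : E3, K (x, y) = 0 := by
    filter_upwards [h3, ae_slice_memLp K] with x hx hm
    have hs : MemLp (fun y : E3 => (starRingEnd ℂ) (K (x, y))) 2 volume := hm.star
    have h5 : ∀ g : H, inner ℂ (hs.toLp _) g = ∫ y : E3, K (x, y) * g y := by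
      intro g
      rw [L2.inner_def]
      refine integral_congr_ae ?_
      filter_upwards [hs.coeFn_toLp] with y hy
      rw [hy]
      simp [mul_comm]
    have h6 : ∀ g : H, inner ℂ (hs.toLp _) g = 0 := by
      intro g
      refine (TopologicalSpace.denseRange_denseSeq H).induction_on
        (p := fun g => inner ℂ (hs.toLp _) g = 0) g ?_ ?_
      · exact isClosed_eq (by fun_prop) continuous_const
      · intro n; rw [h5]; exact hx n
    have h7 : hs.toLp _ = 0 := inner_self_eq_zero.1 (h6 _)
    have h8 := hs.coeFn_toLp
    rw [h7] at h8
    filter_upwards [h8, Lp.coeFn_zero ℂ 2 (volume : Measure E3)] with y hy h0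
    rw [h0] at hy
    simpa using hy.symm
  refine Lp.ext ?_
  have h9 : ∀ᵐ z : E3 × E3 ∂((volume : Measure E3).prod volume), z ∈ {z | K z = 0} := by
    rw [Measure.ae_prod_mem_iff_ae_ae_mem]
    · exact h4
    · exact (Lp.stronglyMeasurable K).measurable (measurableSet_singleton 0)
  filter_upwards [h9, Lp.coeFn_zero ℂ 2 (volume : Measure (E3 × E3))] with z hz h0
  rw [h0]; exact hz

lemma kernelOp_injective : Function.Injective kernelOp := by
  intro K L h
  refine sub_eq_zero.1 (eq_zero_of_kernelOp_eq_zero ?_)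
  rw [kernelOp_sub, h, sub_self]

lemma inner_tensor_tensor (f g f' g' : H) :
    inner ℂ (tensor f g) (tensor f' g') = inner ℂ f f' * inner ℂ g' g := by
  have h0 : (fun z : E3 × E3 => inner ℂ (tensor f g z) (tensor f' g' z)) =ᵐ[volume]
      fun z => inner ℂ (f z.1) (f' z.1) * inner ℂ (g' z.2) (g z.2) := by
    filter_upwards [tensor_ae f g, tensor_ae f' g'] with z hz hz'
    rw [hz, hz']
    simp only [RCLike.inner_apply, map_mul, RCLike.conj_conj]
    ring
  rw [L2.inner_def, L2.inner_def, L2.inner_def, integral_congr_ae h0]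
  exact integral_prod_mul (fun x => inner ℂ (f x) (f' x)) (fun y => inner ℂ (g' y) (g y))

lemma kernelOp_tensor (f g h : H) : kernelOp (tensor f g) h = inner ℂ g h • f := by
  refine ext_inner_left ℂ fun k => ?_
  rw [← inner_tensor, inner_tensor_tensor, inner_smul_right, mul_comm]

/-! ### Transposed and adjoint kernels -/

/-- The transposed kernel `K(y, x)`. -/
def transK : Kern →ₗᵢ[ℂ] Kern :=
  Lp.compMeasurePreservingₗᵢ ℂ Prod.swap Measure.measurePreserving_swap

lemma transK_ae (K : Kern) : (transK K : E3 × E3 → ℂ) =ᵐ[volume] fun z => K z.swap :=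
  Lp.coeFn_compMeasurePreserving K Measure.measurePreserving_swap

lemma ae_swap {P : E3 × E3 → Prop} (h : ∀ᵐ z, P z) : ∀ᵐ z : E3 × E3, P z.swap :=
  (Measure.measurePreserving_swap (μ := (volume : Measure E3))
    (ν := (volume : Measure E3))).quasiMeasurePreserving.ae h

lemma transK_transK (K : Kern) : transK (transK K) = K := by
  refine Lp.ext ?_
  filter_upwards [transK_ae (transK K), ae_swap (transK_ae K)] with z h1 h2
  rw [h1, h2, Prod.swap_swap]

lemma isSymm_iff {K : Kern} : IsSymm K ↔ transK K = K := by
  constructor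
  · intro h
    refine Lp.ext ?_
    filter_upwards [transK_ae K, h] with z h1 h2
    rw [h1, h2]
  · intro h
    have h1 := transK_ae K
    rw [h] at h1
    filter_upwards [h1] with z hz
    exact hz.symm

/-- The adjoint kernel `K̄(y, x)`. -/
def adjK (K : Kern) : Kern := star (transK K)

lemma adjK_ae (K : Kern) :
    (adjK K : E3 × E3 → ℂ) =ᵐ[volume] fun z => (starRingEnd ℂ) (K z.swap) := by
  filter_upwards [star_ae_eq (transK K), transK_ae K] with z h1 h2
  rw [adjK, h1, h2]

lemma adjK_eq_trans_star (K : Kern) : adjK K = transK (star K) := by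
  refine Lp.ext ?_
  filter_upwards [adjK_ae K, transK_ae (star K), ae_swap (star_ae_eq K)] with z h1 h2 h3
  rw [h1, h2, h3]

lemma norm_adjK (K : Kern) : ‖adjK K‖ = ‖K‖ := by
  rw [adjK, norm_star_Lp, LinearIsometry.norm_map]

lemma adjK_add (K L : Kern) : adjK (K + L) = adjK K + adjK L := by
  rw [adjK, map_add, star_add_Lp]; rfl

lemma adjK_smul (c : ℂ) (K : Kern) : adjK (c • K) = star c • adjK K := by
  rw [adjK, map_smul, star_smul_Lp]; rfl

lemma adjK_adjK (K : Kern) : adjK (adjK K) = K := by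
  rw [adjK_eq_trans_star, adjK, star_star, transK_transK]

lemma IsSymm.adjK_eq {K : Kern} (h : IsSymm K) : adjK K = star K := by
  rw [adjK, isSymm_iff.1 h]

lemma kernelOp_adjK (K : Kern) : kernelOp (adjK K) = ContinuousLinearMap.adjoint (kernelOp K) := by
  refine (ContinuousLinearMap.eq_adjoint_iff _ _).2 fun f g => ?_
  rw [← inner_conj_symm, ← inner_tensor, ← inner_tensor, L2.inner_def, L2.inner_def,
    ← integral_conj]
  have h := (Measure.measurePreserving_swap (μ := (volume : Measure E3))
    (ν := (volume : Measure E3))).integral_comp MeasurableEquiv.prodComm.measurableEmbedding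
    (fun z => inner ℂ (tensor f g z) (K z))
  refine Eq.trans ?_ h
  refine integral_congr_ae ?_
  filter_upwards [tensor_ae g f, ae_swap (tensor_ae f g), adjK_ae K] with z h1 h2 h3
  rw [h1, h2, h3]
  simp [mul_comm]

/-- The complex conjugate `f ↦ conj (A (conj f))` of an operator. -/
def barOp (A : H →L[ℂ] H) : H →L[ℂ] H := conjL.comp (A.comp conjL)

lemma barOp_apply (A : H →L[ℂ] H) (f : H) : barOp A f = star (A (star f)) := rfl

lemma kernelOp_star (K : Kern) : kernelOp (star K) = barOp (kernelOp K) := by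
  ext1 f
  rw [barOp_apply]
  refine Lp.ext ?_
  filter_upwards [kernelOp_apply_ae (star K) f, star_ae_eq (kernelOp K (star f)),
    kernelOp_apply_ae K (star f), Measure.ae_ae_of_ae_prod (star_ae_eq K)] with x h1 h2 h3 h4
  rw [h1, h2, h3, ← integral_conj]
  refine integral_congr_ae ?_
  filter_upwards [h4, star_ae_eq f] with y h5 h6
  rw [h5, h6]
  simp

lemma barOp_mul (A B : H →L[ℂ] H) : barOp (A * B) = barOp A * barOp B := by
  ext1 f
  change star (A (B (star f))) = star (A (star (star (B (star f)))))
  rw [star_star]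

lemma barOp_add (A B : H →L[ℂ] H) : barOp (A + B) = barOp A + barOp B := by
  ext1 f
  simp only [barOp_apply, add_apply, star_add_Lp]

lemma barOp_smul (c : ℂ) (A : H →L[ℂ] H) : barOp (c • A) = star c • barOp A := by
  ext1 f
  simp only [barOp_apply, smul_apply, star_smul_Lp]

lemma barOp_neg (A : H →L[ℂ] H) : barOp (-A) = -barOp A := by
  have h := barOp_smul (-1) A
  simpa using h

lemma barOp_sub (A B : H →L[ℂ] H) : barOp (A - B) = barOp A - barOp B := by
  rw [sub_eq_add_neg, barOp_add, barOp_neg, sub_eq_add_neg]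

@[simp] lemma barOp_one : barOp 1 = 1 := by
  ext1 f
  simp [barOp_apply]

@[simp] lemma barOp_barOp (A : H →L[ℂ] H) : barOp (barOp A) = A := by
  ext1 f
  simp only [barOp_apply, star_star]

lemma star_barOp (A : H →L[ℂ] H) : star (barOp A) = barOp (star A) := by
  rw [ContinuousLinearMap.star_eq_adjoint, eq_comm, ContinuousLinearMap.eq_adjoint_iff]
  intro f g
  rw [barOp_apply, barOp_apply, ← inner_star_star, star_star,
    ContinuousLinearMap.star_eq_adjoint, ContinuousLinearMap.adjoint_inner_right,
    ← inner_star_star, star_star]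

/-! ### Left and right multiplication of kernels by bounded operators -/

section Basis

variable {ι : Type*} (b : HilbertBasis ι ℂ H)

lemma orthonormal_tensor : Orthonormal ℂ (fun p : ι × ι => tensor (b p.1) (b p.2)) := by
  classical
  rw [orthonormal_iff_ite]
  rintro ⟨i, j⟩ ⟨i', j'⟩
  have hb := orthonormal_iff_ite.1 b.orthonormal
  rw [inner_tensor_tensor, hb, hb]
  by_cases h1 : i = i' <;> by_cases h2 : j = j' <;> simp [h1, h2, Prod.ext_iff, eq_comm]

lemma HilbertBasis.op_ext {A B : H →L[ℂ] H} (h : ∀ j, A (b j) = B (b j)) : A = B := by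
  refine ContinuousLinearMap.ext_on (s := range b) ?_ ?_
  · have := b.dense_span
    rw [← Submodule.dense_iff_topologicalClosure_eq_top] at this
    exact this
  · rintro _ ⟨j, rfl⟩
    exact h j

lemma HilbertBasis.vec_ext {x y : H} (h : ∀ i, inner ℂ (b i) x = inner ℂ (b i) y) : x = y := by
  refine b.repr.injective (lp.ext (funext fun i => ?_))
  rw [b.repr_apply_apply, b.repr_apply_apply, h]

/-- The orthonormal basis `b_i(x) b̄_j(y)` of `L²(ℝ⁶)`. -/
def tensorBasis : HilbertBasis (ι × ι) ℂ Kern :=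
  HilbertBasis.mkOfOrthogonalEqBot (orthonormal_tensor b) (by
    rw [Submodule.eq_bot_iff]
    intro K hK
    refine eq_zero_of_kernelOp_eq_zero (HilbertBasis.op_ext b fun j => ?_)
    refine HilbertBasis.vec_ext b fun i => ?_
    rw [← inner_tensor]
    have := (Submodule.mem_orthogonal _ _).1 hK (tensor (b i) (b j))
      (Submodule.subset_span ⟨(i, j), rfl⟩)
    rw [this]
    simp)

lemma tensorBasis_apply (p : ι × ι) : tensorBasis b p = tensor (b p.1) (b p.2) := by
  rw [tensorBasis, HilbertBasis.coe_mkOfOrthogonalEqBot]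

lemma HilbertBasis.hasSum_norm_inner_sq {κ X : Type*} [NormedAddCommGroup X]
    [InnerProductSpace ℂ X] (b : HilbertBasis κ ℂ X) (x : X) :
    HasSum (fun i => ‖inner ℂ (b i) x‖ ^ 2) (‖x‖ ^ 2) := by
  have h := b.hasSum_inner_mul_inner x x
  have h2 := (Complex.hasSum_re h)
  have h3 : (inner ℂ x x).re = ‖x‖ ^ 2 := inner_self_eq_norm_sq (𝕜 := ℂ) x
  rw [h3] at h2
  refine h2.congr_fun ?_
  intro i
  rw [← inner_conj_symm, RCLike.norm_conj, Complex.mul_conj, Complex.ofReal_re,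
    Complex.normSq_eq_norm_sq]

/-- The `L²` norm of a kernel is the Hilbert–Schmidt norm of its operator. -/
lemma hasSum_norm_sq_kernelOp (K : Kern) :
    HasSum (fun j => ‖kernelOp K (b j)‖ ^ 2) (‖K‖ ^ 2) := by
  have h := HilbertBasis.hasSum_norm_inner_sq (tensorBasis b) K
  rw [← (Equiv.prodComm ι ι).hasSum_iff] at h
  refine h.prod_fiberwise fun j => ?_
  have h2 := HilbertBasis.hasSum_norm_inner_sq b (kernelOp K (b j))
  refine h2.congr_fun ?_
  intro i
  simp only [Function.comp_apply, Equiv.prodComm_apply, Prod.swap_prod_mk, tensorBasis_apply,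
    inner_tensor]

/-- By Parseval in each column the matrix of B is square summable, so it is the coefficient sequence
of some kernel in the basis `tensorBasis`. -/
lemma exists_kernel {B : H →L[ℂ] H} (hB : Summable fun j => ‖B (b j)‖ ^ 2) :
    ∃ K : Kern, kernelOp K = B := by
  have hs : Summable fun p : ι × ι => ‖inner ℂ (b p.1) (B (b p.2))‖ ^ 2 := by
    rw [← (Equiv.prodComm ι ι).summable_iff]
    refine (summable_prod_of_nonneg (fun p => sq_nonneg _)).2 ⟨fun j => ?_, ?_⟩
    · exact (HilbertBasis.hasSum_norm_inner_sq b (B (b j))).summable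
    · refine hB.congr fun j => ?_
      exact (HilbertBasis.hasSum_norm_inner_sq b (B (b j))).tsum_eq.symm
  have hm : Memℓp (fun p : ι × ι => inner ℂ (b p.1) (B (b p.2))) 2 := by
    refine memℓp_gen ?_
    simpa using hs
  refine ⟨(tensorBasis b).repr.symm ⟨_, hm⟩, HilbertBasis.op_ext b fun j => ?_⟩
  refine HilbertBasis.vec_ext b fun i => ?_
  rw [← inner_tensor, ← tensorBasis_apply b (i, j), ← HilbertBasis.repr_apply_apply,
    LinearIsometryEquiv.apply_symm_apply]

end Basis

/-- The Hilbert–Schmidt class is a left ideal: ‖A K b_j‖ ≤ ‖A‖ ‖K b_j‖ column by column. -/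
lemma exists_lmul (A : H →L[ℂ] H) (K : Kern) :
    ∃ L : Kern, kernelOp L = A * kernelOp K ∧ ‖L‖ ≤ ‖A‖ * ‖K‖ := by
  obtain ⟨w, b, -⟩ := exists_hilbertBasis ℂ H
  have hK := hasSum_norm_sq_kernelOp b K
  have hle : ∀ j, ‖(A * kernelOp K) (b j)‖ ^ 2 ≤ ‖A‖ ^ 2 * ‖kernelOp K (b j)‖ ^ 2 := by
    intro j
    rw [← mul_pow]
    exact pow_le_pow_left₀ (norm_nonneg _) (A.le_opNorm _) 2
  obtain ⟨L, hL⟩ := exists_kernel b (B := A * kernelOp K)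
    (Summable.of_nonneg_of_le (fun _ => by positivity) hle (hK.summable.mul_left _))
  refine ⟨L, hL, ?_⟩
  have h1 := hasSum_norm_sq_kernelOp b L
  rw [hL] at h1
  have h2 := hasSum_le hle h1 (hK.mul_left (‖A‖ ^ 2))
  rw [← mul_pow] at h2
  exact (pow_le_pow_iff_left₀ (norm_nonneg _) (by positivity) two_ne_zero).1 h2

/-- The kernel of `A K`, not yet as a bilinear map. -/
def lmulFun (A : H →L[ℂ] H) (K : Kern) : Kern := (exists_lmul A K).choose

lemma kernelOp_lmulFun (A : H →L[ℂ] H) (K : Kern) : kernelOp (lmulFun A K) = A * kernelOp K :=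
  (exists_lmul A K).choose_spec.1

lemma norm_lmulFun_le (A : H →L[ℂ] H) (K : Kern) : ‖lmulFun A K‖ ≤ ‖A‖ * ‖K‖ :=
  (exists_lmul A K).choose_spec.2

/-- The kernel of `A K` for a bounded operator `A` and a kernel `K`. -/
def lmul : (H →L[ℂ] H) →L[ℂ] Kern →L[ℂ] Kern :=
  LinearMap.mkContinuous₂
    (LinearMap.mk₂ ℂ lmulFun
      (fun A B K => kernelOp_injective (by
        simp only [kernelOp_add, kernelOp_lmulFun, add_mul]))
      (fun c A K => kernelOp_injective (by
        simp only [kernelOp_smul, kernelOp_lmulFun, smul_mul_assoc]))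
      (fun A K L => kernelOp_injective (by
        simp only [kernelOp_add, kernelOp_lmulFun, mul_add]))
      (fun c A K => kernelOp_injective (by
        simp only [kernelOp_smul, kernelOp_lmulFun, mul_smul_comm])))
    1 (fun A K => by
      rw [one_mul]
      exact norm_lmulFun_le A K)

@[simp] lemma kernelOp_lmul (A : H →L[ℂ] H) (K : Kern) :
    kernelOp (lmul A K) = A * kernelOp K := kernelOp_lmulFun A K

lemma norm_lmul_apply_le (A : H →L[ℂ] H) (K : Kern) : ‖lmul A K‖ ≤ ‖A‖ * ‖K‖ :=
  norm_lmulFun_le A K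

lemma star_kernelOp (K : Kern) : star (kernelOp K) = kernelOp (adjK K) := by
  rw [kernelOp_adjK, ContinuousLinearMap.star_eq_adjoint]

lemma kernelOp_adjK_lmul (A : H →L[ℂ] H) (K : Kern) :
    kernelOp (adjK (lmul (star A) (adjK K))) = kernelOp K * A := by
  rw [← star_kernelOp, kernelOp_lmul, star_mul, star_star, star_kernelOp, adjK_adjK]

/-- The kernel of `K A` for a bounded operator `A` and a kernel `K`. -/
def rmul : (H →L[ℂ] H) →L[ℂ] Kern →L[ℂ] Kern :=
  LinearMap.mkContinuous₂
    (LinearMap.mk₂ ℂ (fun A K => adjK (lmul (star A) (adjK K)))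
      (fun A B K => kernelOp_injective (by
        simp only [kernelOp_add, kernelOp_adjK_lmul, mul_add]))
      (fun c A K => kernelOp_injective (by
        simp only [kernelOp_smul, kernelOp_adjK_lmul, mul_smul_comm]))
      (fun A K L => kernelOp_injective (by
        simp only [kernelOp_add, kernelOp_adjK_lmul, add_mul]))
      (fun c A K => kernelOp_injective (by
        simp only [kernelOp_smul, kernelOp_adjK_lmul, smul_mul_assoc])))
    1 (fun A K => by
      rw [one_mul]
      refine (norm_adjK _).trans_le ((norm_lmul_apply_le _ _).trans_eq ?_)
      rw [ContinuousLinearMap.star_eq_adjoint, LinearIsometryEquiv.norm_map, norm_adjK])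

lemma rmul_eq_adjK (A : H →L[ℂ] H) (K : Kern) :
    rmul A K = adjK (lmul (star A) (adjK K)) := rfl

@[simp] lemma kernelOp_rmul (A : H →L[ℂ] H) (K : Kern) :
    kernelOp (rmul A K) = kernelOp K * A := kernelOp_adjK_lmul A K

lemma norm_rmul_apply_le (A : H →L[ℂ] H) (K : Kern) : ‖rmul A K‖ ≤ ‖A‖ * ‖K‖ := by
  rw [rmul_eq_adjK, norm_adjK]
  refine (norm_lmul_apply_le _ _).trans_eq ?_
  rw [ContinuousLinearMap.star_eq_adjoint, LinearIsometryEquiv.norm_map, norm_adjK]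

lemma lmul_mul (A B : H →L[ℂ] H) : lmul (A * B) = lmul A * lmul B := by
  ext1 K
  refine kernelOp_injective ?_
  change _ = kernelOp (lmul A (lmul B K))
  simp only [kernelOp_lmul, mul_assoc]

lemma rmul_mul (A B : H →L[ℂ] H) : rmul (A * B) = rmul B * rmul A := by
  ext1 K
  refine kernelOp_injective ?_
  change _ = kernelOp (rmul B (rmul A K))
  simp only [kernelOp_rmul, mul_assoc]

@[simp] lemma lmul_one : lmul 1 = 1 := by
  ext1 K
  exact kernelOp_injective (by simp)

@[simp] lemma rmul_one : rmul 1 = 1 := by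
  ext1 K
  exact kernelOp_injective (by simp)

lemma lmul_rmul_comm (A B : H →L[ℂ] H) (K : Kern) : lmul A (rmul B K) = rmul B (lmul A K) :=
  kernelOp_injective (by simp [mul_assoc])

/-! ### The trace inner product and the adjoints of left and right multiplication. -/

lemma hasSum_inner_kernelOp {ι : Type*} (b : HilbertBasis ι ℂ H) (K L : Kern) :
    HasSum (fun j : ι => inner ℂ (kernelOp K (b j)) (kernelOp L (b j))) (inner ℂ K L) := by
  have h : HasSum (fun p : ι × ι => inner ℂ (kernelOp K (b p.2)) (b p.1)
      * inner ℂ (b p.1) (kernelOp L (b p.2))) (inner ℂ K L) := by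
    have h0 := (tensorBasis b).hasSum_inner_mul_inner K L
    refine h0.congr_fun fun p => ?_
    rw [tensorBasis_apply, inner_tensor, ← inner_conj_symm K, inner_tensor, inner_conj_symm]
  have h' : HasSum (fun p : ι × ι => inner ℂ (kernelOp K (b p.1)) (b p.2)
      * inner ℂ (b p.2) (kernelOp L (b p.1))) (inner ℂ K L) :=
    (Equiv.prodComm ι ι).hasSum_iff.2 h
  have h2 : ∀ j, HasSum (fun i => inner ℂ (kernelOp K (b j)) (b i)
      * inner ℂ (b i) (kernelOp L (b j))) (inner ℂ (kernelOp K (b j)) (kernelOp L (b j))) :=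
    fun j => b.hasSum_inner_mul_inner _ _
  exact HasSum.prod_fiberwise h' h2

lemma inner_lmul_right (A : H →L[ℂ] H) (K L : Kern) :
    inner ℂ K (lmul A L) = inner ℂ (lmul (star A) K) L := by
  obtain ⟨w, b, -⟩ := exists_hilbertBasis ℂ H
  have h1 := hasSum_inner_kernelOp b K (lmul A L)
  have h2 := hasSum_inner_kernelOp b (lmul (star A) K) L
  have h3 : (fun j => inner ℂ (kernelOp K (b j)) (kernelOp (lmul A L) (b j))) =
      fun j => inner ℂ (kernelOp (lmul (star A) K) (b j)) (kernelOp L (b j)) := by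
    funext j
    rw [kernelOp_lmul, kernelOp_lmul, ContinuousLinearMap.star_eq_adjoint]
    exact (ContinuousLinearMap.adjoint_inner_left A _ _).symm
  rw [h3] at h1
  exact h1.unique h2

lemma inner_adjK (K L : Kern) : inner ℂ (adjK K) (adjK L) = inner ℂ L K := by
  rw [adjK, adjK, inner_star_star, LinearIsometry.inner_map_map]

lemma inner_rmul_right (A : H →L[ℂ] H) (K L : Kern) :
    inner ℂ K (rmul A L) = inner ℂ (rmul (star A) K) L := by
  have h1 := inner_adjK (adjK K) (lmul (star A) (adjK L))
  have h2 := inner_adjK (lmul (star (star A)) (adjK K)) (adjK L)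
  rw [adjK_adjK] at h1 h2
  rw [rmul_eq_adjK, rmul_eq_adjK, h1, h2, inner_lmul_right (star (star A)), star_star]

lemma star_lmul (A : H →L[ℂ] H) : star (lmul A) = lmul (star A) := by
  rw [ContinuousLinearMap.star_eq_adjoint, eq_comm, ContinuousLinearMap.eq_adjoint_iff]
  intro K L
  rw [inner_lmul_right]

lemma star_rmul (A : H →L[ℂ] H) : star (rmul A) = rmul (star A) := by
  rw [ContinuousLinearMap.star_eq_adjoint, eq_comm, ContinuousLinearMap.eq_adjoint_iff]
  intro K L
  rw [inner_rmul_right]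

/-- Transposition is the composite of adjoint and complex conjugation. This form turns symmetry of a
kernel into algebra with `star` and `barOp`. -/
lemma isSymm_iff_kernelOp {K : Kern} : IsSymm K ↔ star (kernelOp K) = barOp (kernelOp K) := by
  rw [isSymm_iff, star_kernelOp, ← kernelOp_star, kernelOp_injective.eq_iff, adjK]
  exact ⟨fun h => by rw [h], fun h => star_injective h⟩

/-! ### Composition of kernels -/

lemma integrable_mul_mul_slice (K L : Kern) (f : H) :
    ∀ᵐ x : E3, Integrable (fun p : E3 × E3 => K (x, p.1) * (L p * f p.2)) volume := by
  filter_upwards [ae_slice_memLp K] with x hx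
  have h1 : MemLp (fun y : E3 => (starRingEnd ℂ) (K (x, y))) 2 volume := hx.star
  have h2 := L2.integrable_inner (𝕜 := ℂ) (tensor (h1.toLp _) f) L
  refine h2.congr ?_
  have h3 : ∀ᵐ p : E3 × E3, h1.toLp _ p.1 = (starRingEnd ℂ) (K (x, p.1)) :=
    Measure.quasiMeasurePreserving_fst.ae h1.coeFn_toLp
  filter_upwards [tensor_ae (h1.toLp _) f, h3] with p hp hp3
  rw [hp, hp3]
  simp only [RCLike.inner_apply, map_mul, RCLike.conj_conj]
  ring

lemma stronglyMeasurable_comp_kernel (K L : Kern) :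
    StronglyMeasurable fun z : E3 × E3 => ∫ w : E3, K (z.1, w) * L (w, z.2) := by
  have h : StronglyMeasurable (Function.uncurry fun (z : E3 × E3) (w : E3) =>
      K (z.1, w) * L (w, z.2)) :=
    ((Lp.stronglyMeasurable K).comp_measurable (g := fun p : (E3 × E3) × E3 => (p.1.1, p.2))
      (by fun_prop)).mul
    ((Lp.stronglyMeasurable L).comp_measurable (g := fun p : (E3 × E3) × E3 => (p.2, p.1.2))
      (by fun_prop))
  exact h.integral_prod_right

lemma memLp_comp_kernel (K L : Kern) :
    MemLp (fun z : E3 × E3 => ∫ w : E3, K (z.1, w) * L (w, z.2)) 2 volume := by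
  refine ⟨(stronglyMeasurable_comp_kernel K L).aestronglyMeasurable, ?_⟩
  refine lt_top_iff_ne_top.2 fun htop => ?_
  have hsq := sq_eLpNorm_two (μ := (volume : Measure (E3 × E3)))
    (fun z : E3 × E3 => ∫ w : E3, K (z.1, w) * L (w, z.2))
  rw [htop, ENNReal.top_pow two_ne_zero] at hsq
  refine absurd hsq.symm (ne_of_lt ?_)
  have hle : ∀ z : E3 × E3, ‖∫ w : E3, K (z.1, w) * L (w, z.2)‖ₑ ^ 2 ≤
      (∫⁻ w : E3, ‖K (z.1, w)‖ₑ ^ 2) * ∫⁻ w : E3, ‖L (w, z.2)‖ₑ ^ 2 := by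
    intro z
    have hK : Measurable fun w : E3 => K (z.1, w) :=
      (Lp.stronglyMeasurable K).measurable.comp measurable_prodMk_left
    have hL : Measurable fun w : E3 => L (w, z.2) :=
      (Lp.stronglyMeasurable L).measurable.comp measurable_prodMk_right
    refine (pow_le_pow_left' (enorm_integral_le_lintegral_enorm _) 2).trans ?_
    simp only [enorm_mul]
    exact sq_lintegral_mul_le hK.enorm.aemeasurable hL.enorm.aemeasurable
  refine (lintegral_mono hle).trans_lt ?_
  have hmK : Measurable fun x : E3 => ∫⁻ w : E3, ‖K (x, w)‖ₑ ^ 2 :=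
    Measurable.lintegral_prod_right' (f := fun p : E3 × E3 => ‖K p‖ₑ ^ 2)
      ((Lp.stronglyMeasurable K).measurable.enorm.pow_const 2)
  have hmL : Measurable fun y : E3 => ∫⁻ w : E3, ‖L (w, y)‖ₑ ^ 2 :=
    Measurable.lintegral_prod_left' (f := fun p : E3 × E3 => ‖L p‖ₑ ^ 2)
      ((Lp.stronglyMeasurable L).measurable.enorm.pow_const 2)
  refine (lintegral_prod_mul (μ := (volume : Measure E3)) (ν := (volume : Measure E3))
    hmK.aemeasurable hmL.aemeasurable).trans_lt ?_
  refine ENNReal.mul_lt_top ?_ ?_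
  · rw [lintegral_slice]
    exact ENNReal.pow_lt_top (Lp.eLpNorm_lt_top K)
  · have h1 := lintegral_prod_symm (μ := (volume : Measure E3)) (ν := (volume : Measure E3))
      (fun p : E3 × E3 => ‖L p‖ₑ ^ 2) ((Lp.aestronglyMeasurable L).enorm.pow_const 2)
    rw [← h1]
    refine (sq_eLpNorm_two (μ := (volume : Measure (E3 × E3))) L).symm.trans_lt ?_
    exact ENNReal.pow_lt_top (Lp.eLpNorm_lt_top L)

/-- `lmul` comes from an abstract existence statement; this identifies it with the pointwise
composition integral that occurs in `lowerOrder`. -/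
lemma lmul_kernelOp_ae (K L : Kern) :
    (lmul (kernelOp K) L : E3 × E3 → ℂ) =ᵐ[volume]
      fun z => ∫ w : E3, K (z.1, w) * L (w, z.2) := by
  have hm := memLp_comp_kernel K L
  have : lmul (kernelOp K) L = hm.toLp _ := by
    refine kernelOp_injective ?_
    rw [kernelOp_lmul]
    ext1 f
    refine Lp.ext ?_
    refine (kernelOp_apply_ae K (kernelOp L f)).trans ?_
    filter_upwards [kernelOp_apply_ae (hm.toLp _) f, integrable_mul_mul_slice K L f,
      Measure.ae_ae_of_ae_prod hm.coeFn_toLp] with x h1 h2 h3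
    rw [h1]
    have e1 : ∫ y : E3, hm.toLp _ (x, y) * f y = ∫ y : E3, ∫ w : E3, K (x, w) * (L (w, y) * f y) := by
      refine integral_congr_ae ?_
      filter_upwards [h3] with y hy
      rw [hy, ← integral_mul_const]
      simp only [mul_assoc]
    have e2 : ∫ w : E3, K (x, w) * kernelOp L f w = ∫ w : E3, ∫ y : E3, K (x, w) * (L (w, y) * f y) := by
      refine integral_congr_ae ?_
      filter_upwards [kernelOp_apply_ae L f] with w hw
      rw [hw, ← integral_const_mul]
    rw [e1, e2]
    exact integral_integral_swap (f := fun w y => K (x, w) * (L (w, y) * f y)) h2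
  rw [this]
  exact hm.coeFn_toLp

lemma rmul_kernelOp_ae (K L : Kern) :
    (rmul (kernelOp K) L : E3 × E3 → ℂ) =ᵐ[volume]
      fun z => ∫ w : E3, L (z.1, w) * K (w, z.2) := by
  have : rmul (kernelOp K) L = lmul (kernelOp L) K := kernelOp_injective (by simp)
  rw [this]
  exact lmul_kernelOp_ae L K

/-! ### Operators bounded below by the identity -/

section BoundedBelow

variable {X : Type*} [NormedAddCommGroup X] [InnerProductSpace ℂ X]

/-- ‖x‖² ≤ Re⟨Tx, x⟩ ≤ ‖Tx‖ ‖x‖. This is the source of every bound by 1 on inverses below. -/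
lemma norm_le_norm_apply_of_one_le {T : X →L[ℂ] X} (hT : 1 ≤ T) (x : X) : ‖x‖ ≤ ‖T x‖ := by
  have h1 : 0 ≤ (inner ℂ ((T - 1) x) x).re :=
    ((ContinuousLinearMap.le_def 1 T).1 hT).re_inner_nonneg_left x
  have h2 : (T - 1) x = T x - x := rfl
  rw [h2, inner_sub_left, Complex.sub_re] at h1
  have h3 : (inner ℂ x x).re = ‖x‖ ^ 2 := inner_self_eq_norm_sq (𝕜 := ℂ) x
  have h4 : (inner ℂ (T x) x).re ≤ ‖T x‖ * ‖x‖ := re_inner_le_norm (𝕜 := ℂ) _ _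
  rcases (norm_nonneg x).eq_or_lt with h0 | h0
  · rw [← h0]; exact norm_nonneg _
  · nlinarith

variable [CompleteSpace X]

lemma isUnit_of_one_le {T : X →L[ℂ] X} (hT : 1 ≤ T) : IsUnit T :=
  CStarAlgebra.isUnit_of_le 1 hT

lemma norm_inverse_le_one {T : X →L[ℂ] X} (hT : 1 ≤ T) : ‖Ring.inverse T‖ ≤ 1 := by
  refine ContinuousLinearMap.opNorm_le_bound _ zero_le_one fun x => ?_
  rw [one_mul]
  refine (norm_le_norm_apply_of_one_le hT _).trans_eq ?_
  have h := Ring.mul_inverse_cancel T (isUnit_of_one_le hT)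
  change ‖(T * Ring.inverse T) x‖ = _
  rw [h]; rfl

lemma exists_eq_star_mul_self {T : X →L[ℂ] X} (hT : 0 ≤ T) : ∃ d, T = star d * d :=
  CStarAlgebra.nonneg_iff_eq_star_mul_self.1 hT

lemma opSqrt_mul_self {T : X →L[ℂ] X} (hT : 0 ≤ T) : opSqrt T * opSqrt T = T :=
  CFC.sqrt_mul_sqrt_self T hT

lemma opSqrt_unique {S T : X →L[ℂ] X} (h : S * S = T) (hS : 0 ≤ S) : opSqrt T = S :=
  CFC.sqrt_unique h hS

lemma one_le_opSqrt {T : X →L[ℂ] X} (hT : 1 ≤ T) : 1 ≤ opSqrt T := by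
  have h := CFC.sqrt_le_sqrt (1 : X →L[ℂ] X) T hT
  rwa [CFC.sqrt_one] at h

lemma isSelfAdjoint_of_one_le {T : X →L[ℂ] X} (hT : 1 ≤ T) : star T = T :=
  (IsSelfAdjoint.of_nonneg (zero_le_one.trans hT)).star_eq

/-- The solution of the Sylvester equation `a X + X b = Y` is unique. -/
lemma sylvester_unique {a b S T : X →L[ℂ] X} (ha : 1 ≤ a) (hb : 1 ≤ b)
    (h : a * S + S * b = a * T + T * b) : S = T := by
  set D := S - T with hD
  have h1 : a * D = -(D * b) := by
    rw [hD, mul_sub, sub_mul, neg_sub, sub_eq_sub_iff_add_eq_add, h, add_comm]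
  have hpos : 0 ≤ star D * a * D := star_left_conjugate_nonneg (zero_le_one.trans ha) D
  have h2 : star D * a * D = -(star D * D * b) := by
    rw [mul_assoc, h1, mul_neg, mul_assoc]
  -- D*Db = -D*aD is self-adjoint, so D*D commutes with b. A product of commuting positive operators
  -- is positive, while -D*aD is negative; hence both vanish.
  have hsa : star (star D * D * b) = star D * D * b := by
    rw [← neg_inj, ← star_neg, ← h2]
    exact (IsSelfAdjoint.of_nonneg hpos).star_eq
  have hcomm : Commute (star D * D) b := by
    rw [star_mul, star_mul, star_star, isSelfAdjoint_of_one_le hb] at hsa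
    exact hsa.symm
  have h3 : 0 ≤ star D * D * b :=
    hcomm.mul_nonneg (star_mul_self_nonneg D) (zero_le_one.trans hb)
  have h4 : star D * D * b = 0 := by
    rw [h2] at hpos
    exact le_antisymm (neg_nonneg.1 hpos) h3
  have h5 : star D * D = 0 := by
    have := congrArg (· * Ring.inverse b) h4
    simpa only [mul_assoc, Ring.mul_inverse_cancel b (isUnit_of_one_le hb), mul_one,
      zero_mul] using this
  exact sub_eq_zero.1 (CStarRing.star_mul_self_eq_zero_iff D |>.1 h5)

end BoundedBelow

/-! ### The Sylvester equation `a X + X b = Y` for kernels -/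

/-- Writing a - 1 = d*d, the *-homomorphism `lmul` sends it to a square, hence to a positive
operator on kernels. -/
lemma one_le_lmul {a : H →L[ℂ] H} (ha : 1 ≤ a) : 1 ≤ lmul a := by
  obtain ⟨d, hd⟩ := exists_eq_star_mul_self (sub_nonneg.2 ha)
  have h : lmul a - 1 = star (lmul d) * lmul d := by
    rw [star_lmul, ← lmul_mul, ← hd, map_sub, lmul_one]
  rw [← sub_nonneg, h]
  exact star_mul_self_nonneg _

/-- `rmul` reverses products, so the square is formed with d* in place of d. -/
lemma one_le_rmul {a : H →L[ℂ] H} (ha : 1 ≤ a) : 1 ≤ rmul a := by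
  obtain ⟨d, hd⟩ := exists_eq_star_mul_self (sub_nonneg.2 ha)
  have h : rmul a - 1 = star (rmul (star d)) * rmul (star d) := by
    rw [star_rmul, ← rmul_mul, star_star, ← hd, map_sub, rmul_one]
  rw [← sub_nonneg, h]
  exact star_mul_self_nonneg _

/-- The Sylvester operator `X ↦ a X + X b`. -/
def sylv (a b : H →L[ℂ] H) : Kern →L[ℂ] Kern := lmul a + rmul b

lemma kernelOp_sylv (a b : H →L[ℂ] H) (X : Kern) :
    kernelOp (sylv a b X) = a * kernelOp X + kernelOp X * b := by
  change kernelOp (lmul a X + rmul b X) = _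
  rw [kernelOp_add, kernelOp_lmul, kernelOp_rmul]

lemma one_le_sylv {a b : H →L[ℂ] H} (ha : 1 ≤ a) (hb : 1 ≤ b) : 1 ≤ sylv a b :=
  (one_le_lmul ha).trans (le_add_of_nonneg_right (zero_le_one.trans (one_le_rmul hb)))

/-- The inverse of the Sylvester operator. -/
def sylvInv (a b : H →L[ℂ] H) : Kern →L[ℂ] Kern := Ring.inverse (sylv a b)

lemma sylv_sylvInv {a b : H →L[ℂ] H} (ha : 1 ≤ a) (hb : 1 ≤ b) (X : Kern) :
    sylv a b (sylvInv a b X) = X := by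
  have h := Ring.mul_inverse_cancel _ (isUnit_of_one_le (one_le_sylv ha hb))
  change (sylv a b * Ring.inverse (sylv a b)) X = X
  rw [h]; rfl

lemma norm_le_norm_sylv {a b : H →L[ℂ] H} (ha : 1 ≤ a) (hb : 1 ≤ b) (X : Kern) :
    ‖X‖ ≤ ‖sylv a b X‖ := norm_le_norm_apply_of_one_le (one_le_sylv ha hb) X

lemma norm_sylvInv_le {a b : H →L[ℂ] H} (ha : 1 ≤ a) (hb : 1 ≤ b) : ‖sylvInv a b‖ ≤ 1 :=
  norm_inverse_le_one (one_le_sylv ha hb)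

/-! ### The square root of `1 + Q` for a positive Hilbert–Schmidt operator `Q` -/

/-- `√(1 + Q)`. -/
def sqrtOneAdd (Q : Kern) : H →L[ℂ] H := opSqrt (1 + kernelOp Q)

lemma sqrtOneAdd_mul_self {Q : Kern} (hQ : 0 ≤ kernelOp Q) :
    sqrtOneAdd Q * sqrtOneAdd Q = 1 + kernelOp Q :=
  opSqrt_mul_self (add_nonneg zero_le_one hQ)

lemma one_le_sqrtOneAdd {Q : Kern} (hQ : 0 ≤ kernelOp Q) : 1 ≤ sqrtOneAdd Q :=
  one_le_opSqrt (le_add_of_nonneg_right hQ)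

/-- The kernel of `√(1 + Q) - 1`. -/
def pKern (Q : Kern) : Kern := lmul (Ring.inverse (sqrtOneAdd Q + 1)) Q

lemma kernelOp_pKern {Q : Kern} (hQ : 0 ≤ kernelOp Q) :
    kernelOp (pKern Q) = sqrtOneAdd Q - 1 := by
  have h1 : IsUnit (sqrtOneAdd Q + 1) :=
    isUnit_of_one_le (le_add_of_nonneg_left (zero_le_one.trans (one_le_sqrtOneAdd hQ)))
  have h2 : (sqrtOneAdd Q + 1) * (sqrtOneAdd Q - 1) = kernelOp Q := by
    have := sqrtOneAdd_mul_self hQ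
    rw [← sub_eq_iff_eq_add'] at this
    rw [← this]
    noncomm_ring
  rw [pKern, kernelOp_lmul, ← h2, ← mul_assoc, Ring.inverse_mul_cancel _ h1, one_mul]

/-- The noncommutative difference of squares c'² - c² = c'(c' - c) + (c' - c)c. With the lower bound
for the Sylvester operator it makes Q ↦ √(1+Q) - 1 Lipschitz with constant 1 in the Hilbert–Schmidt
norm. -/
lemma sylv_pKern_sub {Q Q' : Kern} (hQ : 0 ≤ kernelOp Q) (hQ' : 0 ≤ kernelOp Q') :
    sylv (sqrtOneAdd Q') (sqrtOneAdd Q) (pKern Q' - pKern Q) = Q' - Q := by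
  refine kernelOp_injective ?_
  rw [kernelOp_sylv, kernelOp_sub, kernelOp_sub, kernelOp_pKern hQ, kernelOp_pKern hQ']
  have h := sqrtOneAdd_mul_self hQ
  have h' := sqrtOneAdd_mul_self hQ'
  have e : kernelOp Q' - kernelOp Q =
      sqrtOneAdd Q' * sqrtOneAdd Q' - sqrtOneAdd Q * sqrtOneAdd Q := by
    rw [h, h']; abel
  rw [e]
  noncomm_ring

lemma norm_pKern_sub_le {Q Q' : Kern} (hQ : 0 ≤ kernelOp Q) (hQ' : 0 ≤ kernelOp Q') :
    ‖pKern Q' - pKern Q‖ ≤ ‖Q' - Q‖ := by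
  have h := norm_le_norm_sylv (one_le_sqrtOneAdd hQ') (one_le_sqrtOneAdd hQ) (pKern Q' - pKern Q)
  rwa [sylv_pKern_sub hQ hQ'] at h

lemma norm_sqrtOneAdd_sub_le {Q Q' : Kern} (hQ : 0 ≤ kernelOp Q) (hQ' : 0 ≤ kernelOp Q') :
    ‖sqrtOneAdd Q' - sqrtOneAdd Q‖ ≤ ‖Q' - Q‖ := by
  have h : sqrtOneAdd Q' - sqrtOneAdd Q = kernelOp (pKern Q' - pKern Q) := by
    rw [kernelOp_sub, kernelOp_pKern hQ, kernelOp_pKern hQ']; abel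
  rw [h]
  exact (norm_kernelOp_le _).trans (norm_pKern_sub_le hQ hQ')

/-- Replacing c' by c in the Sylvester equation for the increment D costs (c' - c)D, which is a
product of two Lipschitz increments. The remainder is thus quadratic, and the inverse Sylvester
operator is the derivative of the square root. -/
lemma norm_pKern_sub_sub_le {Q Q' : Kern} (hQ : 0 ≤ kernelOp Q) (hQ' : 0 ≤ kernelOp Q') :
    ‖pKern Q' - pKern Q - sylvInv (sqrtOneAdd Q) (sqrtOneAdd Q) (Q' - Q)‖ ≤ ‖Q' - Q‖ ^ 2 := by
  set c := sqrtOneAdd Q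
  set c' := sqrtOneAdd Q'
  set D := pKern Q' - pKern Q with hD
  have hc : 1 ≤ c := one_le_sqrtOneAdd hQ
  have h1 : sylv c' c D = Q' - Q := sylv_pKern_sub hQ hQ'
  have h2 : sylv c c (D - sylvInv c c (Q' - Q)) = -lmul (c' - c) D := by
    rw [map_sub, sylv_sylvInv hc hc, ← h1]
    simp only [sylv, map_sub, add_apply, sub_apply]
    abel
  have h3 := norm_le_norm_sylv hc hc (D - sylvInv c c (Q' - Q))
  rw [h2, norm_neg] at h3
  refine h3.trans ((norm_lmul_apply_le _ _).trans ?_)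
  rw [sq]
  exact mul_le_mul (norm_sqrtOneAdd_sub_le hQ hQ') (norm_pKern_sub_le hQ hQ') (norm_nonneg _)
    (norm_nonneg _)

/-! ### Bounded Lipschitz maps on a set -/

section BddLip

variable {X Y Z : Type*} [NormedAddCommGroup X] [NormedAddCommGroup Y] [NormedAddCommGroup Z]

/-- `f` is bounded and Lipschitz on `S`. -/
def BddLip (S : Set X) (f : X → Y) : Prop :=
  ∃ C : ℝ, 0 ≤ C ∧ (∀ x ∈ S, ‖f x‖ ≤ C) ∧ ∀ x ∈ S, ∀ y ∈ S, ‖f x - f y‖ ≤ C * ‖x - y‖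

variable {S : Set X}

lemma BddLip.of_bounds {f : X → Y} {C D : ℝ} (hC : ∀ x ∈ S, ‖f x‖ ≤ C)
    (hD : ∀ x ∈ S, ∀ y ∈ S, ‖f x - f y‖ ≤ D * ‖x - y‖) : BddLip S f := by
  refine ⟨max 0 (max C D), le_max_left _ _, fun x hx => (hC x hx).trans (by simp), ?_⟩
  intro x hx y hy
  refine (hD x hx y hy).trans ?_
  gcongr
  simp

lemma BddLip.add {f g : X → Y} (hf : BddLip S f) (hg : BddLip S g) :
    BddLip S (fun x => f x + g x) := by
  obtain ⟨C, -, hC1, hC2⟩ := hf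
  obtain ⟨D, -, hD1, hD2⟩ := hg
  refine BddLip.of_bounds (C := C + D) (D := C + D) (fun x hx => ?_) fun x hx y hy => ?_
  · exact (norm_add_le _ _).trans (add_le_add (hC1 x hx) (hD1 x hx))
  · rw [add_sub_add_comm, add_mul]
    exact (norm_add_le _ _).trans (add_le_add (hC2 x hx y hy) (hD2 x hx y hy))

variable [NormedSpace ℝ Y] [NormedSpace ℝ Z]

lemma BddLip.clm {f : X → Y} (hf : BddLip S f) (A : Y →L[ℝ] Z) : BddLip S (fun x => A (f x)) := by
  obtain ⟨C, hC0, hC1, hC2⟩ := hf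
  refine BddLip.of_bounds (C := ‖A‖ * C) (D := ‖A‖ * C) (fun x hx => ?_) fun x hx y hy => ?_
  · exact (A.le_opNorm _).trans (by gcongr; exact hC1 x hx)
  · rw [← map_sub, mul_assoc]
    exact (A.le_opNorm _).trans (by gcongr; exact hC2 x hx y hy)

lemma BddLip.sub {f g : X → Y} (hf : BddLip S f) (hg : BddLip S g) :
    BddLip S (fun x => f x - g x) := by
  have h := hf.add (hg.clm (-ContinuousLinearMap.id ℝ Y))
  simpa [sub_eq_add_neg] using h

lemma BddLip.mul {R : Type*} [NormedRing R] {f g : X → R} (hf : BddLip S f) (hg : BddLip S g) :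
    BddLip S (fun x => f x * g x) := by
  obtain ⟨C, hC0, hC1, hC2⟩ := hf
  obtain ⟨D, hD0, hD1, hD2⟩ := hg
  refine BddLip.of_bounds (C := C * D) (D := C * D + C * D) (fun x hx => ?_) fun x hx y hy => ?_
  · exact (norm_mul_le _ _).trans (mul_le_mul (hC1 x hx) (hD1 x hx) (norm_nonneg _) hC0)
  · have e : f x * g x - f y * g y = f x * (g x - g y) + (f x - f y) * g y := by noncomm_ring
    rw [e]
    calc _ ≤ ‖f x‖ * ‖g x - g y‖ + ‖f x - f y‖ * ‖g y‖ :=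
          (norm_add_le _ _).trans (add_le_add (norm_mul_le _ _) (norm_mul_le _ _))
      _ ≤ C * (D * ‖x - y‖) + (C * ‖x - y‖) * D :=
          add_le_add (mul_le_mul (hC1 x hx) (hD2 x hx y hy) (norm_nonneg _) hC0)
            (mul_le_mul (hC2 x hx y hy) (hD1 y hy) (norm_nonneg _) (by positivity))
      _ = _ := by ring

/-- The identity x⁻¹ - y⁻¹ = x⁻¹(y - x)y⁻¹ together with the uniform bound M on the inverses. -/
lemma BddLip.inverse {R : Type*} [NormedRing R] {f : X → R} (hf : BddLip S f)
    (hu : ∀ x ∈ S, IsUnit (f x)) {M : ℝ} (hM : 0 ≤ M) (hb : ∀ x ∈ S, ‖Ring.inverse (f x)‖ ≤ M) :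
    BddLip S (fun x => Ring.inverse (f x)) := by
  obtain ⟨C, hC0, hC1, hC2⟩ := hf
  refine BddLip.of_bounds hb (D := M * C * M) fun x hx y hy => ?_
  have e : Ring.inverse (f x) - Ring.inverse (f y) =
      Ring.inverse (f x) * (f y - f x) * Ring.inverse (f y) := by
    rw [mul_sub, sub_mul, mul_assoc, Ring.mul_inverse_cancel _ (hu y hy),
      Ring.inverse_mul_cancel _ (hu x hx), mul_one, one_mul]
  rw [e]
  have h1 : ‖f y - f x‖ ≤ C * ‖x - y‖ := by rw [norm_sub_rev]; exact hC2 x hx y hy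
  calc _ ≤ ‖Ring.inverse (f x)‖ * ‖f y - f x‖ * ‖Ring.inverse (f y)‖ :=
        (norm_mul_le _ _).trans (by gcongr; exact norm_mul_le _ _)
    _ ≤ M * (C * ‖x - y‖) * M := by
        gcongr
        · exact hb x hx
        · exact hb y hy
    _ = _ := by ring

end BddLip

/-! ### The nonlinearity of the semilinear equation -/

/-- The kernel of `q = u u*`. -/
def qKern (u : Kern) : Kern := rmul (star (kernelOp u)) u

lemma kernelOp_qKern (u : Kern) : kernelOp (qKern u) = kernelOp u * star (kernelOp u) :=
  kernelOp_rmul _ _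

lemma kernelOp_qKern_nonneg (u : Kern) : 0 ≤ kernelOp (qKern u) := by
  rw [kernelOp_qKern]
  exact mul_star_self_nonneg _

/-- `c = √(1 + u u*)`. -/
def cOp (u : Kern) : H →L[ℂ] H := sqrtOneAdd (qKern u)

lemma one_le_cOp (u : Kern) : 1 ≤ cOp u := one_le_sqrtOneAdd (kernelOp_qKern_nonneg u)

lemma star_cOp (u : Kern) : star (cOp u) = cOp u := isSelfAdjoint_of_one_le (one_le_cOp u)

lemma cOp_mul_self (u : Kern) : cOp u * cOp u = 1 + kernelOp u * star (kernelOp u) := by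
  rw [cOp, sqrtOneAdd_mul_self (kernelOp_qKern_nonneg u), kernelOp_qKern]

/-- `c⁻¹`. -/
def cInv (u : Kern) : H →L[ℂ] H := Ring.inverse (cOp u)

lemma cInv_mul_cOp (u : Kern) : cInv u * cOp u = 1 :=
  Ring.inverse_mul_cancel _ (isUnit_of_one_le (one_le_cOp u))

lemma cOp_mul_cInv (u : Kern) : cOp u * cInv u = 1 :=
  Ring.mul_inverse_cancel _ (isUnit_of_one_le (one_le_cOp u))

/-- The adjoint kernel, as a real-linear map. -/
def adjR : Kern →L[ℝ] Kern :=
  LinearMap.mkContinuous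
    { toFun := adjK
      map_add' := adjK_add
      map_smul' := fun c K => by
        rw [← algebraMap_smul ℂ c K, ← algebraMap_smul ℂ (RingHom.id ℝ c) (adjK K), adjK_smul]
        simp } 1 (fun f => by simp [norm_adjK])

@[simp] lemma adjR_apply (K : Kern) : adjR K = adjK K := rfl

/-- Forgetting complex linearity. -/
def toReal : (Kern →L[ℂ] Kern) →L[ℝ] (Kern →L[ℝ] Kern) :=
  ContinuousLinearMap.restrictScalarsL ℂ Kern Kern ℝ ℝ

@[simp] lemma toReal_apply (A : Kern →L[ℂ] Kern) (K : Kern) : toReal A K = A K := rfl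

/-- `m ↦ F = m u* c - c u m*`. -/
def FMap (u : Kern) : Kern →L[ℝ] Kern :=
  toReal (rmul (star (kernelOp u) * cOp u)) - toReal (lmul (cOp u * kernelOp u)) * adjR

/-- `m ↦ W`, the solution of `c W + W c = F`. -/
def WMap (u : Kern) : Kern →L[ℝ] Kern := toReal (sylvInv (cOp u) (cOp u)) * FMap u

/-- The right-hand side of the semilinear equation as a real-linear map in `m`. -/
def NMap (u : Kern) : Kern →L[ℝ] Kern :=
  toReal (lmul (cOp u))
    + (1 / 2 : ℝ) • ((toReal (rmul (cInv u * kernelOp u))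
        - toReal (lmul (cInv u)) * toReal (rmul (kernelOp u))) * WMap u)
    + (1 / 2 : ℝ) • (toReal (lmul (cInv u)) * toReal (rmul (star (kernelOp u) * kernelOp u))
        + toReal (lmul (kernelOp u)) * toReal (rmul (cInv u * kernelOp u)) * adjR)

/-! ### Lipschitz bounds on balls for the ingredients of the nonlinearity. -/

section

variable (R : ℝ)

lemma bddLip_kernelOp : BddLip {u : Kern | ‖u‖ ≤ R} kernelOp := by
  refine BddLip.of_bounds (C := R) (D := 1) (fun u hu => (norm_kernelOp_le u).trans hu) ?_
  intro u _ w _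
  rw [← kernelOp_sub, one_mul]
  exact norm_kernelOp_le _

lemma bddLip_star_kernelOp : BddLip {u : Kern | ‖u‖ ≤ R} (fun u => star (kernelOp u)) := by
  refine BddLip.of_bounds (C := R) (D := 1) (fun u hu => ?_) ?_
  · rw [star_kernelOp]
    exact (norm_kernelOp_le _).trans ((norm_adjK u).trans_le hu)
  · intro u _ w _
    rw [← star_sub, ← kernelOp_sub, one_mul, star_kernelOp]
    exact (norm_kernelOp_le _).trans (norm_adjK _).le

lemma bddLip_qKern : BddLip {u : Kern | ‖u‖ ≤ R} qKern := by
  have hn : ∀ u : Kern, ‖star (kernelOp u)‖ ≤ ‖u‖ := fun u => by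
    rw [star_kernelOp]
    exact (norm_kernelOp_le _).trans (norm_adjK u).le
  refine BddLip.of_bounds (C := R * R) (D := R + R) (fun u hu => ?_) ?_
  · have h0 : 0 ≤ R := (norm_nonneg u).trans hu
    refine (norm_rmul_apply_le _ _).trans ?_
    exact mul_le_mul ((hn u).trans hu) hu (norm_nonneg _) h0
  · intro u hu w hw
    have h0 : 0 ≤ R := (norm_nonneg u).trans hu
    have e : qKern u - qKern w =
        rmul (star (kernelOp u)) (u - w) + rmul (star (kernelOp (u - w))) w := by
      simp only [qKern, kernelOp_sub, star_sub, map_sub, sub_apply]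
      abel
    rw [e, add_mul]
    refine (norm_add_le _ _).trans (add_le_add ?_ ?_)
    · refine (norm_rmul_apply_le _ _).trans ?_
      gcongr
      exact (hn u).trans hu
    · refine (norm_rmul_apply_le _ _).trans ?_
      rw [mul_comm]
      exact mul_le_mul hw (hn _) (norm_nonneg _) h0

lemma bddLip_cOp : BddLip {u : Kern | ‖u‖ ≤ R} cOp := by
  obtain ⟨C, hC0, hC1, hC2⟩ := bddLip_qKern R
  refine BddLip.of_bounds (C := 1 + C) (D := C) (fun u hu => ?_) ?_
  · have e : cOp u = 1 + kernelOp (pKern (qKern u)) := by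
      rw [kernelOp_pKern (kernelOp_qKern_nonneg u), cOp]; abel
    rw [e]
    refine (norm_add_le _ _).trans (add_le_add ContinuousLinearMap.norm_id_le ?_)
    refine (norm_kernelOp_le _).trans ?_
    -- The size of p is its Lipschitz increment from Q = 0.
    have h0 : pKern 0 = 0 := by simp [pKern]
    have h := norm_pKern_sub_le (Q := 0) (Q' := qKern u) (by simp) (kernelOp_qKern_nonneg u)
    rw [h0, sub_zero, sub_zero] at h
    exact h.trans (hC1 u hu)
  · intro u hu w hw
    exact (norm_sqrtOneAdd_sub_le (kernelOp_qKern_nonneg w) (kernelOp_qKern_nonneg u)).trans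
      (hC2 u hu w hw)

lemma bddLip_cInv : BddLip {u : Kern | ‖u‖ ≤ R} cInv :=
  (bddLip_cOp R).inverse (fun u _ => isUnit_of_one_le (one_le_cOp u)) zero_le_one
    (fun u _ => norm_inverse_le_one (one_le_cOp u))

variable {R}

lemma BddLip.lmul {f : Kern → H →L[ℂ] H} (hf : BddLip {u : Kern | ‖u‖ ≤ R} f) :
    BddLip {u : Kern | ‖u‖ ≤ R} (fun u => lmul (f u)) :=
  hf.clm (PairExcitation.lmul.restrictScalars ℝ)

lemma BddLip.rmul {f : Kern → H →L[ℂ] H} (hf : BddLip {u : Kern | ‖u‖ ≤ R} f) :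
    BddLip {u : Kern | ‖u‖ ≤ R} (fun u => rmul (f u)) :=
  hf.clm (PairExcitation.rmul.restrictScalars ℝ)

lemma BddLip.toReal {f : Kern → Kern →L[ℂ] Kern} (hf : BddLip {u : Kern | ‖u‖ ≤ R} f) :
    BddLip {u : Kern | ‖u‖ ≤ R} (fun u => toReal (f u)) :=
  hf.clm PairExcitation.toReal

lemma BddLip.const {X Y : Type*} [NormedAddCommGroup X] [NormedAddCommGroup Y] {S : Set X}
    (a : Y) : BddLip S (fun _ => a) :=
  BddLip.of_bounds (C := ‖a‖) (D := 0) (fun _ _ => le_rfl) (by simp)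

lemma bddLip_sylvInv : BddLip {u : Kern | ‖u‖ ≤ R} (fun u => sylvInv (cOp u) (cOp u)) :=
  ((bddLip_cOp R).lmul.add (bddLip_cOp R).rmul).inverse
    (fun u _ => isUnit_of_one_le (one_le_sylv (one_le_cOp u) (one_le_cOp u))) zero_le_one
    (fun u _ => norm_sylvInv_le (one_le_cOp u) (one_le_cOp u))

lemma bddLip_WMap : BddLip {u : Kern | ‖u‖ ≤ R} WMap := by
  have hA := bddLip_kernelOp R
  have hS := bddLip_star_kernelOp R
  have hc := bddLip_cOp R
  exact bddLip_sylvInv.toReal.mul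
    ((hS.mul hc).rmul.toReal.sub ((hc.mul hA).lmul.toReal.mul (BddLip.const adjR)))

/-- The central estimate. The norm here is the operator norm in `m`, so the nonlinearity is bounded
by C‖m‖ with C depending only on the radius, and its Lipschitz constant in `u` is a multiple of ‖m‖,
which is integrable in time. -/
lemma bddLip_NMap : BddLip {u : Kern | ‖u‖ ≤ R} NMap := by
  have hA := bddLip_kernelOp R
  have hS := bddLip_star_kernelOp R
  have hc := bddLip_cOp R
  have hr := bddLip_cInv R
  have half : ∀ {f : Kern → Kern →L[ℝ] Kern}, BddLip {u : Kern | ‖u‖ ≤ R} f →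
      BddLip {u : Kern | ‖u‖ ≤ R} (fun u => (1 / 2 : ℝ) • f u) := fun hf =>
    hf.clm ((1 / 2 : ℝ) • ContinuousLinearMap.id ℝ (Kern →L[ℝ] Kern))
  exact (hc.lmul.toReal.add
    (half (((hr.mul hA).rmul.toReal.sub (hr.lmul.toReal.mul hA.rmul.toReal)).mul bddLip_WMap))).add
    (half ((hr.lmul.toReal.mul (hS.mul hA).rmul.toReal).add
      ((hA.lmul.toReal.mul (hr.mul hA).rmul.toReal).mul (BddLip.const adjR))))

end

/-! ### The contour integral representing the derivative of the square root -/

section Contour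

variable {X : Type*} [NormedAddCommGroup X] [InnerProductSpace ℂ X] [CompleteSpace X]

/-- From 0 ≤ q ≤ ‖q‖ follows 0 ≤ ‖q‖ - q ≤ ‖q‖. The spectrum thus stays at distance at least 1/2
from the contour of radius ‖q‖ + 1/2. -/
lemma norm_sub_norm_smul_one_le {q : X →L[ℂ] X} (hq : 0 ≤ q) :
    ‖q - (‖q‖ : ℂ) • (1 : X →L[ℂ] X)‖ ≤ ‖q‖ := by
  have h1 : q ≤ algebraMap ℝ (X →L[ℂ] X) ‖q‖ :=
    IsSelfAdjoint.le_algebraMap_norm_self (IsSelfAdjoint.of_nonneg hq)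
  have e : algebraMap ℝ (X →L[ℂ] X) ‖q‖ = (‖q‖ : ℂ) • (1 : X →L[ℂ] X) := by
    rw [Algebra.algebraMap_eq_smul_one]; rfl
  rw [norm_sub_rev, ← e]
  rw [CStarAlgebra.norm_le_iff_le_algebraMap _ (norm_nonneg q) (sub_nonneg.2 h1)]
  exact sub_le_self _ hq

/-- The hypothesis is on the norm of a - c rather than on the spectrum, so that it survives the
perturbation of q by small multiples of F. -/
lemma isUnit_sub_smul_one {a : X →L[ℂ] X} {c z : ℂ}
    (h : ‖a - c • (1 : X →L[ℂ] X)‖ < ‖z - c‖) : IsUnit (a - z • (1 : X →L[ℂ] X)) := by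
  have h1 : ‖a - c • (1 : X →L[ℂ] X)‖ * ‖(1 : X →L[ℂ] X)‖ < ‖z - c‖ :=
    (mul_le_of_le_one_right (norm_nonneg _) ContinuousLinearMap.norm_id_le).trans_lt h
  have h2 := spectrum.mem_resolventSet_of_norm_lt_mul h1
  rw [spectrum.mem_resolventSet_iff, Algebra.algebraMap_eq_smul_one] at h2
  have e : a - z • (1 : X →L[ℂ] X) =
      -((z - c) • (1 : X →L[ℂ] X) - (a - c • (1 : X →L[ℂ] X))) := by
    rw [sub_smul]; abel
  rw [e]
  exact h2.neg

lemma dist_lt_of_mem_spectrum {a : X →L[ℂ] X} {c x : ℂ} {ρ : ℝ}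
    (h : ‖a - c • (1 : X →L[ℂ] X)‖ < ρ) (hx : x ∈ spectrum ℂ a) : ‖x - c‖ < ρ := by
  by_contra hcon
  rw [not_lt] at hcon
  have h1 := isUnit_sub_smul_one (h.trans_le hcon)
  rw [spectrum.mem_iff] at hx
  refine hx ?_
  rw [Algebra.algebraMap_eq_smul_one, ← neg_sub]
  exact h1.neg

lemma neg_half_lt_re {c : ℝ} {z : ℂ} (hz : ‖z - (c : ℂ)‖ ≤ c + 1 / 2) : -(1 / 2) ≤ z.re := by
  have h1 := (Complex.abs_re_le_norm (z - c)).trans hz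
  rw [Complex.sub_re, Complex.ofReal_re] at h1
  have := (abs_le.1 h1).1
  linarith

lemma differentiableAt_sqrt_one_add {z : ℂ} (hz : -(1 / 2) ≤ z.re) :
    DifferentiableAt ℂ (fun z : ℂ => (1 + z) ^ (1 / 2 : ℂ)) z := by
  refine DifferentiableAt.cpow (by fun_prop) (by fun_prop) (Or.inl ?_)
  rw [Complex.add_re, Complex.one_re]
  linarith

lemma sqrt_one_add_mul_self {z : ℂ} (hz : -(1 / 2) ≤ z.re) :
    (1 + z) ^ (1 / 2 : ℂ) * (1 + z) ^ (1 / 2 : ℂ) = 1 + z := by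
  have h0 : (1 + z) ≠ 0 := by
    intro h
    have := congrArg Complex.re h
    rw [Complex.add_re, Complex.one_re, Complex.zero_re] at this
    linarith
  rw [← Complex.cpow_add _ _ h0]
  norm_num

lemma inverse_sub_eq_cfc {a : X →L[ℂ] X} (ha : IsSelfAdjoint a) {c z : ℂ}
    (h : ‖a - c • (1 : X →L[ℂ] X)‖ < ‖z - c‖) :
    Ring.inverse (a - z • (1 : X →L[ℂ] X)) = cfc (fun x : ℂ => (x - z)⁻¹) a := by
  have hn : IsStarNormal a := ha.isStarNormal
  have hne : ∀ x ∈ spectrum ℂ a, x - z ≠ 0 := by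
    intro x hx h0
    have := dist_lt_of_mem_spectrum h hx
    rw [sub_eq_zero.1 h0] at this
    exact lt_irrefl _ this
  have hc : ContinuousOn (fun x : ℂ => (x - z)⁻¹) (spectrum ℂ a) :=
    ContinuousOn.inv₀ (by fun_prop) hne
  have h1 : cfc (fun x : ℂ => x - z) a = a - z • (1 : X →L[ℂ] X) := by
    rw [cfc_sub (fun x : ℂ => x) (fun _ => z) a, cfc_id' ℂ a, cfc_const z a,
      Algebra.algebraMap_eq_smul_one]
  have h2 : cfc (fun x : ℂ => (x - z)⁻¹) a * (a - z • (1 : X →L[ℂ] X)) = 1 := by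
    rw [← h1, ← cfc_mul (fun x : ℂ => (x - z)⁻¹) (fun x : ℂ => x - z) a hc (by fun_prop),
      ← cfc_one ℂ a]
    refine cfc_congr fun x hx => ?_
    exact inv_mul_cancel₀ (hne x hx)
  have hu := isUnit_sub_smul_one h
  calc Ring.inverse (a - z • (1 : X →L[ℂ] X))
      = cfc (fun x : ℂ => (x - z)⁻¹) a * (a - z • (1 : X →L[ℂ] X))
          * Ring.inverse (a - z • (1 : X →L[ℂ] X)) := by rw [h2, one_mul]
    _ = _ := by rw [mul_assoc, Ring.mul_inverse_cancel _ hu, mul_one]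

-- On the real spectrum, which lies in x ≥ -1/2, the principal branch is the nonnegative real root,
-- so the functional calculus produces the positive square root.
open scoped ComplexOrder in
lemma opSqrt_one_add_eq_cfc {a : X →L[ℂ] X} (ha : IsSelfAdjoint a) {c : ℝ}
    (h : ‖a - (c : ℂ) • (1 : X →L[ℂ] X)‖ < c + 1 / 2) :
    opSqrt (1 + a) = cfc (fun x : ℂ => (1 + x) ^ (1 / 2 : ℂ)) a := by
  have hn : IsStarNormal a := ha.isStarNormal
  have hre : ∀ x ∈ spectrum ℂ a, -(1 / 2) ≤ x.re := fun x hx =>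
    neg_half_lt_re (dist_lt_of_mem_spectrum h hx).le
  have hc : ContinuousOn (fun x : ℂ => (1 + x) ^ (1 / 2 : ℂ)) (spectrum ℂ a) := fun x hx =>
    (differentiableAt_sqrt_one_add (hre x hx)).continuousAt.continuousWithinAt
  refine opSqrt_unique ?_ ?_
  · rw [← cfc_mul _ _ a hc hc]
    have : 1 + a = cfc (fun x : ℂ => 1 + x) a := by
      rw [cfc_add (R := ℂ) (a := a) (f := fun _ : ℂ => (1 : ℂ)) (g := fun x => x), cfc_id' ℂ a,
        cfc_const (1 : ℂ) a, map_one]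
    rw [this]
    exact cfc_congr fun x hx => sqrt_one_add_mul_self (hre x hx)
  · refine cfc_nonneg fun x hx => ?_
    have hx1 : x = (x.re : ℂ) := ha.mem_spectrum_eq_re hx
    have hx2 := hre x hx
    rw [hx1]
    have : ((1 + (x.re : ℂ)) ^ (1 / 2 : ℂ)) = (((1 + x.re) ^ (1 / 2 : ℝ) : ℝ) : ℂ) := by
      rw [Complex.ofReal_cpow (by linarith)]
      push_cast
      rfl
    rw [this]
    exact_mod_cast Real.rpow_nonneg (by linarith) _

/-- Cauchy's formula for √(1+z) at each spectral point, transported by the continuous functional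
calculus. The minus sign comes from using (a - z)⁻¹ instead of (z - a)⁻¹. -/
lemma circleIntegral_resolvent {a : X →L[ℂ] X} (ha : IsSelfAdjoint a) {c : ℝ} (hc0 : 0 ≤ c)
    (h : ‖a - (c : ℂ) • (1 : X →L[ℂ] X)‖ < c + 1 / 2) :
    ∮ z in C((c : ℂ), c + 1 / 2), ((1 + z) ^ (1 / 2 : ℂ)) • Ring.inverse (a - z • (1 : X →L[ℂ] X))
      = -(2 * Real.pi * Complex.I : ℂ) • opSqrt (1 + a) := by
  have hn : IsStarNormal a := ha.isStarNormal
  set f : ℂ → ℂ := fun z => (1 + z) ^ (1 / 2 : ℂ) with hf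
  set γ : ℝ → ℂ := circleMap (c : ℂ) (c + 1 / 2) with hγ
  have hγn : ∀ θ, ‖γ θ - c‖ = c + 1 / 2 := by
    intro θ
    rw [hγ]
    have := circleMap_mem_sphere (c : ℂ) (by linarith : 0 ≤ c + 1 / 2) θ
    rwa [mem_sphere_iff_norm] at this
  have hγre : ∀ θ, -(1 / 2) ≤ (γ θ).re := fun θ => neg_half_lt_re (hγn θ).le
  have hγc : Continuous γ := continuous_circleMap _ _
  have hfc : Continuous fun θ => f (γ θ) := by
    rw [continuous_iff_continuousAt]
    intro θ
    exact (differentiableAt_sqrt_one_add (hγre θ)).continuousAt.comp hγc.continuousAt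
  have hγd : Continuous (deriv γ) := by
    have : deriv γ = fun θ => circleMap 0 (c + 1 / 2) θ * Complex.I := by
      funext θ; rw [hγ, deriv_circleMap]
    rw [this]
    exact (continuous_circleMap _ _).mul continuous_const
  set g : ℝ → ℂ → ℂ := fun θ x => deriv γ θ * (f (γ θ) * (x - γ θ)⁻¹) with hg
  have hgc : ContinuousOn (Function.uncurry g) (univ ×ˢ spectrum ℂ a) := by
    refine ContinuousOn.mul (hγd.comp continuous_fst).continuousOn
      (ContinuousOn.mul (hfc.comp continuous_fst).continuousOn
        (ContinuousOn.inv₀ (by fun_prop) ?_))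
    rintro ⟨θ, x⟩ ⟨-, hx⟩ h0
    have := dist_lt_of_mem_spectrum h hx
    rw [sub_eq_zero.1 h0, hγn] at this
    exact lt_irrefl _ this
  -- A constant dominating function on the compact set of angles and spectral points, needed to
  -- interchange the integral with the functional calculus.
  obtain ⟨B, hB⟩ := (isCompact_Icc (a := (0 : ℝ)) (b := 2 * Real.pi)).prod
    (spectrum.isCompact a) |>.exists_bound_of_continuousOn
    (hgc.mono (prod_mono_left (subset_univ _)))
  have h2π : (0 : ℝ) ≤ 2 * Real.pi := by positivity
  have key := cfc_setIntegral (μ := volume) (measurableSet_Ioc (a := (0 : ℝ)) (b := 2 * Real.pi))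
    g (fun _ => B) a (hgc.mono (prod_mono_left (subset_univ _)))
    (by
      refine ae_restrict_of_forall_mem measurableSet_Ioc fun θ hθ x hx => ?_
      exact hB (θ, x) ⟨Ioc_subset_Icc_self hθ, hx⟩)
    (integrable_const B).2
  have hL : ∫ θ in Ioc 0 (2 * Real.pi), cfc (g θ) a =
      ∮ z in C((c : ℂ), c + 1 / 2), f z • Ring.inverse (a - z • (1 : X →L[ℂ] X)) := by
    rw [circleIntegral, intervalIntegral.integral_of_le h2π]
    refine setIntegral_congr_fun measurableSet_Ioc fun θ _ => ?_
    have hlt : ‖a - (c : ℂ) • (1 : X →L[ℂ] X)‖ < ‖γ θ - c‖ := by rw [hγn]; exact h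
    have hci : ContinuousOn (fun x : ℂ => (x - γ θ)⁻¹) (spectrum ℂ a) := by
      refine ContinuousOn.inv₀ (by fun_prop) fun x hx h0 => ?_
      have := dist_lt_of_mem_spectrum hlt hx
      rw [sub_eq_zero.1 h0] at this
      exact lt_irrefl _ this
    change cfc (fun x => deriv γ θ * (f (γ θ) * (x - γ θ)⁻¹)) a = deriv γ θ • (f (γ θ) • _)
    rw [inverse_sub_eq_cfc ha hlt, cfc_const_mul _ (fun x => f (γ θ) * (x - γ θ)⁻¹) a
        (continuousOn_const.mul hci),
      cfc_const_mul _ _ a hci]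
  have hR : cfc (fun x => ∫ θ in Ioc 0 (2 * Real.pi), g θ x) a =
      -(2 * Real.pi * Complex.I : ℂ) • opSqrt (1 + a) := by
    have hfs : ContinuousOn f (spectrum ℂ a) := fun x hx =>
      (differentiableAt_sqrt_one_add
        (neg_half_lt_re (dist_lt_of_mem_spectrum h hx).le)).continuousAt.continuousWithinAt
    rw [opSqrt_one_add_eq_cfc ha h, ← cfc_const_mul _ _ a hfs]
    refine cfc_congr fun x hx => ?_
    have hd : DifferentiableOn ℂ f (Metric.closedBall (c : ℂ) (c + 1 / 2)) := fun z hz =>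
      (differentiableAt_sqrt_one_add (neg_half_lt_re
        (mem_closedBall_iff_norm.1 hz))).differentiableWithinAt
    have hcau := hd.circleIntegral_sub_inv_smul (w := x)
      (mem_ball_iff_norm.2 (dist_lt_of_mem_spectrum h hx))
    rw [circleIntegral, intervalIntegral.integral_of_le h2π] at hcau
    change ∫ θ in Ioc 0 (2 * Real.pi), g θ x = -(2 * Real.pi * Complex.I : ℂ) * f x
    rw [smul_eq_mul] at hcau
    rw [neg_mul, ← hcau, ← integral_neg]
    refine setIntegral_congr_fun measurableSet_Ioc fun θ _ => ?_
    change deriv γ θ * (f (γ θ) * (x - γ θ)⁻¹) = -(deriv γ θ • ((γ θ - x)⁻¹ • f (γ θ)))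
    rw [← neg_sub, inv_neg]
    simp only [smul_eq_mul]
    ring
  rw [← hL, ← key, hR]

lemma inverse_sub_inverse {R : Type*} [Ring R] {a b : R} (ha : IsUnit a) (hb : IsUnit b) :
    Ring.inverse a - Ring.inverse b = Ring.inverse a * (b - a) * Ring.inverse b := by
  rw [mul_sub, sub_mul, mul_assoc, Ring.mul_inverse_cancel _ hb, Ring.inverse_mul_cancel _ ha,
    mul_one, one_mul]

-- W is identified as the derivative at s = 0 of √(1 + q + sF). By the resolvent identity the
-- difference quotient is the contour integral V(s) with one resolvent of q + sF and one of q. The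
-- difference of squares gives √(1+q+sF) V(s) + V(s) √(1+q) = F for small s > 0, and s tends to 0 by
-- continuity of V.
set_option maxHeartbeats 1000000 in
lemma circleIntegral_sylvester_of_isSelfAdjoint {q F : X →L[ℂ] X} (hq : 0 ≤ q)
    (hF : IsSelfAdjoint F) (W : X →L[ℂ] X)
    (hW : W = (2 * Real.pi * Complex.I : ℂ)⁻¹ • ∮ z in C((‖q‖ : ℂ), ‖q‖ + 1 / 2),
      ((1 + z) ^ (1 / 2 : ℂ)) •
        (Ring.inverse (q - z • 1) * F * Ring.inverse (q - z • 1))) :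
    opSqrt (1 + q) * W + W * opSqrt (1 + q) = F := by
  set c := ‖q‖ with hc
  have hc0 : 0 ≤ c := norm_nonneg q
  -- Chosen so that δ‖F‖ < 1/2: the perturbed spectrum stays inside the same circle and 1 + q + sF
  -- stays positive.
  set δ : ℝ := (4 * (‖F‖ + 1))⁻¹ with hδ
  have hδ0 : 0 < δ := by positivity
  have hδF : δ * ‖F‖ < 1 / 2 := by
    rw [hδ, inv_mul_lt_iff₀ (by positivity)]
    nlinarith [norm_nonneg F]
  -- Clamping the parameter to [-δ, δ] makes all families globally defined and continuous in s.
  set σ : ℝ → ℝ := fun s => max (-δ) (min s δ) with hσ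
  have hσc : Continuous σ := by fun_prop
  have hσδ : ∀ s, |σ s| ≤ δ := fun s =>
    abs_le.2 ⟨le_max_left _ _, max_le (by linarith) (min_le_right _ _)⟩
  set γ : ℝ → ℂ := circleMap (c : ℂ) (c + 1 / 2) with hγ
  have hγn : ∀ θ, ‖γ θ - c‖ = c + 1 / 2 := by
    intro θ
    have := circleMap_mem_sphere (c : ℂ) (by linarith : 0 ≤ c + 1 / 2) θ
    rwa [mem_sphere_iff_norm] at this
  set a : ℝ → X →L[ℂ] X := fun s => q + (σ s : ℂ) • F with ha
  have hac : Continuous a := by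
    rw [ha]; fun_prop
  have hasa : ∀ s, IsSelfAdjoint (a s) := by
    intro s
    refine (IsSelfAdjoint.of_nonneg hq).add ?_
    rw [IsSelfAdjoint, star_smul, hF.star_eq]
    simp
  have han : ∀ s, ‖a s - (c : ℂ) • (1 : X →L[ℂ] X)‖ < c + 1 / 2 := by
    intro s
    have e : a s - (c : ℂ) • (1 : X →L[ℂ] X) = (q - (c : ℂ) • (1 : X →L[ℂ] X)) + (σ s : ℂ) • F := by
      rw [ha, add_sub_right_comm]
    rw [e]
    refine (norm_add_le _ _).trans_lt ?_
    have h1 := norm_sub_norm_smul_one_le hq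
    have h2 : ‖(σ s : ℂ) • F‖ ≤ δ * ‖F‖ := by
      rw [norm_smul, Complex.norm_real]
      exact mul_le_mul_of_nonneg_right (hσδ s) (norm_nonneg _)
    linarith
  have hu : ∀ s θ, IsUnit (a s - γ θ • (1 : X →L[ℂ] X)) := fun s θ =>
    isUnit_sub_smul_one (c := (c : ℂ)) (by rw [hγn]; exact han s)
  have hinv : Continuous fun p : ℝ × ℝ => Ring.inverse (a p.1 - γ p.2 • (1 : X →L[ℂ] X)) := by
    rw [continuous_iff_continuousAt]
    intro p
    obtain ⟨w, hw⟩ := hu p.1 p.2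
    have h1 : ContinuousAt Ring.inverse (a p.1 - γ p.2 • (1 : X →L[ℂ] X)) := by
      rw [← hw]
      exact NormedRing.inverse_continuousAt w
    refine ContinuousAt.comp (f := fun p : ℝ × ℝ => a p.1 - γ p.2 • (1 : X →L[ℂ] X)) h1 ?_
    refine Continuous.continuousAt ?_
    exact (hac.comp continuous_fst).sub
      (((continuous_circleMap _ _).comp continuous_snd).smul continuous_const)
  have hfc : Continuous fun θ => (1 + γ θ) ^ (1 / 2 : ℂ) := by
    rw [continuous_iff_continuousAt]
    intro θ
    exact (differentiableAt_sqrt_one_add (neg_half_lt_re (hγn θ).le)).continuousAt.comp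
      (continuous_circleMap _ _).continuousAt
  have hγd : Continuous (deriv γ) := by
    have : deriv γ = fun θ => circleMap 0 (c + 1 / 2) θ * Complex.I := by
      funext θ; rw [hγ, deriv_circleMap]
    rw [this]
    exact (continuous_circleMap _ _).mul continuous_const
  set V : ℝ → X →L[ℂ] X := fun s => (2 * Real.pi * Complex.I : ℂ)⁻¹ •
    ∮ z in C((c : ℂ), c + 1 / 2), ((1 + z) ^ (1 / 2 : ℂ)) •
      (Ring.inverse (a s - z • 1) * F * Ring.inverse (a 0 - z • 1)) with hV
  have hVc : Continuous V := by
    rw [hV]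
    refine Continuous.fun_const_smul ?_ _
    refine intervalIntegral.continuous_parametric_intervalIntegral_of_continuous' ?_ 0 (2 * Real.pi)
    refine (hγd.comp continuous_snd).smul ((hfc.comp continuous_snd).smul ?_)
    refine (hinv.mul continuous_const).mul ?_
    exact hinv.comp (continuous_const.prodMk continuous_snd)
  have hσ0 : σ 0 = 0 := by
    simp only [hσ]
    rw [min_eq_left hδ0.le, max_eq_right (by linarith)]
  have ha0 : a 0 = q := by simp [ha, hσ0]
  have hV0 : V 0 = W := by rw [hW, hV]; simp only [ha0]
  have hpi : (2 * Real.pi * Complex.I : ℂ) ≠ 0 := Complex.two_pi_I_ne_zero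
  have hci : ∀ s, CircleIntegrable
      (fun z => ((1 + z) ^ (1 / 2 : ℂ)) • Ring.inverse (a s - z • (1 : X →L[ℂ] X))) c (c + 1 / 2) := by
    intro s
    refine Continuous.intervalIntegrable ?_ _ _
    exact hfc.smul (hinv.comp (continuous_const.prodMk continuous_id))
  -- Subtracting the two Cauchy formulas and applying the resolvent identity under the integral.
  have hdiff : ∀ s, opSqrt (1 + a s) - opSqrt (1 + q) = (σ s : ℂ) • V s := by
    intro s
    have h1 := circleIntegral_resolvent (hasa s) hc0 (han s)
    have h0 := circleIntegral_resolvent (hasa 0) hc0 (han 0)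
    rw [← ha0]
    have h2 : (2 * Real.pi * Complex.I : ℂ) • (opSqrt (1 + a s) - opSqrt (1 + a 0)) =
        (2 * Real.pi * Complex.I : ℂ) • (σ s : ℂ) • V s := by
      rw [hV, smul_comm (σ s : ℂ), smul_inv_smul₀ hpi, smul_sub]
      have h3 := congrArg₂ (· - ·) h0 h1
      simp only [neg_smul] at h3
      rw [sub_neg_eq_add, neg_add_eq_sub, ← circleIntegral.integral_sub (hci 0) (hci s)] at h3
      rw [← h3, ← circleIntegral.integral_smul]
      refine circleIntegral.integral_congr (by linarith) fun z hz => ?_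
      obtain ⟨θ, rfl⟩ : ∃ θ, γ θ = z := by
        have : z ∈ range γ := by
          rw [hγ, range_circleMap, abs_of_nonneg (by linarith)]
          exact hz
        exact this
      have h4 := inverse_sub_inverse (hu s θ) (hu 0 θ)
      have h5 : a 0 - γ θ • (1 : X →L[ℂ] X) - (a s - γ θ • (1 : X →L[ℂ] X)) =
          -((σ s : ℂ) • F) := by
        simp only [ha, hσ0]
        simp
      rw [h5] at h4
      rw [← smul_sub, ← neg_sub, h4, smul_comm (σ s : ℂ)]
      congr 1
      rw [mul_neg, neg_mul, neg_neg, mul_smul_comm, smul_mul_assoc]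
    exact smul_right_injective _ hpi h2
  have hpos : ∀ s, 0 ≤ 1 + a s := by
    intro s
    have h1 := (hasa s).sub (IsSelfAdjoint.of_nonneg hq)
    have h2 : (-(1 : X →L[ℂ] X)) ≤ a s - q := by
      have h3 := IsSelfAdjoint.neg_algebraMap_norm_le_self h1
      refine le_trans ?_ h3
      have h4 : ‖a s - q‖ ≤ 1 := by
        have e : a s - q = (σ s : ℂ) • F := by simp [ha]
        rw [e, norm_smul, Complex.norm_real]
        have := mul_le_mul_of_nonneg_right (hσδ s) (norm_nonneg F)
        simp only [Real.norm_eq_abs]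
        linarith
      rw [neg_le_neg_iff]
      have := algebraMap_mono (X →L[ℂ] X) h4
      simpa using this
    have e : 1 + a s = q + ((a s - q) - (-1)) := by abel
    rw [e]
    exact add_nonneg hq (sub_nonneg.2 h2)
  have hsyl : ∀ s ∈ Ioo 0 δ, opSqrt (1 + a s) * V s + V s * opSqrt (1 + q) = F := by
    intro s hs
    have hss : σ s = s := by
      simp only [hσ]
      rw [min_eq_left hs.2.le, max_eq_right (by linarith [hs.1])]
    have hs0 : (s : ℂ) ≠ 0 := by exact_mod_cast hs.1.ne'
    have h1 := hdiff s
    rw [hss] at h1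
    have h2 := opSqrt_mul_self (hpos s)
    have h3 := opSqrt_mul_self (hpos 0)
    rw [ha0] at h3
    have h4 : (s : ℂ) • (opSqrt (1 + a s) * V s + V s * opSqrt (1 + q)) = (s : ℂ) • F := by
      rw [smul_add, ← mul_smul_comm, ← smul_mul_assoc, ← h1]
      have h5 : (s : ℂ) • F = (1 + a s) - (1 + q) := by
        simp only [ha, hss]; abel
      rw [h5, ← sub_eq_zero]
      refine Eq.trans ?_ (sub_eq_zero.2 (congrArg₂ (· - ·) h2 h3))
      noncomm_ring
    exact smul_right_injective _ hs0 h4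
  have hlim : Filter.Tendsto (fun s => opSqrt (1 + a s) * V s + V s * opSqrt (1 + q))
      (nhdsWithin 0 (Ioi 0)) (nhds (opSqrt (1 + q) * W + W * opSqrt (1 + q))) := by
    have hsq : Continuous fun s => opSqrt (1 + a s) := by
      have : (fun s => opSqrt (1 + a s)) = fun s => opSqrt (1 + q) + (σ s : ℂ) • V s := by
        funext s
        rw [← hdiff s]; abel
      rw [this]
      fun_prop
    have hcont : Continuous (fun s => opSqrt (1 + a s) * V s + V s * opSqrt (1 + q)) :=
      (hsq.mul hVc).add (hVc.mul continuous_const)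
    have := hcont.tendsto 0
    rw [ha0, hV0] at this
    exact this.mono_left nhdsWithin_le_nhds
  refine tendsto_nhds_unique hlim (tendsto_const_nhds.congr' ?_)
  filter_upwards [Ioo_mem_nhdsGT hδ0] with s hs
  exact (hsyl s hs).symm

/-- The contour integral `W` solves the Sylvester equation `√(1+q) W + W √(1+q) = F`. -/
lemma circleIntegral_sylvester {q F : X →L[ℂ] X} (hq : 0 ≤ q) (hF : star F = -F) (W : X →L[ℂ] X)
    (hW : W = (2 * Real.pi * Complex.I : ℂ)⁻¹ • ∮ z in C((‖q‖ : ℂ), ‖q‖ + 1 / 2),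
      ((1 + z) ^ (1 / 2 : ℂ)) •
        (Ring.inverse (q - z • 1) * F * Ring.inverse (q - z • 1))) :
    opSqrt (1 + q) * W + W * opSqrt (1 + q) = F := by
  -- The F of the equation is skew-adjoint. The perturbation argument needs a self-adjoint
  -- direction, so it is applied to iF, and both sides are linear in F.
  have h1 : IsSelfAdjoint (Complex.I • F) := by
    rw [IsSelfAdjoint, star_smul, hF]
    simp
  have h2 := circleIntegral_sylvester_of_isSelfAdjoint hq h1 (Complex.I • W) (by
    rw [hW, smul_comm Complex.I, ← circleIntegral.integral_smul]
    simp only [mul_smul_comm, smul_mul_assoc]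
    congr 2
    funext z
    rw [smul_comm])
  rw [mul_smul_comm, smul_mul_assoc, ← smul_add] at h2
  exact smul_right_injective _ Complex.I_ne_zero h2

end Contour

/-! ### The nonlinearity and the operators of the semilinear equation -/

lemma IsSymm.kernelOp_star {u : Kern} (hu : IsSymm u) :
    kernelOp (star u) = star (kernelOp u) := by
  rw [star_kernelOp, hu.adjK_eq]

lemma IsSymm.barOp_kernelOp {u : Kern} (hu : IsSymm u) :
    barOp (kernelOp u) = star (kernelOp u) := (isSymm_iff_kernelOp.1 hu).symm

lemma IsSymm.qOp_eq {u : Kern} (hu : IsSymm u) : qOp u = kernelOp (qKern u) := by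
  rw [qOp, hu.kernelOp_star, kernelOp_qKern]

lemma IsSymm.chOp_eq {u : Kern} (hu : IsSymm u) : chOp u = cOp u := by
  rw [chOp, hu.qOp_eq]; rfl

lemma IsSymm.rOp_eq {u : Kern} (hu : IsSymm u) : rOp u = cInv u := by
  rw [rOp, hu.chOp_eq]; rfl

lemma kernelOp_FMap (u m : Kern) : kernelOp (FMap u m) =
    kernelOp m * star (kernelOp u) * cOp u - cOp u * kernelOp u * star (kernelOp m) := by
  change kernelOp (rmul _ m - lmul _ (adjK m)) = _
  rw [kernelOp_sub, kernelOp_rmul, kernelOp_lmul, ← star_kernelOp, mul_assoc (kernelOp m)]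

/-- For symmetric kernels complex conjugation is the adjoint. The nonlinearity is treated with
adjoints throughout, which keeps positivity available for arbitrary u; only here do the two forms
have to agree. -/
lemma IsSymm.FOp_eq {u m : Kern} (hu : IsSymm u) (hm : IsSymm m) :
    FOp u m = kernelOp (FMap u m) := by
  rw [FOp, kernelOp_FMap, hu.kernelOp_star, hm.kernelOp_star, hu.chOp_eq]

lemma star_kernelOp_FMap (u m : Kern) : star (kernelOp (FMap u m)) = -kernelOp (FMap u m) := by
  rw [kernelOp_FMap]
  simp only [star_sub, star_mul, star_star, star_cOp, mul_assoc, neg_sub]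

lemma WMap_sylvester (u m : Kern) :
    cOp u * kernelOp (WMap u m) + kernelOp (WMap u m) * cOp u = kernelOp (FMap u m) := by
  rw [← kernelOp_sylv]
  exact congrArg kernelOp (sylv_sylvInv (one_le_cOp u) (one_le_cOp u) (FMap u m))

/-- Both sides solve the same Sylvester equation, whose solution is unique. In particular the
contour integral is Hilbert–Schmidt. -/
lemma IsSymm.WOp_eq {u m : Kern} (hu : IsSymm u) (hm : IsSymm m) :
    WOp u m = kernelOp (WMap u m) := by
  refine sylvester_unique (one_le_cOp u) (one_le_cOp u) ?_
  rw [WMap_sylvester, ← hu.FOp_eq hm, ← hu.chOp_eq]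
  refine circleIntegral_sylvester ?_ ?_ _ rfl
  · rw [hu.qOp_eq]
    exact kernelOp_qKern_nonneg u
  · rw [hu.FOp_eq hm]
    exact star_kernelOp_FMap u m

lemma kernelOp_NMap (u m : Kern) : kernelOp (NMap u m) =
    cOp u * kernelOp m
      + (1 / 2 : ℂ) • ((kernelOp (WMap u m) * cInv u - cInv u * kernelOp (WMap u m)) * kernelOp u)
      + (1 / 2 : ℂ) • ((cInv u * kernelOp m * star (kernelOp u)
        + kernelOp u * star (kernelOp m) * cInv u) * kernelOp u) := by
  have h : NMap u m = lmul (cOp u) m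
      + (1 / 2 : ℝ) • (rmul (cInv u * kernelOp u) (WMap u m)
          - lmul (cInv u) (rmul (kernelOp u) (WMap u m)))
      + (1 / 2 : ℝ) • (lmul (cInv u) (rmul (star (kernelOp u) * kernelOp u) m)
        + lmul (kernelOp u) (rmul (cInv u * kernelOp u) (adjK m))) := rfl
  have hs : ∀ K : Kern, (1 / 2 : ℝ) • K = (1 / 2 : ℂ) • K := fun K => by
    rw [← algebraMap_smul ℂ (1 / 2 : ℝ) K]
    simp
  rw [h, hs, hs]
  simp only [kernelOp_add, kernelOp_smul, kernelOp_sub, kernelOp_lmul, kernelOp_rmul,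
    ← star_kernelOp, sub_mul, add_mul, mul_assoc]

lemma IsSymm.rhsOp_eq {u m : Kern} (hu : IsSymm u) (hm : IsSymm m) :
    rhsOp u m = kernelOp (NMap u m) := by
  rw [rhsOp, kernelOp_NMap, hu.WOp_eq hm, hu.chOp_eq, hu.rOp_eq, hu.kernelOp_star,
    hm.kernelOp_star]

/-! ### Symmetry of the nonlinearity -/

/-- Primes stand for complex conjugates, with a = u. Transposition fixes a, a', m and m', sends c to
c', r to r' and w to -w'. The two sides are then twice the nonlinearity and its transpose. The only
input beyond the relations between u, c and r is the value `hY` of wa - aw'. -/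
lemma rhs_transpose_identity {R : Type*} [Ring R] {a a' m m' c c' r r' w w' : R}
    (hc : c * c = 1 + a * a') (hc' : c' * c' = 1 + a' * a)
    (hr : r * c = 1) (hr' : c' * r' = 1) (har : a * r' = r * a)
    (hY : w * a - a * w' = c * c * m - c * m * c' + m * c' * c' - m - a * m' * a) :
    2 * (c * m) + (w * r - r * w) * a + (r * m * a' + a * m' * r) * a =
      2 * (m * c') + a * (w' * r' - r' * w') + a * (a' * m * r' + r' * m' * a) := by
  linear_combination (norm := noncomm_ring) -(w * har) + har * w' + hY * r' - r * hY
    + hc * (m * r') - c * m * hr' + m * c' * hr' - a * m' * har - hr * (c * m) + hr * (m * c')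
    - r * m * hc' - har * (m' * a)

/-- The element wa - aw' and the explicit expression without w have the same image under Y ↦ cY +
Yc'; uniqueness for this Sylvester equation then gives the hypothesis `hY` of the previous lemma. -/
lemma commutator_identity {R : Type*} [Ring R] {a a' m m' c c' w w' : R}
    (hc : c * c = 1 + a * a') (hc' : c' * c' = 1 + a' * a) (hac : a * c' = c * a)
    (hw : c * w + w * c = m * a' * c - c * a * m')
    (hw' : c' * w' + w' * c' = m' * a * c' - c' * a' * m) :
    c * (w * a - a * w') + (w * a - a * w') * c' =
      c * (c * c * m - c * m * c' + m * c' * c' - m - a * m' * a)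
        + (c * c * m - c * m * c' + m * c' * c' - m - a * m' * a) * c' := by
  linear_combination (norm := noncomm_ring) hac * w' + w * hac + hw * a - a * hw'
    - m * a' * hac - m * hc' * c' - c * hc * m + hac * (a' * m)

lemma one_le_barOp {a : H →L[ℂ] H} (ha : 1 ≤ a) : 1 ≤ barOp a := by
  obtain ⟨d, hd⟩ := exists_eq_star_mul_self (sub_nonneg.2 ha)
  have h : barOp a - 1 = star (barOp d) * barOp d := by
    rw [star_barOp, ← barOp_mul, ← hd, barOp_sub, barOp_one]
  rw [← sub_nonneg, h]
  exact star_mul_self_nonneg _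

/-- F is skew-adjoint and c self-adjoint, so -W* solves the same Sylvester equation as W. -/
lemma star_kernelOp_WMap (u m : Kern) : star (kernelOp (WMap u m)) = -kernelOp (WMap u m) := by
  refine sylvester_unique (one_le_cOp u) (one_le_cOp u) ?_
  have h := congrArg star (WMap_sylvester u m)
  rw [star_kernelOp_FMap, ← WMap_sylvester, star_add, star_mul, star_mul, star_cOp] at h
  rw [add_comm, h]
  noncomm_ring

/-- Needed for consistency: g u + u gᵀ and the free flow preserve symmetry, so the nonlinearity must
do so as well for the solution to remain symmetric. -/
lemma isSymm_NMap {u m : Kern} (hu : IsSymm u) (hm : IsSymm m) : IsSymm (NMap u m) := by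
  rw [isSymm_iff_kernelOp, kernelOp_NMap]
  set A := kernelOp u
  set M := kernelOp m
  set c := cOp u
  set r := cInv u
  set W := kernelOp (WMap u m) with hW
  have hA : barOp A = star A := hu.barOp_kernelOp
  have hA' : barOp (star A) = A := by rw [← hA, barOp_barOp]
  have hM : barOp M = star M := hm.barOp_kernelOp
  have hM' : barOp (star M) = M := by rw [← hM, barOp_barOp]
  have hc : c * c = 1 + A * star A := cOp_mul_self u
  have hc' : barOp c * barOp c = 1 + star A * A := by
    rw [← barOp_mul, hc, barOp_add, barOp_mul, barOp_one, hA, hA']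
  -- The intertwining u √(1+ūu) = √(1+uū) u. Both sides have the same image under Y ↦ cY + Yc̄, so
  -- no functional calculus is needed.
  have hac : A * barOp c = c * A := by
    refine sylvester_unique (one_le_cOp u) (one_le_barOp (one_le_cOp u)) ?_
    change c * (A * barOp c) + A * barOp c * barOp c = c * (c * A) + c * A * barOp c
    linear_combination (norm := noncomm_ring) A * hc' - hc * A
  have hr : r * c = 1 := cInv_mul_cOp u
  have hr2 : c * r = 1 := cOp_mul_cInv u
  have hr' : barOp c * barOp r = 1 := by rw [← barOp_mul, hr2, barOp_one]
  have har : A * barOp r = r * A := by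
    linear_combination (norm := noncomm_ring) -(hr * (A * barOp r)) - r * hac * barOp r
      + r * A * hr'
  have hw : c * W + W * c = M * star A * c - c * A * star M := by
    rw [hW, WMap_sylvester, kernelOp_FMap]
  have hw' : barOp c * barOp W + barOp W * barOp c =
      star M * A * barOp c - barOp c * star A * M := by
    have := congrArg barOp hw
    simpa only [barOp_add, barOp_sub, barOp_mul, hA, hA', hM, hM'] using this
  have hY : W * A - A * barOp W =
      c * c * M - c * M * barOp c + M * barOp c * barOp c - M - A * star M * A :=
    sylvester_unique (one_le_cOp u) (one_le_barOp (one_le_cOp u))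
      (commutator_identity hc hc' hac hw hw')
  have key := rhs_transpose_identity hc hc' hr hr' har hY
  have hsc : star c = c := star_cOp u
  have hsr : star r = r := by
    have h1 := congrArg star hr
    rw [star_mul, hsc, star_one] at h1
    calc star r = r * c * star r := by rw [hr, one_mul]
      _ = r := by rw [mul_assoc, h1, mul_one]
  have hsW : star W = -W := star_kernelOp_WMap u m
  rw [← barOp_barOp (star _)]
  congr 1
  have e1 : barOp (star (c * M + (1 / 2 : ℂ) • ((W * r - r * W) * A)
      + (1 / 2 : ℂ) • ((r * M * star A + A * star M * r) * A))) =
      (1 / 2 : ℂ) • (2 * (M * barOp c) + A * (barOp W * barOp r - barOp r * barOp W)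
        + A * (star A * M * barOp r + barOp r * star M * A)) := by
    simp only [star_add, star_smul, star_mul, star_sub, star_star, hsc, hsr, hsW, barOp_add,
      barOp_smul, barOp_mul, barOp_sub, barOp_neg, hA, hA', hM, hM']
    have h3 : M * barOp c = (1 / 2 : ℂ) • (2 * (M * barOp c)) := by
      rw [two_mul, ← two_smul ℂ, smul_smul]; norm_num
    conv_lhs => rw [h3]
    rw [← smul_add, ← smul_add]
    congr 1
    noncomm_ring
  rw [e1, ← key]
  have h3 : c * M = (1 / 2 : ℂ) • (2 * (c * M)) := by
    rw [two_mul, ← two_smul ℂ, smul_smul]; norm_num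
  conv_rhs => rw [h3]
  rw [← smul_add, ← smul_add]

/-! ### Multiplication operators on `L²` -/

section Multiplication

variable {α : Type*} [MeasurableSpace α] {μ : Measure α}

lemma memLp_mul_bdd {g : α → ℂ} (hg : Measurable g) {C : ℝ} (hC : ∀ x, ‖g x‖ ≤ C)
    (f : Lp ℂ 2 μ) : MemLp (fun x => g x * f x) 2 μ := by
  refine MemLp.of_le_mul (c := C) (Lp.memLp f)
    (hg.aestronglyMeasurable.mul (Lp.aestronglyMeasurable f)) (ae_of_all _ fun x => ?_)
  rw [norm_mul]
  exact mul_le_mul_of_nonneg_right (hC x) (norm_nonneg _)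

/-- Multiplication by a bounded measurable function. -/
def mulL (g : α → ℂ) (hg : Measurable g) (C : ℝ) (hC : ∀ x, ‖g x‖ ≤ C) :
    Lp ℂ 2 μ →L[ℂ] Lp ℂ 2 μ :=
  LinearMap.mkContinuous
    { toFun := fun f => (memLp_mul_bdd hg hC f).toLp _
      map_add' := fun f f' => by
        rw [← MemLp.toLp_add]
        refine MemLp.toLp_congr _ _ ?_
        filter_upwards [Lp.coeFn_add f f'] with x hx
        rw [hx, Pi.add_apply, Pi.add_apply, mul_add]
      map_smul' := fun c f => by
        rw [RingHom.id_apply, ← MemLp.toLp_const_smul]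
        refine MemLp.toLp_congr _ _ ?_
        filter_upwards [Lp.coeFn_smul c f] with x hx
        rw [hx, Pi.smul_apply, Pi.smul_apply, smul_eq_mul, smul_eq_mul]
        ring }
    C (fun f => by
      refine Lp.norm_le_mul_norm_of_ae_le_mul ?_
      filter_upwards [(memLp_mul_bdd hg hC f).coeFn_toLp] with x hx
      change ‖((memLp_mul_bdd hg hC f).toLp _ : α → ℂ) x‖ ≤ _
      rw [hx, norm_mul]
      exact mul_le_mul_of_nonneg_right (hC x) (norm_nonneg _))

lemma mulL_ae (g : α → ℂ) (hg : Measurable g) (C : ℝ) (hC : ∀ x, ‖g x‖ ≤ C) (f : Lp ℂ 2 μ) :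
    (mulL g hg C hC f : α → ℂ) =ᵐ[μ] fun x => g x * f x :=
  (memLp_mul_bdd hg hC f).coeFn_toLp

lemma norm_mulL_apply_le (g : α → ℂ) (hg : Measurable g) (C : ℝ) (hC : ∀ x, ‖g x‖ ≤ C)
    (f : Lp ℂ 2 μ) : ‖mulL g hg C hC f‖ ≤ C * ‖f‖ := by
  refine Lp.norm_le_mul_norm_of_ae_le_mul ?_
  filter_upwards [mulL_ae g hg C hC f] with x hx
  rw [hx, norm_mul]
  exact mul_le_mul_of_nonneg_right (hC x) (norm_nonneg _)

end Multiplication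

/-! ### The free Schrödinger group on `L²(ℝ³)` -/

open FourierTransform SchwartzMap Laplacian

/-- The symbol `4π²|ξ|²` of `-Δ`. -/
def symb (ξ : E3) : ℝ := (2 * Real.pi) ^ 2 * ‖ξ‖ ^ 2

lemma continuous_symb : Continuous symb := by unfold symb; fun_prop

/-- The phase `e^{4π² i t |ξ|²}`. -/
def phase (t : ℝ) (ξ : E3) : ℂ := Complex.exp (Complex.I * ((t * symb ξ : ℝ) : ℂ))

lemma measurable_phase (t : ℝ) : Measurable (phase t) := by
  have := continuous_symb
  refine Continuous.measurable ?_
  unfold phase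
  fun_prop

lemma norm_phase (t : ℝ) (ξ : E3) : ‖phase t ξ‖ = 1 := by
  rw [phase, mul_comm]
  exact Complex.norm_exp_ofReal_mul_I _

lemma phase_add (s t : ℝ) (ξ : E3) : phase (s + t) ξ = phase s ξ * phase t ξ := by
  rw [phase, phase, phase, ← Complex.exp_add]
  congr 1
  push_cast
  ring

lemma conj_phase (t : ℝ) (ξ : E3) : (starRingEnd ℂ) (phase t ξ) = phase (-t) ξ := by
  rw [phase, phase, ← Complex.exp_conj]
  congr 1
  simp

/-- Multiplication by the phase. -/
def mulPhase (t : ℝ) : H →L[ℂ] H :=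
  mulL (phase t) (measurable_phase t) 1 (fun ξ => (norm_phase t ξ).le)

lemma mulPhase_ae (t : ℝ) (f : H) :
    (mulPhase t f : E3 → ℂ) =ᵐ[volume] fun ξ => phase t ξ * f ξ := mulL_ae _ _ _ _ f

lemma mulPhase_add (s t : ℝ) : mulPhase (s + t) = mulPhase s * mulPhase t := by
  ext1 f
  change _ = mulPhase s (mulPhase t f)
  refine Lp.ext ?_
  filter_upwards [mulPhase_ae (s + t) f, mulPhase_ae s (mulPhase t f), mulPhase_ae t f]
    with ξ h1 h2 h3
  rw [h1, h2, h3, phase_add, mul_assoc]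

@[simp] lemma mulPhase_zero : mulPhase 0 = 1 := by
  ext1 f
  refine Lp.ext ?_
  filter_upwards [mulPhase_ae 0 f] with ξ h1
  rw [h1]
  simp [phase]

lemma star_mulPhase (t : ℝ) : star (mulPhase t) = mulPhase (-t) := by
  rw [ContinuousLinearMap.star_eq_adjoint, eq_comm, ContinuousLinearMap.eq_adjoint_iff]
  intro f g
  rw [L2.inner_def, L2.inner_def]
  refine integral_congr_ae ?_
  filter_upwards [mulPhase_ae (-t) f, mulPhase_ae t g] with ξ h1 h2
  rw [h1, h2]
  simp only [RCLike.inner_apply, map_mul]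
  rw [← conj_phase, RCLike.conj_conj]
  ring

lemma barOp_mulPhase (t : ℝ) : barOp (mulPhase t) = mulPhase (-t) := by
  ext1 f
  rw [barOp_apply]
  refine Lp.ext ?_
  filter_upwards [mulPhase_ae (-t) f, star_ae_eq (mulPhase t (star f)), mulPhase_ae t (star f),
    star_ae_eq f] with ξ h1 h2 h3 h4
  rw [h1, h2, h3, h4, map_mul, conj_phase, RCLike.conj_conj]

/-- The Fourier transform as an operator. -/
def fourierOp : H →L[ℂ] H := (Lp.fourierTransformₗᵢ E3 ℂ : H →L[ℂ] H)

/-- The inverse Fourier transform as an operator. -/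
def fourierInvOp : H →L[ℂ] H := ((Lp.fourierTransformₗᵢ E3 ℂ).symm : H →L[ℂ] H)

lemma fourierInvOp_mul_fourierOp : fourierInvOp * fourierOp = 1 := by
  ext1 f
  exact (Lp.fourierTransformₗᵢ E3 ℂ).symm_apply_apply f

lemma fourierOp_mul_fourierInvOp : fourierOp * fourierInvOp = 1 := by
  ext1 f
  exact (Lp.fourierTransformₗᵢ E3 ℂ).apply_symm_apply f

lemma star_fourierOp : star fourierOp = fourierInvOp := by
  rw [ContinuousLinearMap.star_eq_adjoint, eq_comm, ContinuousLinearMap.eq_adjoint_iff]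
  intro f g
  have h := (Lp.fourierTransformₗᵢ E3 ℂ).inner_map_map (fourierInvOp f) g
  have h2 : (Lp.fourierTransformₗᵢ E3 ℂ) (fourierInvOp f) = f :=
    (Lp.fourierTransformₗᵢ E3 ℂ).apply_symm_apply f
  rw [h2] at h
  exact h.symm

/-- The class in `L²` of a Schwartz function. -/
def schw (θ : 𝓢(E3, ℂ)) : H := θ.toLp 2 volume

lemma schw_ae (θ : 𝓢(E3, ℂ)) : (schw θ : E3 → ℂ) =ᵐ[volume] θ := θ.coeFn_toLp 2 volume

lemma fourierOp_schw (θ : 𝓢(E3, ℂ)) : fourierOp (schw θ) = schw (𝓕 θ) :=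
  SchwartzMap.toLp_fourier_eq θ

lemma fourierInvOp_schw (θ : 𝓢(E3, ℂ)) : fourierInvOp (schw θ) = schw (𝓕⁻ θ) :=
  SchwartzMap.toLp_fourierInv_eq θ

/-- Properties closed under limits that hold for Schwartz functions hold on `L²`. -/
lemma schwartz_induction {p : H → Prop} (hp : IsClosed {f | p f})
    (h : ∀ θ : 𝓢(E3, ℂ), p (schw θ)) (f : H) : p f :=
  (SchwartzMap.denseRange_toLpCLM (E := E3) (F := ℂ) (μ := volume)
    (p := 2) ENNReal.ofNat_ne_top).induction_on f hp h

lemma ext_schwartz {A B : H →L[ℂ] H} (h : ∀ θ : 𝓢(E3, ℂ), A (schw θ) = B (schw θ)) : A = B := by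
  ext1 f
  exact schwartz_induction (p := fun f => A f = B f)
    (isClosed_eq A.continuous B.continuous) h f

/-- The reflection `f(x) ↦ f(-x)`. -/
def reflOp : H →L[ℂ] H :=
  (Lp.compMeasurePreservingₗᵢ ℂ (fun x : E3 => -x)
    (Measure.measurePreserving_neg volume)).toContinuousLinearMap

lemma reflOp_ae (f : H) : (reflOp f : E3 → ℂ) =ᵐ[volume] fun x => f (-x) :=
  Lp.coeFn_compMeasurePreserving f (Measure.measurePreserving_neg volume)

lemma ae_neg {P : E3 → Prop} (h : ∀ᵐ x, P x) : ∀ᵐ x : E3, P (-x) :=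
  (Measure.measurePreserving_neg (volume : Measure E3)).quasiMeasurePreserving.ae h

lemma reflOp_mul_fourierInvOp : reflOp * fourierInvOp = fourierOp := by
  refine ext_schwartz fun θ => ?_
  change reflOp (fourierInvOp _) = _
  rw [fourierOp_schw, fourierInvOp_schw]
  refine Lp.ext ?_
  filter_upwards [reflOp_ae (schw (𝓕⁻ θ)), ae_neg (schw_ae (𝓕⁻ θ)),
    schw_ae (𝓕 θ)] with x h1 h2 h3
  rw [h1, h2, h3, SchwartzMap.fourierInv_apply_eq]
  simp

lemma reflOp_mul_reflOp : reflOp * reflOp = 1 := by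
  ext1 f
  change reflOp (reflOp f) = f
  refine Lp.ext ?_
  filter_upwards [reflOp_ae (reflOp f), ae_neg (reflOp_ae f)] with x h1 h2
  rw [h1, h2, neg_neg]

lemma reflOp_mul_mulPhase (t : ℝ) : reflOp * mulPhase t = mulPhase t * reflOp := by
  ext1 f
  change reflOp (mulPhase t f) = mulPhase t (reflOp f)
  refine Lp.ext ?_
  filter_upwards [reflOp_ae (mulPhase t f), ae_neg (mulPhase_ae t f), mulPhase_ae t (reflOp f),
    reflOp_ae f] with x h1 h2 h3 h4
  rw [h1, h2, h3, h4]
  simp [phase, symb]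

lemma fourierInvOp_mul_reflOp : fourierInvOp * reflOp = fourierOp := by
  have h1 : fourierOp * reflOp = fourierInvOp := by
    calc fourierOp * reflOp
        = fourierInvOp * fourierOp * (fourierOp * reflOp) := by
          rw [fourierInvOp_mul_fourierOp, one_mul]
      _ = fourierInvOp * (reflOp * fourierInvOp * fourierOp * reflOp) := by
          rw [reflOp_mul_fourierInvOp]; noncomm_ring
      _ = fourierInvOp := by
          rw [mul_assoc reflOp, fourierInvOp_mul_fourierOp, mul_one, reflOp_mul_reflOp, mul_one]
  rw [← h1, mul_assoc, reflOp_mul_reflOp, mul_one]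

/-- The self-duality ∫ f̂ g = ∫ f ĝ on Schwartz functions, rewritten with the sesquilinear inner
product, where the adjoint of the Fourier transform is its inverse. -/
lemma barOp_fourierOp : barOp fourierOp = fourierInvOp := by
  have h0 : ∀ θ η : 𝓢(E3, ℂ), inner ℂ (star (schw θ)) (fourierOp (schw η)) =
      inner ℂ (star (fourierOp (schw θ))) (schw η) := by
    intro θ η
    rw [fourierOp_schw, fourierOp_schw, L2.inner_def, L2.inner_def]
    have e1 : ∫ x, inner ℂ ((star (schw θ) : H) x) (schw (𝓕 η) x) = ∫ x, θ x * 𝓕 η x := by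
      refine integral_congr_ae ?_
      filter_upwards [star_ae_eq (schw θ), schw_ae θ,
        schw_ae (𝓕 η)] with x h1 h2 h3
      rw [h1, h2, h3]
      simp [mul_comm]
    have e2 : ∫ x, inner ℂ ((star (schw (𝓕 θ)) : H) x) (schw η x) = ∫ x, 𝓕 θ x * η x := by
      refine integral_congr_ae ?_
      filter_upwards [star_ae_eq (schw (𝓕 θ)), schw_ae (𝓕 θ),
        schw_ae η] with x h1 h2 h3
      rw [h1, h2, h3]
      simp [mul_comm]
    rw [e1, e2]
    exact (SchwartzMap.integral_fourier_mul_eq θ η).symm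
  have h1 : ∀ (θ : 𝓢(E3, ℂ)) (g : H), inner ℂ (star (schw θ)) (fourierOp g) =
      inner ℂ (star (fourierOp (schw θ))) g := by
    intro θ g
    refine schwartz_induction (p := fun g => inner ℂ (star (schw θ)) (fourierOp g) =
      inner ℂ (star (fourierOp (schw θ))) g) ?_ (h0 θ) g
    exact isClosed_eq (by fun_prop) (by fun_prop)
  have h2 : ∀ θ : 𝓢(E3, ℂ), fourierInvOp (star (schw θ)) = star (fourierOp (schw θ)) := by
    intro θ
    refine ext_inner_right ℂ fun g => ?_
    rw [← h1, ← star_fourierOp, ContinuousLinearMap.star_eq_adjoint,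
      ContinuousLinearMap.adjoint_inner_left]
  have h3 : ∀ f : H, fourierInvOp (star f) = star (fourierOp f) := by
    intro f
    refine schwartz_induction (p := fun f => fourierInvOp (star f) = star (fourierOp f)) ?_ h2 f
    have hs : Continuous (fun f : H => star f) := conjL.continuous
    exact isClosed_eq (fourierInvOp.continuous.comp hs) (hs.comp fourierOp.continuous)
  ext1 f
  rw [barOp_apply, ← h3, star_star]

/-- The free Schrödinger group `e^{-itΔ}`. -/
def freeU (t : ℝ) : H →L[ℂ] H := fourierInvOp * mulPhase t * fourierOp

@[simp] lemma freeU_zero : freeU 0 = 1 := by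
  rw [freeU, mulPhase_zero, mul_one, fourierInvOp_mul_fourierOp]

lemma freeU_add (s t : ℝ) : freeU (s + t) = freeU s * freeU t := by
  rw [freeU, freeU, freeU, mulPhase_add]
  calc _ = fourierInvOp * mulPhase s * 1 * mulPhase t * fourierOp := by noncomm_ring
    _ = _ := by rw [← fourierOp_mul_fourierInvOp]; noncomm_ring

lemma star_freeU (t : ℝ) : star (freeU t) = freeU (-t) := by
  rw [freeU, freeU, star_mul, star_mul, star_mulPhase, star_fourierOp, ← star_fourierOp, star_star,
    mul_assoc]

/-- Complex conjugation reverses time. Combined with unitarity it says that e^{-itΔ} is symmetric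
under transposition, whence K ↦ e^{-itΔ} K e^{-itΔ} preserves symmetric kernels. The proof uses that
the symbol is even. -/
lemma barOp_freeU (t : ℝ) : barOp (freeU t) = freeU (-t) := by
  have h1 : barOp fourierInvOp = fourierOp := by rw [← barOp_fourierOp, barOp_barOp]
  rw [freeU, freeU, barOp_mul, barOp_mul, barOp_mulPhase, h1, barOp_fourierOp]
  calc fourierOp * mulPhase (-t) * fourierInvOp
      = fourierInvOp * (reflOp * mulPhase (-t)) * fourierInvOp := by
        rw [← fourierInvOp_mul_reflOp]; noncomm_ring
    _ = fourierInvOp * mulPhase (-t) * (reflOp * fourierInvOp) := by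
        rw [reflOp_mul_mulPhase]; noncomm_ring
    _ = _ := by rw [reflOp_mul_fourierInvOp]

lemma freeU_mul_neg (t : ℝ) : freeU t * freeU (-t) = 1 := by
  rw [← freeU_add, add_neg_cancel, freeU_zero]

lemma freeU_neg_mul (t : ℝ) : freeU (-t) * freeU t = 1 := by
  rw [← freeU_add, neg_add_cancel, freeU_zero]

lemma norm_freeU_apply (t : ℝ) (f : H) : ‖freeU t f‖ = ‖f‖ := by
  have h : inner ℂ (freeU t f) (freeU t f) = inner ℂ f f := by
    rw [← ContinuousLinearMap.adjoint_inner_right, ← ContinuousLinearMap.star_eq_adjoint,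
      star_freeU]
    change inner ℂ f ((freeU (-t) * freeU t) f) = _
    rw [freeU_neg_mul]; rfl
  rw [inner_self_eq_norm_sq_to_K, inner_self_eq_norm_sq_to_K] at h
  have h2 : ‖freeU t f‖ ^ 2 = ‖f‖ ^ 2 := by exact_mod_cast h
  exact (pow_left_inj₀ (norm_nonneg _) (norm_nonneg _) two_ne_zero).1 h2

lemma norm_freeU_le (t : ℝ) : ‖freeU t‖ ≤ 1 :=
  ContinuousLinearMap.opNorm_le_bound _ zero_le_one fun f => by rw [norm_freeU_apply, one_mul]

lemma fourier_laplacian_apply (θ : 𝓢(E3, ℂ)) (ξ : E3) :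
    𝓕 (Δ θ) ξ = -(symb ξ : ℂ) * 𝓕 θ ξ := by
  rw [SchwartzMap.laplacian_eq_fourierMultiplierCLM, SchwartzMap.fourierMultiplierCLM_apply,
    FourierTransform.fourier_smul, FourierTransform.fourier_fourierInv_eq]
  rw [smul_apply, SchwartzMap.smulLeftCLM_apply_apply (by fun_prop)]
  simp [symb]
  ring

lemma norm_exp_sub_one_sub_le (x : ℝ) :
    ‖Complex.exp (Complex.I * (x : ℂ)) - 1 - Complex.I * (x : ℂ)‖ ≤ 2 * x ^ 2 := by
  by_cases hx : |x| ≤ 1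
  · have h := Complex.norm_exp_sub_one_sub_id_le (x := Complex.I * (x : ℂ)) (by simpa using hx)
    refine h.trans ?_
    simp only [norm_mul, Complex.norm_I, one_mul, Complex.norm_real, Real.norm_eq_abs, sq_abs]
    nlinarith [sq_nonneg x]
  · rw [not_le] at hx
    refine (norm_sub_le _ _).trans ?_
    have h1 := Real.norm_exp_I_mul_ofReal_sub_one_le (x := x)
    rw [Real.norm_eq_abs] at h1
    simp only [norm_mul, Complex.norm_I, one_mul, Complex.norm_real, Real.norm_eq_abs]
    have h2 : x ^ 2 = |x| ^ 2 := (sq_abs x).symm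
    nlinarith

/-- Second-order Taylor bound of the phase on the Fourier side; the square of the symbol is paid for
by two Laplacians on θ. -/
lemma norm_freeU_sub_sub_le (θ : 𝓢(E3, ℂ)) (h : ℝ) :
    ‖freeU h (schw θ) - schw θ - h • ((-Complex.I) • (schw (Δ θ)))‖
      ≤ 2 * h ^ 2 * ‖(schw (Δ (Δ θ)))‖ := by
  have e : freeU h (schw θ) - schw θ - h • ((-Complex.I) • (schw (Δ θ))) =
      fourierInvOp (mulPhase h (schw (𝓕 θ)) - schw (𝓕 θ)
        - (h : ℂ) • ((-Complex.I) • (schw (𝓕 (Δ θ))))) := by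
    have h1 : ∀ η : 𝓢(E3, ℂ), fourierInvOp (schw (𝓕 η)) = schw η := by
      intro η
      rw [← fourierOp_schw]
      exact congrArg (fun A : H →L[ℂ] H => A (schw η)) fourierInvOp_mul_fourierOp
    rw [map_sub, map_sub, map_smul, map_smul, h1, h1, ← fourierOp_schw]
    rfl
  have hn : ∀ f : H, ‖fourierInvOp f‖ = ‖f‖ := fun f =>
    (Lp.fourierTransformₗᵢ E3 ℂ).symm.norm_map f
  have hn2 : ‖(schw (Δ (Δ θ)))‖ = ‖(schw (𝓕 (Δ (Δ θ))))‖ := by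
    rw [← fourierOp_schw]
    exact ((Lp.fourierTransformₗᵢ E3 ℂ).norm_map _).symm
  rw [e, hn, hn2]
  refine Lp.norm_le_mul_norm_of_ae_le_mul ?_
  filter_upwards [Lp.coeFn_sub (mulPhase h (schw (𝓕 θ)) - schw (𝓕 θ))
      ((h : ℂ) • ((-Complex.I) • (schw (𝓕 (Δ θ))))),
    Lp.coeFn_sub (mulPhase h (schw (𝓕 θ))) (schw (𝓕 θ)),
    Lp.coeFn_smul (h : ℂ) ((-Complex.I) • (schw (𝓕 (Δ θ)))),
    Lp.coeFn_smul (-Complex.I) (schw (𝓕 (Δ θ))),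
    mulPhase_ae h (schw (𝓕 θ)), schw_ae (𝓕 θ), schw_ae (𝓕 (Δ θ)),
    schw_ae (𝓕 (Δ (Δ θ)))] with ξ h1 h2 h3 h4 h5 h6 h7 h8
  rw [h1, Pi.sub_apply, h2, Pi.sub_apply, h3, Pi.smul_apply, h4, Pi.smul_apply, h5, h6, h7, h8,
    fourier_laplacian_apply, fourier_laplacian_apply, fourier_laplacian_apply]
  have e2 : phase h ξ * 𝓕 θ ξ - 𝓕 θ ξ - (h : ℂ) • (-Complex.I) • (-(symb ξ : ℂ) * 𝓕 θ ξ) =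
      (Complex.exp (Complex.I * ((h * symb ξ : ℝ) : ℂ)) - 1 - Complex.I * ((h * symb ξ : ℝ) : ℂ))
        * 𝓕 θ ξ := by
    rw [phase]
    simp only [smul_eq_mul]
    push_cast
    ring
  rw [e2, norm_mul]
  refine (mul_le_mul_of_nonneg_right (norm_exp_sub_one_sub_le _) (norm_nonneg _)).trans_eq ?_
  simp only [norm_mul, norm_neg, Complex.norm_real, Real.norm_eq_abs]
  rw [mul_pow, ← sq_abs (symb ξ)]
  ring

lemma hasDerivAt_freeU_zero (θ : 𝓢(E3, ℂ)) :
    HasDerivAt (fun t => freeU t (schw θ)) ((-Complex.I) • (schw (Δ θ))) 0 := by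
  rw [hasDerivAt_iff_isLittleO_nhds_zero]
  refine Asymptotics.IsBigO.trans_isLittleO (g := fun h : ℝ => h ^ 2) ?_ ?_
  · refine Asymptotics.IsBigO.of_bound (2 * ‖(schw (Δ (Δ θ)))‖)
      (Filter.Eventually.of_forall fun h => ?_)
    have := norm_freeU_sub_sub_le θ h
    simp only [zero_add, freeU_zero]
    refine this.trans_eq ?_
    rw [norm_pow, Real.norm_eq_abs, sq_abs]
    ring
  · exact Asymptotics.isLittleO_pow_id one_lt_two

lemma hasDerivAt_freeU (θ : 𝓢(E3, ℂ)) (t : ℝ) :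
    HasDerivAt (fun t => freeU t (schw θ)) ((-Complex.I) • freeU t (schw (Δ θ))) t := by
  have h0 := hasDerivAt_freeU_zero θ
  have h1 : HasDerivAt (fun s => freeU (s - t) (schw θ))
      ((-Complex.I) • (schw (Δ θ))) t := by
    have := (sub_self t).symm ▸ h0
    exact HasDerivAt.comp_sub_const t t this
  have h2 := ((freeU t).restrictScalars ℝ).hasFDerivAt.comp_hasDerivAt t h1
  have e : (fun s => freeU s (schw θ)) =
      ((freeU t).restrictScalars ℝ) ∘ fun s => freeU (s - t) (schw θ) := by
    funext s
    change _ = (freeU t * freeU (s - t)) _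
    rw [← freeU_add, add_sub_cancel]
  rw [e, ← map_smul]
  exact h2

/-- Strong continuity passes from Schwartz functions to the closure because the group is isometric,
uniformly in t. -/
lemma continuous_freeU (f : H) : Continuous fun t => freeU t f := by
  refine schwartz_induction (p := fun f => Continuous fun t => freeU t f) ?_ ?_ f
  · rw [isClosed_iff_frequently]
    intro f hf
    refine continuous_of_uniform_approx_of_continuous fun u hu => ?_
    obtain ⟨ε, hε, hεu⟩ := Metric.mem_uniformity_dist.1 hu
    obtain ⟨g, hg, hgf⟩ := (hf.and_eventually (Metric.ball_mem_nhds f hε)).exists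
    refine ⟨fun t => freeU t g, hg, fun t => hεu ?_⟩
    rw [dist_eq_norm, ← map_sub, norm_freeU_apply, ← dist_eq_norm, dist_comm]
    exact hgf
  · intro θ
    exact continuous_iff_continuousAt.2 fun t => (hasDerivAt_freeU θ t).continuousAt

/-- Differentiating ⟨U_t θ, ζ⟩ = ⟨θ, U_{-t} ζ⟩ in t in both forms and comparing moves the Laplacian
across without any integration by parts. -/
lemma inner_freeU_laplacian (θ ζ : 𝓢(E3, ℂ)) (t : ℝ) :
    inner ℂ (freeU t (schw (Δ θ))) (schw ζ) =
      inner ℂ (freeU t (schw θ)) (schw (Δ ζ)) := by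
  have h1 := (hasDerivAt_freeU θ t).inner ℂ (hasDerivAt_const t (schw ζ))
  have h2 := (hasDerivAt_const t (schw θ)).inner ℂ
    ((hasDerivAt_freeU ζ (-t)).scomp t (hasDerivAt_neg t))
  have hadj : ∀ (s : ℝ) (f g : H), inner ℂ (freeU s f) g = inner ℂ f (freeU (-s) g) := by
    intro s f g
    rw [← star_freeU, ContinuousLinearMap.star_eq_adjoint,
      ContinuousLinearMap.adjoint_inner_right]
  have e : (fun s => inner ℂ (freeU s (schw θ)) (schw ζ)) =
      fun s => inner ℂ (schw θ) (((fun t => freeU t (schw ζ)) ∘ Neg.neg) s) := by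
    funext s
    exact hadj s _ _
  rw [e] at h1
  have h3 := h1.unique h2
  simp only [inner_zero_right, inner_zero_left, zero_add, add_zero, inner_smul_left,
    inner_smul_right, Function.comp, neg_smul, one_smul, inner_neg_right, inner_neg_left] at h3
  rw [hadj t (schw θ)]
  have hI : (Complex.I : ℂ) ≠ 0 := Complex.I_ne_zero
  simpa [hI] using h3

/-! ### Primitives of integrable functions -/

section Primitive

variable {E F G : Type*} [NormedAddCommGroup E] [NormedSpace ℝ E] [NormedAddCommGroup F]
  [NormedSpace ℝ F] [CompleteSpace F] [NormedAddCommGroup G] [NormedSpace ℝ G] [CompleteSpace G]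

/-- `a` is a primitive on `[0, T]` of the integrable function `g`. -/
structure IsPrimitive (T : ℝ) (a g : ℝ → E) : Prop where
  integrable : IntervalIntegrable g volume 0 T
  eq_add : ∀ t ∈ Icc 0 T, a t = a 0 + ∫ s in (0 : ℝ)..t, g s

namespace IsPrimitive

variable {T : ℝ} {a g : ℝ → E} {b h : ℝ → F}

lemma intervalIntegrable (H : IsPrimitive T a g) {s t : ℝ} (hs : s ∈ Icc 0 T) (ht : t ∈ Icc 0 T) :
    IntervalIntegrable g volume s t := by
  refine H.integrable.mono_set ?_
  rw [uIcc_of_le (hs.1.trans hs.2)]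
  exact uIcc_subset_Icc hs ht

lemma sub_eq (H : IsPrimitive T a g) {s t : ℝ} (hs : s ∈ Icc 0 T) (ht : t ∈ Icc 0 T) :
    a t - a s = ∫ r in s..t, g r := by
  have h0 : (0 : ℝ) ∈ Icc 0 T := ⟨le_rfl, hs.1.trans hs.2⟩
  rw [H.eq_add t ht, H.eq_add s hs, add_sub_add_left_eq_sub,
    intervalIntegral.integral_interval_sub_left (H.intervalIntegrable h0 ht)
      (H.intervalIntegrable h0 hs)]

lemma continuousOn (H : IsPrimitive T a g) (hT : 0 ≤ T) : ContinuousOn a (Icc 0 T) := by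
  have h1 : ContinuousOn (fun t => a 0 + ∫ s in (0 : ℝ)..t, g s) (Icc 0 T) := by
    refine continuousOn_const.add ?_
    have := intervalIntegral.continuousOn_primitive_interval' (a := 0) H.integrable
      (by simp)
    rwa [uIcc_of_le hT] at this
  exact h1.congr H.eq_add

/-- The chain rule along a primitive of an integrable function. -/
theorem comp [CompleteSpace E] (H : IsPrimitive T a g) (hT : 0 ≤ T) {S : Set E} (haS : ∀ t ∈ Icc 0 T, a t ∈ S)
    {Φ : E → F} {Φ' : ℝ → E →L[ℝ] F} (hΦ : ∀ t ∈ Icc 0 T, HasFDerivWithinAt Φ (Φ' t) S (a t))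
    (hΦ' : ContinuousOn Φ' (Icc 0 T)) :
    IsPrimitive T (fun t => Φ (a t)) (fun t => Φ' t (g t)) := by
  have hac := H.continuousOn hT
  have hint : IntervalIntegrable (fun t => Φ' t (g t)) volume 0 T := by
    have hgi := H.integrable
    rw [intervalIntegrable_iff_integrableOn_Icc_of_le hT] at hgi ⊢
    obtain ⟨C, hC⟩ := isCompact_Icc.exists_bound_of_continuousOn hΦ'
    refine Integrable.mono' (hgi.norm.const_mul C) ?_ ?_
    · exact (ContinuousLinearMap.id ℝ (E →L[ℝ] F)).aestronglyMeasurable_comp₂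
        (hΦ'.aestronglyMeasurable measurableSet_Icc) hgi.aestronglyMeasurable
    · refine (ae_restrict_iff' measurableSet_Icc).2 (Filter.Eventually.of_forall fun t ht => ?_)
      exact ((Φ' t).le_opNorm _).trans
        (mul_le_mul_of_nonneg_right (hC t ht) (norm_nonneg _))
  refine ⟨hint, fun t₁ ht₁ => ?_⟩
  have hsub : ∀ s ∈ Icc 0 T, ∀ t ∈ Icc 0 T,
      IntervalIntegrable (fun t => Φ' t (g t)) volume s t := fun s hs t ht => by
    refine hint.mono_set ?_
    rw [uIcc_of_le hT]
    exact uIcc_subset_Icc hs ht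
  have hng : ∀ s ∈ Icc 0 T, ∀ t ∈ Icc 0 T,
      IntervalIntegrable (fun t => ‖g t‖) volume s t := fun s hs t ht =>
    (H.intervalIntegrable hs ht).norm
  have h0 : (0 : ℝ) ∈ Icc 0 T := ⟨le_rfl, hT⟩
  -- The defect of the chain rule. Since g is merely integrable, a need not be differentiable at
  -- every time, so D is controlled by increments instead of derivatives.
  set D : ℝ → F := fun t => Φ (a t) - Φ (a 0) - ∫ s in (0 : ℝ)..t, Φ' s (g s) with hD
  have hDc : ContinuousOn D (Icc 0 T) := by
    refine ContinuousOn.sub (ContinuousOn.sub ?_ continuousOn_const) ?_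
    · intro t ht
      exact (hΦ t ht).continuousWithinAt.comp (hac t ht) haS
    · have := intervalIntegral.continuousOn_primitive_interval' (a := 0) hint (by simp)
      rwa [uIcc_of_le hT] at this
  have hNc : ContinuousOn (fun t => ∫ s in (0 : ℝ)..t, ‖g s‖) (Icc 0 T) := by
    have := intervalIntegral.continuousOn_primitive_interval' (a := 0) H.integrable.norm (by simp)
    rwa [uIcc_of_le hT] at this
  have key : ∀ ε > 0, ∀ t ∈ Icc 0 T, ‖D t‖ ≤ ε * ∫ s in (0 : ℝ)..t, ‖g s‖ := by
    intro ε hε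
    have hcl : IsClosed ({t | ‖D t‖ ≤ ε * ∫ s in (0 : ℝ)..t, ‖g s‖} ∩ Icc 0 T) := by
      have := (hDc.norm.prodMk (hNc.const_smul ε)).preimage_isClosed_of_isClosed isClosed_Icc
        OrderClosedTopology.isClosed_le'
      rw [inter_comm]
      exact this
    -- Continuous induction: the inequality defines a closed set containing 0, and it extends
    -- slightly to the right of each of its points. Half of ε absorbs the differentiability error of
    -- Φ and half the oscillation of Φ'.
    refine hcl.Icc_subset_of_forall_mem_nhdsWithin (by simp [hD]) ?_
    rintro t ⟨ht, ht0, htT⟩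
    have htI : t ∈ Icc 0 T := ⟨ht0, htT.le⟩
    have h1 := (hΦ t htI).isLittleO.def (c := ε / 2) (by positivity)
    have hat : Filter.Tendsto a (nhdsWithin t (Icc 0 T)) (nhdsWithin (a t) S) :=
      (hac t htI).tendsto_nhdsWithin haS
    have h1' := hat.eventually h1
    have h2 : ∀ᶠ s in nhdsWithin t (Icc 0 T), ‖Φ' s - Φ' t‖ ≤ ε / 2 := by
      have := (hΦ' t htI).eventually (Metric.closedBall_mem_nhds (Φ' t) (ε := ε / 2) (by positivity))
      filter_upwards [this] with s hs
      simpa [dist_eq_norm] using hs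
    obtain ⟨δ, hδ, hδ'⟩ := Metric.mem_nhdsWithin_iff.1 (h1'.and h2)
    have hmem : Ioo t (min (t + δ) T) ∈ nhdsWithin t (Ioi t) :=
      Ioo_mem_nhdsGT (lt_min (by linarith) htT)
    filter_upwards [hmem] with r hr
    have hrT : r < T := hr.2.trans_le (min_le_right _ _)
    have hrδ : r < t + δ := hr.2.trans_le (min_le_left _ _)
    have hrI : r ∈ Icc 0 T := ⟨ht0.trans hr.1.le, hrT.le⟩
    have hin : ∀ s ∈ Icc t r, s ∈ Metric.ball t δ ∩ Icc 0 T := fun s hs => by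
      refine ⟨?_, ht0.trans hs.1, hs.2.trans hrT.le⟩
      rw [Metric.mem_ball, Real.dist_eq, abs_of_nonneg (by linarith [hs.1])]
      linarith [hs.2]
    have e1 := (hδ' (hin r (right_mem_Icc.2 hr.1.le))).1
    have e2 : ∀ s ∈ Icc t r, ‖Φ' s - Φ' t‖ ≤ ε / 2 := fun s hs => (hδ' (hin s hs)).2
    have hnorm : ‖a r - a t‖ ≤ ∫ s in t..r, ‖g s‖ := by
      rw [H.sub_eq htI hrI]
      exact intervalIntegral.norm_integral_le_integral_norm hr.1.le
    have hlin : Φ' t (a r - a t) = ∫ s in t..r, Φ' t (g s) := by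
      rw [H.sub_eq htI hrI, (Φ' t).intervalIntegral_comp_comm (H.intervalIntegrable htI hrI)]
    have hDr : D r - D t = (Φ (a r) - Φ (a t) - Φ' t (a r - a t))
        - ∫ s in t..r, (Φ' s - Φ' t) (g s) := by
      have i1 : (∫ s in (0 : ℝ)..r, Φ' s (g s)) - ∫ s in (0 : ℝ)..t, Φ' s (g s)
          = ∫ s in t..r, Φ' s (g s) :=
        intervalIntegral.integral_interval_sub_left (hsub 0 h0 r hrI) (hsub 0 h0 t htI)
      have hconst (hi : IntervalIntegrable g volume t r) :
          IntervalIntegrable (fun s => Φ' t (g s)) volume t r :=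
        ⟨(Φ' t).integrable_comp hi.1, (Φ' t).integrable_comp hi.2⟩
      have i2 : ∫ s in t..r, (Φ' s - Φ' t) (g s)
          = (∫ s in t..r, Φ' s (g s)) - ∫ s in t..r, Φ' t (g s) := by
        rw [← intervalIntegral.integral_sub (hsub t htI r hrI)
          (hconst (H.intervalIntegrable htI hrI))]
        rfl
      rw [i2, ← i1, hlin]
      simp only [hD]
      abel
    have hI2 : ‖∫ s in t..r, (Φ' s - Φ' t) (g s)‖ ≤ ε / 2 * ∫ s in t..r, ‖g s‖ := by
      rw [← intervalIntegral.integral_const_mul]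
      refine intervalIntegral.norm_integral_le_of_norm_le hr.1.le
        (Filter.Eventually.of_forall fun s hs => ?_) ((hng t htI r hrI).const_mul _)
      exact ((Φ' s - Φ' t).le_opNorm _).trans
        (mul_le_mul_of_nonneg_right (e2 s ⟨hs.1.le, hs.2⟩) (norm_nonneg _))
    have hsum : (∫ s in (0 : ℝ)..t, ‖g s‖) + ∫ s in t..r, ‖g s‖ = ∫ s in (0 : ℝ)..r, ‖g s‖ :=
      intervalIntegral.integral_add_adjacent_intervals (hng 0 h0 t htI) (hng t htI r hrI)
    have hfin : ‖D r - D t‖ ≤ ε * ∫ s in t..r, ‖g s‖ := by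
      rw [hDr]
      refine (norm_sub_le _ _).trans ?_
      have := e1.trans (mul_le_mul_of_nonneg_left hnorm (by positivity))
      linarith
    have ht' : ‖D t‖ ≤ ε * ∫ s in (0 : ℝ)..t, ‖g s‖ := ht
    show ‖D r‖ ≤ ε * ∫ s in (0 : ℝ)..r, ‖g s‖
    calc ‖D r‖ = ‖D t + (D r - D t)‖ := by rw [add_sub_cancel]
      _ ≤ ‖D t‖ + ‖D r - D t‖ := norm_add_le _ _
      _ ≤ _ := by rw [← hsum, mul_add]; exact add_le_add ht' hfin
  have hzero : ‖D t₁‖ ≤ 0 := by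
    have hc : Filter.Tendsto (fun ε : ℝ => ε * ∫ s in (0 : ℝ)..t₁, ‖g s‖)
        (nhdsWithin 0 (Ioi 0)) (nhds 0) := by
      have : Filter.Tendsto (fun ε : ℝ => ε * ∫ s in (0 : ℝ)..t₁, ‖g s‖) (nhds 0)
        (nhds (0 * ∫ s in (0 : ℝ)..t₁, ‖g s‖)) := Filter.Tendsto.mul_const _ Filter.tendsto_id
      rw [zero_mul] at this
      exact this.mono_left nhdsWithin_le_nhds
    exact ge_of_tendsto hc (by filter_upwards [self_mem_nhdsWithin] with ε hε using key ε hε t₁ ht₁)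
  have := norm_le_zero_iff.1 hzero
  simp only [hD] at this
  rw [sub_sub, sub_eq_zero] at this
  exact this

lemma clm [CompleteSpace E] (H : IsPrimitive T a g) (hT : 0 ≤ T) (L : E →L[ℝ] F) :
    IsPrimitive T (fun t => L (a t)) (fun t => L (g t)) :=
  H.comp hT (S := univ) (fun _ _ => mem_univ _) (Φ' := fun _ => L)
    (fun _ _ => L.hasFDerivWithinAt) continuousOn_const

lemma prodMk [CompleteSpace E] (H : IsPrimitive T a g) (H' : IsPrimitive T b h) :
    IsPrimitive T (fun t => (a t, b t)) (fun t => (g t, h t)) := by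
  have hi : IntervalIntegrable (fun t => (g t, h t)) volume 0 T :=
    ⟨H.integrable.1.prodMk H'.integrable.1, H.integrable.2.prodMk H'.integrable.2⟩
  refine ⟨hi, fun t ht => ?_⟩
  have h0 : (0 : ℝ) ∈ Icc 0 T := ⟨le_rfl, ht.1.trans ht.2⟩
  have hi' : IntervalIntegrable (fun t => (g t, h t)) volume 0 t :=
    hi.mono_set (by rw [uIcc_of_le h0.2]; exact uIcc_subset_Icc h0 ht)
  refine Prod.ext ?_ ?_
  · refine (H.eq_add t ht).trans (congrArg (a 0 + ·) ?_)
    exact (ContinuousLinearMap.intervalIntegral_comp_comm (ContinuousLinearMap.fst ℝ E F) hi')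
  · refine (H'.eq_add t ht).trans (congrArg (b 0 + ·) ?_)
    exact (ContinuousLinearMap.intervalIntegral_comp_comm (ContinuousLinearMap.snd ℝ E F) hi')

/-- The product rule for primitives. -/
lemma bilin [CompleteSpace E] (H : IsPrimitive T a g) (H' : IsPrimitive T b h)
    (hT : 0 ≤ T) (B : E →L[ℝ] F →L[ℝ] G) :
    IsPrimitive T (fun t => B (a t) (b t)) (fun t => B (a t) (h t) + B (g t) (b t)) := by
  have hB := fun t : ℝ => B.hasFDerivWithinAt_of_bilinear (s := (univ : Set (E × F)))
    (x := (a t, b t)) hasFDerivWithinAt_fst hasFDerivWithinAt_snd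
  have := (H.prodMk H').comp hT (S := univ) (fun _ _ => mem_univ _)
    (Φ := fun x => B x.1 x.2) (fun t _ => hB t) ?_
  · exact this
  · have hc := (H.continuousOn hT)
    have hc' := (H'.continuousOn hT)
    refine ContinuousOn.add ?_ ?_
    · exact ((ContinuousLinearMap.precompR (E × F) B).continuous.comp_continuousOn hc).clm_apply
        continuousOn_const
    · exact ((ContinuousLinearMap.precompL (E × F) B).continuous.comp_continuousOn
        continuousOn_const).clm_apply hc'

end IsPrimitive

end Primitive

/-! ### Ordinary differential equations with integrable time dependence -/

section Ode

variable {E : Type*} [NormedAddCommGroup E]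

/-- A Carathéodory superposition lemma: the claim is clear along simple functions, and continuity in
the second variable passes to the limit. -/
lemma aestronglyMeasurable_comp_of_lipschitz {μ : Measure ℝ} {f : ℝ → E → E} {ℓ : ℝ → ℝ}
    (hm : ∀ x, AEStronglyMeasurable (fun t => f t x) μ)
    (hl : ∀ t x y, ‖f t x - f t y‖ ≤ ℓ t * ‖x - y‖) {x : ℝ → E}
    (hx : AEStronglyMeasurable x μ) :
    AEStronglyMeasurable (fun t => f t (x t)) μ := by
  obtain ⟨y, hy, hxy⟩ := hx
  have h2 : AEStronglyMeasurable (fun t => f t (y t)) μ := by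
    refine aestronglyMeasurable_of_tendsto_ae Filter.atTop
      (f := fun n t => f t (hy.approx n t)) (fun n => ?_)
      (Filter.Eventually.of_forall fun t => ?_)
    · have hfin := (hy.approx n).finite_range
      classical
      have : (fun t => f t (hy.approx n t)) = fun t =>
          ∑ c ∈ hfin.toFinset, ((hy.approx n) ⁻¹' {c}).indicator (fun t => f t c) t := by
        funext t
        rw [Finset.sum_eq_single (hy.approx n t)]
        · simp
        · intro c _ hc
          rw [indicator_of_notMem]
          simpa using fun h => hc h.symm
        · intro h
          exact absurd (by simp) h
      rw [this]
      refine Finset.aestronglyMeasurable_fun_sum _ fun c _ => ?_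
      exact (hm c).indicator ((hy.approx n).measurableSet_fiber c)
    · rw [tendsto_iff_norm_sub_tendsto_zero]
      have h0 := (tendsto_iff_norm_sub_tendsto_zero.1 (hy.tendsto_approx t)).const_mul (ℓ t)
      rw [mul_zero] at h0
      exact squeeze_zero (fun _ => norm_nonneg _) (fun n => hl t _ _) h0
  refine h2.congr ?_
  filter_upwards [hxy] with t ht
  rw [ht]

/-- Global solvability of `x' = f(t, x)` for a vector field which is Lipschitz in `x`, with an
integrable Lipschitz constant. -/
theorem exists_isPrimitive_of_lipschitz [NormedSpace ℝ E] [CompleteSpace E] {T : ℝ} (hT : 0 ≤ T) {f : ℝ → E → E} {ℓ : ℝ → ℝ}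
    (hm : ∀ x, AEStronglyMeasurable (fun t => f t x) (volume.restrict (Icc 0 T)))
    (hl : ∀ t x y, ‖f t x - f t y‖ ≤ ℓ t * ‖x - y‖)
    (hℓ0 : ∀ t, 0 ≤ ℓ t) (hℓ : IntegrableOn ℓ (Icc 0 T))
    (hf0 : IntegrableOn (fun t => f t 0) (Icc 0 T))
    (x₀ : E) :
    ∃ x : ℝ → E, x 0 = x₀ ∧ IsPrimitive T x (fun t => f t (x t)) := by
  have hint : ∀ x : ℝ → E, ContinuousOn x (Icc 0 T) →
      IntegrableOn (fun t => f t (x t)) (Icc 0 T) := by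
    intro x hx
    obtain ⟨C, hC⟩ := isCompact_Icc.exists_bound_of_continuousOn hx
    refine Integrable.mono' ((hℓ.mul_const C).add hf0.norm)
      (aestronglyMeasurable_comp_of_lipschitz hm hl
        (hx.aestronglyMeasurable measurableSet_Icc)) ?_
    refine (ae_restrict_iff' measurableSet_Icc).2 (Filter.Eventually.of_forall fun t ht => ?_)
    have h1 := hl t (x t) 0
    rw [sub_zero] at h1
    have h2 := mul_le_mul_of_nonneg_left (hC t ht) (hℓ0 t)
    calc ‖f t (x t)‖ = ‖(f t (x t) - f t 0) + f t 0‖ := by rw [sub_add_cancel]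
      _ ≤ ‖f t (x t) - f t 0‖ + ‖f t 0‖ := norm_add_le _ _
      _ ≤ _ := add_le_add (h1.trans h2) le_rfl
  have hΛ : IsPrimitive T (fun t => ∫ s in (0 : ℝ)..t, ℓ s) ℓ :=
    ⟨(intervalIntegrable_iff_integrableOn_Icc_of_le hT).2 hℓ, fun t _ => by simp⟩
  set Λ : ℝ → ℝ := fun t => ∫ s in (0 : ℝ)..t, ℓ s with hΛdef
  have hΛc : ContinuousOn Λ (Icc 0 T) := hΛ.continuousOn hT
  -- The weight of the Bielecki norm: the integral of e^{2Λ}ℓ is at most e^{2Λ}/2, which gives a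
  -- contraction of ratio 1/2 on all of [0, T].
  have hexp : IsPrimitive T (fun t => Real.exp (2 * Λ t))
      (fun t => Real.exp (2 * Λ t) * 2 * ℓ t) := by
    have hd : ∀ y : ℝ, HasDerivAt (fun y => Real.exp (2 * y)) (Real.exp (2 * y) * 2) y := fun y => by
      simpa using ((hasDerivAt_id y).const_mul 2).exp
    have := hΛ.comp hT (S := univ) (fun _ _ => mem_univ _) (Φ := fun y => Real.exp (2 * y))
      (Φ' := fun t => ContinuousLinearMap.toSpanSingleton ℝ (Real.exp (2 * Λ t) * 2))
      (fun t _ => (hd (Λ t)).hasFDerivAt.hasFDerivWithinAt) ?_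
    · refine ⟨?_, ?_⟩
      · simpa [mul_comm, mul_assoc, mul_left_comm] using this.integrable
      · intro t ht
        rw [this.eq_add t ht]
        simp [mul_comm]
    · have : ContinuousOn (fun t => Real.exp (2 * Λ t) * 2) (Icc 0 T) := by fun_prop
      exact (ContinuousLinearMap.toSpanSingletonCLE (𝕜 := ℝ) (E := ℝ)).continuous.comp_continuousOn this
  let ext (y : C(Icc (0 : ℝ) T, E)) : ℝ → E := fun t => y (projIcc 0 T hT t)
  have hext : ∀ y, Continuous (ext y) := fun y => y.continuous.comp continuous_projIcc
  -- The fixed point is sought for the rescaled unknown y = e^{-2Λ}x, so that the ordinary sup norm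
  -- of y is the weighted norm of x.
  let ev (y : C(Icc (0 : ℝ) T, E)) : ℝ → E := fun t => Real.exp (2 * Λ t) • ext y t
  have hev : ∀ y, ContinuousOn (ev y) (Icc 0 T) := fun y =>
    ContinuousOn.smul (by fun_prop) (hext y).continuousOn
  have hprim : ∀ y, IsPrimitive T (fun t => x₀ + ∫ s in (0 : ℝ)..t, f s (ev y s))
      (fun t => f t (ev y t)) := fun y =>
    ⟨(intervalIntegrable_iff_integrableOn_Icc_of_le hT).2 (hint _ (hev y)), fun t _ => by simp⟩
  let Ψ (y : C(Icc (0 : ℝ) T, E)) : C(Icc (0 : ℝ) T, E) :=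
    ⟨fun t => Real.exp (-(2 * Λ t)) • (x₀ + ∫ s in (0 : ℝ)..t, f s (ev y s)), by
      have hc : ContinuousOn (fun t : ℝ => Real.exp (-(2 * Λ t)) •
          (x₀ + ∫ s in (0 : ℝ)..t, f s (ev y s))) (Icc 0 T) :=
        ContinuousOn.smul (by fun_prop) ((hprim y).continuousOn hT)
      exact continuousOn_iff_continuous_domRestrict.1 hc⟩
  have hΨ : ContractingWith (1 / 2) Ψ := by
    refine ⟨by norm_num, LipschitzWith.of_dist_le_mul fun y z => ?_⟩
    have hnn : (0 : ℝ) ≤ ((1 / 2 : ℝ≥0) : ℝ) * dist y z := by positivity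
    rw [ContinuousMap.dist_le hnn]
    rintro ⟨t, ht⟩
    have h0 : (0 : ℝ) ∈ Icc 0 T := ⟨le_rfl, hT⟩
    have hb : ∀ s, ‖f s (ev y s) - f s (ev z s)‖
        ≤ (Real.exp (2 * Λ s) * 2 * ℓ s) * (1 / 2 * dist y z) := fun s => by
      refine (hl s _ _).trans ?_
      have h1 : ‖ev y s - ev z s‖ ≤ Real.exp (2 * Λ s) * dist y z := by
        simp only [ev, ext]
        rw [← smul_sub, norm_smul, Real.norm_of_nonneg (Real.exp_pos _).le, ← dist_eq_norm]
        exact mul_le_mul_of_nonneg_left (ContinuousMap.dist_apply_le_dist _) (Real.exp_pos _).le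
      refine (mul_le_mul_of_nonneg_left h1 (hℓ0 s)).trans (le_of_eq ?_)
      ring
    have hi : ‖∫ s in (0 : ℝ)..t, (f s (ev y s) - f s (ev z s))‖
        ≤ (Real.exp (2 * Λ t) - 1) * (1 / 2 * dist y z) := by
      have h1 := hexp.sub_eq h0 ht
      have h2 : Real.exp (2 * Λ 0) = 1 := by simp [hΛdef]
      rw [h2] at h1
      rw [h1, ← intervalIntegral.integral_mul_const]
      exact intervalIntegral.norm_integral_le_of_norm_le ht.1
        (Filter.Eventually.of_forall fun s _ => hb s)
        ((hexp.intervalIntegrable h0 ht).mul_const _)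
    have hsub : Ψ y ⟨t, ht⟩ - Ψ z ⟨t, ht⟩ = Real.exp (-(2 * Λ t)) •
        ∫ s in (0 : ℝ)..t, (f s (ev y s) - f s (ev z s)) := by
      show Real.exp (-(2 * Λ t)) • (x₀ + ∫ s in (0 : ℝ)..t, f s (ev y s))
        - Real.exp (-(2 * Λ t)) • (x₀ + ∫ s in (0 : ℝ)..t, f s (ev z s)) = _
      rw [← smul_sub, add_sub_add_left_eq_sub, intervalIntegral.integral_sub
        ((hprim y).intervalIntegrable h0 ht) ((hprim z).intervalIntegrable h0 ht)]
    rw [dist_eq_norm, hsub, norm_smul, Real.norm_of_nonneg (Real.exp_pos _).le]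
    refine (mul_le_mul_of_nonneg_left hi (Real.exp_pos _).le).trans ?_
    rw [← mul_assoc, mul_sub, ← Real.exp_add, neg_add_cancel, Real.exp_zero, mul_one]
    have hd : (0 : ℝ) ≤ 1 / 2 * dist y z := by positivity
    have := mul_le_mul_of_nonneg_right
      (sub_le_self (1 : ℝ) (Real.exp_pos (-(2 * Λ t))).le) hd
    simpa using this
  set y := ContractingWith.fixedPoint Ψ hΨ with hy
  have hfix : Ψ y = y := hΨ.fixedPoint_isFixedPt
  have hev_eq : ∀ t ∈ Icc 0 T, ev y t = x₀ + ∫ s in (0 : ℝ)..t, f s (ev y s) := fun t ht => by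
    have h1 : y ⟨t, ht⟩ = Real.exp (-(2 * Λ t)) • (x₀ + ∫ s in (0 : ℝ)..t, f s (ev y s)) := by
      conv_lhs => rw [← hfix]
      rfl
    show Real.exp (2 * Λ t) • y (projIcc 0 T hT t) = _
    rw [projIcc_of_mem hT ht, h1, smul_smul, ← Real.exp_add, add_neg_cancel, Real.exp_zero,
      one_smul]
  have h00 : ev y 0 = x₀ := by simpa using hev_eq 0 ⟨le_rfl, hT⟩
  exact ⟨ev y, h00, (hprim y).integrable, fun t ht => by rw [h00, hev_eq t ht]⟩

end Ode

/-! ### Classes of compactly supported functions -/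

lemma toKern_ae {k : E3 × E3 → ℂ} (hk : MemLp k 2 volume) :
    (toKern k : E3 × E3 → ℂ) =ᵐ[volume] k := by
  rw [toKern, dif_pos hk]
  exact hk.coeFn_toLp

lemma toKern_add {k l : E3 × E3 → ℂ} (hk : MemLp k 2 volume) (hl : MemLp l 2 volume) :
    toKern (fun z => k z + l z) = toKern k + toKern l := by
  refine Lp.ext ?_
  filter_upwards [toKern_ae hk, toKern_ae hl, Lp.coeFn_add (toKern k) (toKern l),
    toKern_ae (hk.add hl)] with z h1 h2 h3 h4
  rw [h3, Pi.add_apply, h1, h2]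
  exact h4

lemma toKern_const_mul {k : E3 × E3 → ℂ} (hk : MemLp k 2 volume) (c : ℂ) :
    toKern (fun z => c * k z) = c • toKern k := by
  refine Lp.ext ?_
  filter_upwards [toKern_ae hk, Lp.coeFn_smul c (toKern k), toKern_ae (hk.const_mul c)]
    with z h1 h2 h3
  rw [h2, Pi.smul_apply, h1]
  exact h3

lemma norm_toKern_le {F : E3 × E3 → ℂ} {S : Set (E3 × E3)} (hS : MeasurableSet S)
    (hv : volume S ≠ ⊤) {ε : ℝ}
    (hε : 0 ≤ ε) (hF : ∀ z, ‖F z‖ ≤ ε) (hs : ∀ z ∉ S, F z = 0) :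
    ‖toKern F‖ ≤ (volume S ^ (2 : ℝ≥0∞).toReal⁻¹).toReal * ε := by
  by_cases h : MemLp F 2 volume
  · rw [toKern, dif_pos h, Lp.norm_toLp]
    have hind : S.indicator F = F := indicator_eq_self.2 fun z hz => by
      by_contra hcon
      exact hz (hs z hcon)
    have h1 : eLpNorm F 2 volume = eLpNorm F 2 (volume.restrict S) := by
      rw [← eLpNorm_indicator_eq_eLpNorm_restrict hS, hind]
    have h2 := eLpNorm_le_of_ae_bound (p := 2) (μ := volume.restrict S) (f := F) (C := ε)
      (ae_of_all _ hF)
    rw [Measure.restrict_apply_univ] at h2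
    have h3 : volume S ^ (2 : ℝ≥0∞).toReal⁻¹ ≠ ⊤ :=
      ENNReal.rpow_ne_top_of_nonneg (by simp) hv
    rw [h1, ← ENNReal.toReal_ofReal hε, ← ENNReal.toReal_mul]
    exact ENNReal.toReal_mono (ENNReal.mul_ne_top h3 ENNReal.ofReal_ne_top) h2
  · rw [toKern, dif_neg h, norm_zero]
    positivity

/-- Smooth functions of compact support. -/
structure SmoothCc {V : Type*} [NormedAddCommGroup V] [NormedSpace ℝ V] (k : V → ℂ) : Prop where
  smooth : ContDiff ℝ ∞ k
  compact : HasCompactSupport k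

namespace SmoothCc

variable {V W : Type*} [NormedAddCommGroup V] [NormedSpace ℝ V]
  [NormedAddCommGroup W] [NormedSpace ℝ W] {k l : V → ℂ}

lemma add (hk : SmoothCc k) (hl : SmoothCc l) : SmoothCc (fun x => k x + l x) :=
  ⟨hk.smooth.add hl.smooth, hk.compact.add hl.compact⟩

lemma const_mul (hk : SmoothCc k) (c : ℂ) : SmoothCc (fun x => c * k x) :=
  ⟨contDiff_const.mul hk.smooth, hk.compact.mul_left⟩

lemma conj (hk : SmoothCc k) : SmoothCc (fun x => (starRingEnd ℂ) (k x)) :=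
  ⟨Complex.conjCLE.contDiff.comp hk.smooth, hk.compact.comp_left (g := starRingEnd ℂ) (map_zero _)⟩

lemma fderiv_apply (hk : SmoothCc k) (w : V) : SmoothCc (fun x => fderiv ℝ k x w) :=
  ⟨(hk.smooth.fderiv_right (m := ∞) le_rfl).clm_apply contDiff_const, hk.compact.fderiv_apply ℝ w⟩

lemma comp (hk : SmoothCc k) {j : W → V} (hj : ContDiff ℝ ∞ j) (hj' : Topology.IsClosedEmbedding j) :
    SmoothCc (fun x => k (j x)) :=
  ⟨hk.smooth.comp hj, hk.compact.comp_isClosedEmbedding hj'⟩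

lemma sum {ι : Type*} (s : Finset ι) {k : ι → V → ℂ} (hk : ∀ i ∈ s, SmoothCc (k i)) :
    SmoothCc (fun x => ∑ i ∈ s, k i x) := by
  classical
  induction s using Finset.induction_on with
  | empty =>
    simp only [Finset.sum_empty]
    exact ⟨contDiff_const, HasCompactSupport.zero⟩
  | insert i s hi ih =>
    simp only [Finset.sum_insert hi]
    exact (hk i (Finset.mem_insert_self _ _)).add
      (ih fun j hj => hk j (Finset.mem_insert_of_mem hj))

lemma memLp [MeasurableSpace V] [BorelSpace V] [SecondCountableTopology V]
    {μ : Measure V} [IsFiniteMeasureOnCompacts μ] (hk : SmoothCc k) : MemLp k 2 μ :=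
  hk.smooth.continuous.memLp_of_hasCompactSupport hk.compact

end SmoothCc

lemma isClosedEmbedding_prodMk_left {X Y : Type*} [TopologicalSpace X] [T1Space X]
    [TopologicalSpace Y] (x : X) : Topology.IsClosedEmbedding (fun y : Y => (x, y)) := by
  refine ⟨isEmbedding_prodMkRight x, ?_⟩
  have : range (fun y : Y => (x, y)) = Prod.fst ⁻¹' {x} := by
    ext ⟨a, b⟩
    simp [eq_comm]
  rw [this]
  exact isClosed_singleton.preimage continuous_fst

lemma isClosedEmbedding_prodMk_right {X Y : Type*} [TopologicalSpace X]
    [TopologicalSpace Y] [T1Space Y] (y : Y) : Topology.IsClosedEmbedding (fun x : X => (x, y)) := by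
  refine ⟨isEmbedding_prodMkLeft y, ?_⟩
  have : range (fun x : X => (x, y)) = Prod.snd ⁻¹' {y} := by
    ext ⟨a, b⟩
    simp [eq_comm]
  rw [this]
  exact isClosed_singleton.preimage continuous_snd

/-- The Laplacian of `k` in the directions of the image of `ι`. -/
def dirLap {V : Type*} [NormedAddCommGroup V] [NormedSpace ℝ V] (ι : E3 →L[ℝ] V) (k : V → ℂ)
    (p : V) : ℂ :=
  ∑ i : Fin 3, fderiv ℝ (fun q => fderiv ℝ k q (ι (EuclideanSpace.basisFun (Fin 3) ℝ i))) p
    (ι (EuclideanSpace.basisFun (Fin 3) ℝ i))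

lemma SmoothCc.dirLap {V : Type*} [NormedAddCommGroup V] [NormedSpace ℝ V] {k : V → ℂ}
    (hk : SmoothCc k) (ι : E3 →L[ℝ] V) : SmoothCc (dirLap ι k) :=
  SmoothCc.sum _ fun _ _ => (hk.fderiv_apply _).fderiv_apply _

lemma fderiv_comp_add_clm {V : Type*} [NormedAddCommGroup V] [NormedSpace ℝ V] {k : V → ℂ}
    (hk : Differentiable ℝ k) (ι : E3 →L[ℝ] V) (p : V) (x w : E3) :
    fderiv ℝ (fun x => k (p + ι x)) x w = fderiv ℝ k (p + ι x) (ι w) := by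
  have h := (hk (p + ι x)).hasFDerivAt.comp x ((ι.hasFDerivAt (x := x)).const_add p)
  exact congrArg (fun A : E3 →L[ℝ] ℂ => A w) h.fderiv

/-- Expresses the Laplacian of a slice as the value of one function on the whole space, which is
visibly smooth with compact support when k is. -/
lemma laplacian_comp_add_clm {V : Type*} [NormedAddCommGroup V] [NormedSpace ℝ V] {k : V → ℂ}
    (hk : ContDiff ℝ ∞ k) (ι : E3 →L[ℝ] V) (p : V) (x : E3) :
    Laplacian.laplacian (fun x => k (p + ι x)) x = dirLap ι k (p + ι x) := by
  have hd : Differentiable ℝ k := hk.differentiable (by simp)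
  have hcomp : ContDiff ℝ ∞ (fun x => k (p + ι x)) :=
    hk.comp (contDiff_const.add ι.contDiff)
  have hd2 : Differentiable ℝ (fderiv ℝ fun x => k (p + ι x)) :=
    (hcomp.fderiv_right (m := ∞) le_rfl).differentiable (by simp)
  have e := congrFun (InnerProductSpace.laplacian_eq_iteratedFDeriv_orthonormalBasis
    (fun x => k (p + ι x)) (EuclideanSpace.basisFun (Fin 3) ℝ)) x
  refine e.trans (Finset.sum_congr rfl fun i _ => ?_)
  rw [iteratedFDeriv_two_apply]
  have h1 : ∀ w : E3, (fderiv ℝ (fderiv ℝ fun x => k (p + ι x)) x w) w =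
      fderiv ℝ (fun y => fderiv ℝ (fun x => k (p + ι x)) y w) x w := fun w => by
    rw [fderiv_clm_apply (hd2 x) (differentiableAt_const _)]
    simp
  have h2 : ∀ w : E3, (fun y => fderiv ℝ (fun x => k (p + ι x)) y w) =
      fun y => (fun q => fderiv ℝ k q (ι w)) (p + ι y) := fun w => by
    funext y
    exact fderiv_comp_add_clm hd ι p y w
  have hd3 : ∀ w : V, Differentiable ℝ fun q => fderiv ℝ k q w := fun w =>
    ((hk.fderiv_right (m := ∞) le_rfl).clm_apply contDiff_const).differentiable (by simp)
  refine (h1 _).trans ?_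
  rw [h2, fderiv_comp_add_clm (hd3 _) ι p x]
  rfl

/-! ### Time slices of test functions -/

section Slice

variable {k : ℝ × E3 × E3 → ℂ}

lemma SmoothCc.slice (hk : SmoothCc k) (t : ℝ) : SmoothCc (fun z => k (t, z)) :=
  hk.comp (contDiff_const.prodMk contDiff_id) (isClosedEmbedding_prodMk_left t)

lemma SmoothCc.exists_support (hk : SmoothCc k) :
    ∃ S : Set (E3 × E3), IsCompact S ∧ ∀ t, ∀ z ∉ S, k (t, z) = 0 := by
  refine ⟨Prod.snd '' tsupport k, hk.compact.isCompact.image continuous_snd, fun t z hz => ?_⟩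
  by_contra hcon
  exact hz ⟨(t, z), subset_tsupport _ hcon, rfl⟩

lemma SmoothCc.uniform (hk : SmoothCc k) {ε : ℝ} (hε : 0 < ε) :
    ∃ δ > 0, ∀ s t : ℝ, |s - t| < δ → ∀ z, ‖k (s, z) - k (t, z)‖ ≤ ε := by
  have hu : UniformContinuous k :=
    hk.compact.uniformContinuous_of_continuous hk.smooth.continuous
  obtain ⟨δ, hδ, h⟩ := Metric.uniformContinuous_iff.1 hu ε hε
  refine ⟨δ, hδ, fun s t hst z => ?_⟩
  rw [← dist_eq_norm]
  refine (h ?_).le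
  rw [Prod.dist_eq, dist_self, Real.dist_eq]
  exact max_lt hst hδ

lemma SmoothCc.hasDerivAt (hk : SmoothCc k) (t : ℝ) (z : E3 × E3) :
    HasDerivAt (fun s => k (s, z)) (fderiv ℝ k (t, z) (1, 0)) t := by
  have h := ((hk.smooth.differentiable (by simp)) (t, z)).hasFDerivAt.comp_hasDerivAt t
    ((hasDerivAt_id t).prodMk (hasDerivAt_const t z))
  exact h

/-- Difference quotients converge uniformly and vanish outside a common compact set in space, hence
converge in L². -/
lemma SmoothCc.hasDerivAt_toKern (hk : SmoothCc k) (t : ℝ) :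
    HasDerivAt (fun s => toKern fun z => k (s, z))
      (toKern fun z => fderiv ℝ k (t, z) (1, 0)) t := by
  obtain ⟨S, hS, hS0⟩ := hk.exists_support
  have hk' := hk.fderiv_apply (1, 0)
  have hSv : volume S ≠ ⊤ := hS.measure_lt_top.ne
  set M := (volume S ^ (2 : ℝ≥0∞).toReal⁻¹).toReal with hM
  have hM0 : 0 ≤ M := ENNReal.toReal_nonneg
  rw [hasDerivAt_iff_isLittleO, Asymptotics.isLittleO_iff]
  intro c hc
  -- M is the factor converting a uniform bound into an L² bound on the support; M + 1 avoids
  -- dividing by zero.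
  obtain ⟨δ, hδ, hu⟩ := hk'.uniform (ε := c / (M + 1)) (by positivity)
  filter_upwards [Metric.ball_mem_nhds t hδ] with s hs
  rw [Metric.mem_ball, Real.dist_eq] at hs
  have e : (toKern fun z => k (s, z)) - (toKern fun z => k (t, z))
      - (s - t) • (toKern fun z => fderiv ℝ k (t, z) (1, 0)) =
      toKern fun z => k (s, z) + ((-1) * k (t, z)
        + (-(s - t : ℝ) : ℂ) * fderiv ℝ k (t, z) (1, 0)) := by
    rw [toKern_add (hk.slice s).memLp (((hk.slice t).const_mul _).add
      ((hk'.slice t).const_mul _)).memLp, toKern_add ((hk.slice t).const_mul _).memLp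
      ((hk'.slice t).const_mul _).memLp, toKern_const_mul (hk.slice t).memLp,
      toKern_const_mul (hk'.slice t).memLp, neg_smul, one_smul, neg_smul]
    rw [show ((s - t : ℝ) : ℂ) • (toKern fun z => fderiv ℝ k (t, z) (1, 0))
      = (s - t) • (toKern fun z => fderiv ℝ k (t, z) (1, 0)) from rfl]
    abel
  rw [e]
  refine (norm_toKern_le hS.measurableSet hSv (ε := c / (M + 1) * |s - t|) (by positivity)
    (fun z => ?_) (fun z hz => ?_)).trans ?_
  -- The mean value inequality for r ↦ k(r,z) - r ∂ₜk(t,z), whose derivative is small near t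
  -- uniformly in z.
  · have hconv := (convex_ball t δ).norm_image_sub_le_of_norm_hasDerivWithin_le
      (f := fun r : ℝ => k (r, z) - (r : ℂ) * fderiv ℝ k (t, z) (1, 0))
      (f' := fun r => fderiv ℝ k (r, z) (1, 0) - 1 * fderiv ℝ k (t, z) (1, 0)) (x := t) (y := s)
      (C := c / (M + 1)) (fun r _ => ?_) (fun r hr => ?_) (Metric.mem_ball_self hδ) ?_
    · rw [Real.norm_eq_abs] at hconv
      refine le_of_eq_of_le ?_ hconv
      congr 1
      push_cast
      ring
    · refine HasDerivAt.hasDerivWithinAt ((hk.hasDerivAt r z).sub (HasDerivAt.mul_const ?_ _))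
      exact Complex.ofRealCLM.hasDerivAt
    · rw [one_mul]
      rw [Metric.mem_ball, Real.dist_eq] at hr
      exact hu r t hr z
    · rwa [Metric.mem_ball, Real.dist_eq]
  · have h3 : fderiv ℝ k (t, z) (1, 0) = 0 := by
      have := hk.hasDerivAt t z
      have h0 : (fun s => k (s, z)) = fun _ => 0 := funext fun s => hS0 s z hz
      rw [h0] at this
      exact this.unique (hasDerivAt_const t 0)
    rw [hS0 s z hz, hS0 t z hz, h3]
    simp
  · rw [Real.norm_eq_abs, ← mul_assoc]
    refine mul_le_mul_of_nonneg_right ?_ (abs_nonneg _)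
    rw [← hM, mul_div_assoc', div_le_iff₀ (by positivity)]
    nlinarith

lemma SmoothCc.continuous_toKern (hk : SmoothCc k) : Continuous fun s => toKern fun z => k (s, z) :=
  continuous_iff_continuousAt.2 fun t => (hk.hasDerivAt_toKern t).continuousAt

end Slice

/-! ### The free evolution of kernels -/

/-- Rank one kernels as a real bilinear map. -/
def tensorL : H →L[ℝ] H →L[ℝ] Kern :=
  LinearMap.mkContinuous₂
    (LinearMap.mk₂ ℝ tensor
      (fun f f' g => kernelOp_injective (by
        ext1 h
        simp only [kernelOp_add, kernelOp_tensor, add_apply, smul_add]))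
      (fun c f g => kernelOp_injective (by
        ext1 h
        change _ = kernelOp ((c : ℂ) • tensor f g) h
        rw [kernelOp_smul, smul_apply, kernelOp_tensor, kernelOp_tensor]
        exact smul_comm _ _ _))
      (fun f g g' => kernelOp_injective (by
        ext1 h
        simp only [kernelOp_add, kernelOp_tensor, add_apply, inner_add_left, add_smul]))
      (fun c f g => kernelOp_injective (by
        ext1 h
        change kernelOp (tensor f ((c : ℂ) • g)) h = kernelOp ((c : ℂ) • tensor f g) h
        rw [kernelOp_smul, smul_apply, kernelOp_tensor, kernelOp_tensor, inner_smul_left,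
          Complex.conj_ofReal, mul_smul])))
    1 (fun f g => by
      have h : ‖tensor f g‖ ^ 2 = (‖f‖ * ‖g‖) ^ 2 := by
        have h1 := inner_tensor_tensor f g f g
        rw [inner_self_eq_norm_sq_to_K, inner_self_eq_norm_sq_to_K, inner_self_eq_norm_sq_to_K]
          at h1
        rw [mul_pow]
        exact_mod_cast h1
      rw [one_mul]
      exact ((pow_left_inj₀ (norm_nonneg _) (by positivity) two_ne_zero).1 h).le)

lemma tensorL_apply (f g : H) : tensorL f g = tensor f g := rfl

/-- The free evolution `K ↦ e^{-itΔ} K e^{-iσtΔ}` of kernels. -/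
def freeS (σ t : ℝ) : Kern →L[ℂ] Kern := (lmul (freeU t)).comp (rmul (freeU (σ * t)))

lemma freeS_apply (σ t : ℝ) (K : Kern) : freeS σ t K = lmul (freeU t) (rmul (freeU (σ * t)) K) := rfl

lemma kernelOp_freeS (σ t : ℝ) (K : Kern) :
    kernelOp (freeS σ t K) = freeU t * kernelOp K * freeU (σ * t) := by
  rw [freeS_apply, kernelOp_lmul, kernelOp_rmul, mul_assoc]

lemma freeS_zero (σ : ℝ) (K : Kern) : freeS σ 0 K = K :=
  kernelOp_injective (by rw [kernelOp_freeS, mul_zero, freeU_zero, one_mul, mul_one])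

lemma freeS_freeS_neg (σ t : ℝ) (K : Kern) : freeS σ t (freeS σ (-t) K) = K :=
  kernelOp_injective (by
    rw [kernelOp_freeS, kernelOp_freeS, mul_neg]
    calc _ = (freeU t * freeU (-t)) * kernelOp K * (freeU (-(σ * t)) * freeU (σ * t)) := by
          noncomm_ring
      _ = _ := by rw [freeU_mul_neg, freeU_neg_mul, one_mul, mul_one])

lemma freeS_neg_freeS (σ t : ℝ) (K : Kern) : freeS σ (-t) (freeS σ t K) = K := by
  simpa using freeS_freeS_neg σ (-t) K

lemma norm_freeS_apply_le (σ t : ℝ) (K : Kern) : ‖freeS σ t K‖ ≤ ‖K‖ := by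
  refine (norm_lmul_apply_le _ _).trans ?_
  refine (mul_le_of_le_one_left (norm_nonneg _) (norm_freeU_le t)).trans ?_
  refine (norm_rmul_apply_le _ _).trans ?_
  exact mul_le_of_le_one_left (norm_nonneg _) (norm_freeU_le _)

lemma norm_freeS_apply (σ t : ℝ) (K : Kern) : ‖freeS σ t K‖ = ‖K‖ := by
  refine le_antisymm (norm_freeS_apply_le σ t K) ?_
  conv_lhs => rw [← freeS_neg_freeS σ t K]
  exact norm_freeS_apply_le σ (-t) _

lemma inner_freeS_left (σ t : ℝ) (K L : Kern) :
    inner ℂ (freeS σ t K) L = inner ℂ K (freeS σ (-t) L) := by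
  have h1 : star (freeU (-(σ * t))) = freeU (σ * t) := by rw [star_freeU, neg_neg]
  rw [freeS_apply, freeS_apply, mul_neg, inner_lmul_right, inner_rmul_right, h1, star_freeU,
    neg_neg, lmul_rmul_comm]

lemma freeS_tensor (σ t : ℝ) (f g : H) :
    freeS σ t (tensor f g) = tensor (freeU t f) (freeU (-(σ * t)) g) := by
  refine kernelOp_injective ?_
  ext1 h
  rw [kernelOp_freeS, kernelOp_tensor]
  change freeU t (kernelOp (tensor f g) (freeU (σ * t) h)) = _
  rw [kernelOp_tensor, map_smul, ← star_freeU, ContinuousLinearMap.star_eq_adjoint,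
    ContinuousLinearMap.adjoint_inner_left]

/-- `freeU` is only strongly continuous, so this does not follow from continuity of `lmul` and
`rmul`. It holds on rank one kernels, and the isometry property extends it to the closure of their
span. -/
lemma continuous_freeS (σ : ℝ) (K : Kern) : Continuous fun t => freeS σ t K := by
  obtain ⟨w, b, -⟩ := exists_hilbertBasis ℂ H
  have hcl : ∀ K ∈ closure {K : Kern | Continuous fun t => freeS σ t K},
      Continuous fun t => freeS σ t K := by
    intro K hK
    refine continuous_of_uniform_approx_of_continuous fun u hu => ?_
    obtain ⟨ε, hε, hεu⟩ := Metric.mem_uniformity_dist.1 hu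
    obtain ⟨L, hL, hLK⟩ := Metric.mem_closure_iff.1 hK ε hε
    refine ⟨fun t => freeS σ t L, hL, fun t => hεu ?_⟩
    rw [dist_eq_norm, ← map_sub, norm_freeS_apply, ← dist_eq_norm]
    exact hLK
  refine hcl K ?_
  have hspan : (Submodule.span ℂ (range (tensorBasis b)) : Set Kern) ⊆
      {K : Kern | Continuous fun t => freeS σ t K} := by
    intro K hK
    refine Submodule.span_induction (p := fun K _ => Continuous fun t => freeS σ t K) ?_ ?_ ?_ ?_ hK
    · rintro _ ⟨p, rfl⟩
      simp only [tensorBasis_apply, freeS_tensor]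
      exact (tensorL.continuous.comp (continuous_freeU _)).clm_apply
        ((continuous_freeU _).comp (by fun_prop))
    · simp only [map_zero]
      exact continuous_const
    · intro x y _ _ hx hy
      simp only [map_add]
      exact hx.add hy
    · intro c x _ hx
      simp only [map_smul]
      exact hx.const_smul c
  refine closure_mono hspan ?_
  have := (tensorBasis b).dense_span
  rw [← Submodule.topologicalClosure_coe, this]
  exact Submodule.mem_top

lemma continuousOn_freeS_apply (σ : ℝ) {s : Set ℝ} {a : ℝ → Kern} (ha : ContinuousOn a s) :
    ContinuousOn (fun t => freeS σ t (a t)) s := by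
  intro t ht
  rw [ContinuousWithinAt, tendsto_iff_norm_sub_tendsto_zero]
  have h1 : Filter.Tendsto (fun r => ‖a r - a t‖ + ‖freeS σ r (a t) - freeS σ t (a t)‖)
      (nhdsWithin t s) (nhds (0 + 0)) :=
    (tendsto_iff_norm_sub_tendsto_zero.1 (ha t ht)).add
      (tendsto_iff_norm_sub_tendsto_zero.1 (((continuous_freeS σ (a t)).tendsto t).mono_left
        nhdsWithin_le_nhds))
  rw [add_zero] at h1
  refine squeeze_zero (fun _ => norm_nonneg _) (fun r => ?_) h1
  calc ‖freeS σ r (a r) - freeS σ t (a t)‖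
      = ‖freeS σ r (a r - a t) + (freeS σ r (a t) - freeS σ t (a t))‖ := by
        rw [map_sub]; congr 1; abel
    _ ≤ _ := (norm_add_le _ _).trans (add_le_add (norm_freeS_apply_le _ _ _) le_rfl)

lemma aestronglyMeasurable_freeS {μ : Measure ℝ} {a : ℝ → Kern} (σ c : ℝ)
    (ha : AEStronglyMeasurable a μ) :
    AEStronglyMeasurable (fun t => freeS σ (c * t) (a t)) μ := by
  refine aestronglyMeasurable_comp_of_lipschitz (f := fun t K => freeS σ (c * t) K)
    (ℓ := fun _ => 1) (fun K => ?_) (fun t K L => ?_) ha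
  · exact ((continuous_freeS σ K).comp (by fun_prop)).aestronglyMeasurable
  · rw [← map_sub, one_mul]
    exact norm_freeS_apply_le _ _ _

/-! ### Laplacians of test functions and the free evolution -/

lemma inner_tensor_toKern {k : E3 × E3 → ℂ} (hk : MemLp k 2 volume) (a f : H) :
    inner ℂ (tensor a f) (toKern k) = ∫ y, f y * ∫ x, (starRingEnd ℂ) (a x) * k (x, y) := by
  have h0 : (fun z : E3 × E3 => inner ℂ (tensor a f z) (toKern k z)) =ᵐ[volume]
      fun z => f z.2 * ((starRingEnd ℂ) (a z.1) * k z) := by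
    filter_upwards [tensor_ae a f, toKern_ae hk] with z h1 h2
    rw [h1, h2]
    simp only [RCLike.inner_apply, map_mul, RCLike.conj_conj]
    ring
  have hint := (integrable_congr h0).1 (L2.integrable_inner (𝕜 := ℂ) (tensor a f) (toKern k))
  rw [L2.inner_def, integral_congr_ae h0]
  refine (integral_prod_symm _ hint).trans ?_
  refine integral_congr_ae (ae_of_all _ fun y => ?_)
  simp only
  rw [integral_const_mul]

/-- For each fixed y the slice k(·, y) is a Schwartz function, so `inner_freeU_laplacian` applies
inside the y-integral. -/
lemma inner_tensor_laplacian_left {k l : E3 × E3 → ℂ} (hk : SmoothCc k) (hl : SmoothCc l)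
    (hkl : ∀ x y, Laplacian.laplacian (fun x => k (x, y)) x = l (x, y))
    (θ : 𝓢(E3, ℂ)) (t : ℝ) (f : H) :
    inner ℂ (tensor (freeU t (schw (Δ θ))) f) (toKern k) =
      inner ℂ (tensor (freeU t (schw θ)) f) (toKern l) := by
  rw [inner_tensor_toKern hk.memLp, inner_tensor_toKern hl.memLp]
  refine integral_congr_ae (ae_of_all _ fun y => ?_)
  have hky : SmoothCc (fun x => k (x, y)) :=
    hk.comp (contDiff_id.prodMk contDiff_const) (isClosedEmbedding_prodMk_right y)
  have h := inner_freeU_laplacian θ (hky.compact.toSchwartzMap hky.smooth) t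
  have key : ∀ (a : H) (η : 𝓢(E3, ℂ)), inner ℂ a (schw η) = ∫ x, (starRingEnd ℂ) (a x) * η x := by
    intro a η
    rw [L2.inner_def]
    refine integral_congr_ae ?_
    filter_upwards [schw_ae η] with x hx
    rw [hx, RCLike.inner_apply, mul_comm]
  rw [key, key] at h
  simp only
  congr 1
  refine h.trans (integral_congr_ae (ae_of_all _ fun x => ?_))
  simp only
  congr 1
  rw [SchwartzMap.laplacian_apply]
  exact hkl x y

lemma adjK_tensor (f g : H) : adjK (tensor f g) = tensor g f := by
  refine Lp.ext ?_
  filter_upwards [adjK_ae (tensor f g), ae_swap (tensor_ae f g), tensor_ae g f] with z h1 h2 h3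
  rw [h1, h2, h3]
  simp [mul_comm]

lemma SmoothCc.conj_swap {k : E3 × E3 → ℂ} (hk : SmoothCc k) :
    SmoothCc (fun z : E3 × E3 => (starRingEnd ℂ) (k z.swap)) :=
  SmoothCc.conj (k := fun z : E3 × E3 => k z.swap)
    (hk.comp (contDiff_snd.prodMk contDiff_fst) (Homeomorph.prodComm E3 E3).isClosedEmbedding)

lemma adjK_toKern {k : E3 × E3 → ℂ} (hk : SmoothCc k) :
    adjK (toKern k) = toKern fun z => (starRingEnd ℂ) (k z.swap) := by
  refine Lp.ext ?_
  filter_upwards [adjK_ae (toKern k), ae_swap (toKern_ae hk.memLp), toKern_ae hk.conj_swap.memLp]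
    with z h1 h2 h3
  rw [h1, h2, h3]

lemma inner_tensor_laplacian_right {k l : E3 × E3 → ℂ} (hk : SmoothCc k) (hl : SmoothCc l)
    (hkl : ∀ x y, Laplacian.laplacian (fun y => k (x, y)) y = l (x, y))
    (θ : 𝓢(E3, ℂ)) (t : ℝ) (f : H) :
    inner ℂ (tensor f (freeU t (schw (Δ θ)))) (toKern k) =
      inner ℂ (tensor f (freeU t (schw θ))) (toKern l) := by
  have h := inner_tensor_laplacian_left hk.conj_swap hl.conj_swap (fun x y => ?_) θ t f
  · rw [← adjK_toKern hk, ← adjK_toKern hl, ← adjK_tensor f, ← adjK_tensor f, inner_adjK,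
      inner_adjK, ← inner_conj_symm, ← inner_conj_symm (toKern l)] at h
    exact (starRingEnd ℂ).injective h
  · have h1 := congrFun (InnerProductSpace.laplacian_CLE_comp_left (f := fun x => k (y, x))
      (l := Complex.conjCLE)) x
    refine h1.trans ?_
    simp only [Function.comp, hkl]
    rfl

/-! ### The Schrödinger equation in the sense of distributions -/

lemma tensor_smul_left (c : ℂ) (f g : H) : tensor (c • f) g = c • tensor f g :=
  kernelOp_injective (by
    ext1 h
    rw [kernelOp_smul, smul_apply, kernelOp_tensor, kernelOp_tensor, smul_comm])

lemma tensor_smul_right (c : ℂ) (f g : H) : tensor f (c • g) = (starRingEnd ℂ) c • tensor f g :=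
  kernelOp_injective (by
    ext1 h
    rw [kernelOp_smul, smul_apply, kernelOp_tensor, kernelOp_tensor, inner_smul_left, mul_smul])

lemma kern_ext_schwartz {K L : Kern} (h : ∀ θ ζ : 𝓢(E3, ℂ),
    inner ℂ (tensor (schw θ) (schw ζ)) K = inner ℂ (tensor (schw θ) (schw ζ)) L) : K = L := by
  refine kernelOp_injective (ext_schwartz fun ζ => ext_inner_left ℂ fun f => ?_)
  refine schwartz_induction
    (p := fun f => inner ℂ f (kernelOp K (schw ζ)) = inner ℂ f (kernelOp L (schw ζ)))
    (isClosed_eq (by fun_prop) (by fun_prop)) (fun θ => ?_) f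
  rw [← inner_tensor, ← inner_tensor, h]

/-- The inclusion of the first space variable. -/
def inclX : E3 →L[ℝ] ℝ × E3 × E3 :=
  (ContinuousLinearMap.inr ℝ ℝ (E3 × E3)).comp (ContinuousLinearMap.inl ℝ E3 E3)

/-- The inclusion of the second space variable. -/
def inclY : E3 →L[ℝ] ℝ × E3 × E3 :=
  (ContinuousLinearMap.inr ℝ ℝ (E3 × E3)).comp (ContinuousLinearMap.inr ℝ E3 E3)

section Test

variable {k : ℝ × E3 × E3 → ℂ}

lemma SmoothCc.laplacian_fst (hk : SmoothCc k) (t : ℝ) (x y : E3) :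
    Laplacian.laplacian (fun x => k (t, x, y)) x = PairExcitation.dirLap inclX k (t, x, y) := by
  have e : ∀ x, ((t, 0, y) : ℝ × E3 × E3) + inclX x = (t, x, y) := fun x => by simp [inclX]
  have h := laplacian_comp_add_clm hk.smooth inclX (t, 0, y) x
  simp only [e] at h
  exact h

lemma SmoothCc.laplacian_snd (hk : SmoothCc k) (t : ℝ) (x y : E3) :
    Laplacian.laplacian (fun y => k (t, x, y)) y = PairExcitation.dirLap inclY k (t, x, y) := by
  have e : ∀ y, ((t, x, 0) : ℝ × E3 × E3) + inclY y = (t, x, y) := fun x => by simp [inclY]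
  have h := laplacian_comp_add_clm hk.smooth inclY (t, x, 0) y
  simp only [e] at h
  exact h

/-- The function `∂ₜ k + i (Δ_x + σ Δ_y) k`. -/
def evol (σ : ℝ) (k : ℝ × E3 × E3 → ℂ) (p : ℝ × E3 × E3) : ℂ :=
  fderiv ℝ k p (1, 0)
    + (Complex.I * dirLap inclX k p + ((σ : ℂ) * Complex.I) * dirLap inclY k p)

lemma SmoothCc.evol (hk : SmoothCc k) (σ : ℝ) : SmoothCc (evol σ k) :=
  (hk.fderiv_apply _).add (((hk.dirLap inclX).const_mul _).add ((hk.dirLap inclY).const_mul _))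

/-- Product rule; the Laplacians produced by the two free evolutions of θ and ζ are moved onto k,
where they combine with ∂ₜk into `evol`. -/
lemma SmoothCc.hasDerivAt_inner (hk : SmoothCc k) (σ t : ℝ) (θ ζ : 𝓢(E3, ℂ)) :
    HasDerivAt (fun t => inner ℂ (freeS σ t (tensor (schw θ) (schw ζ))) (toKern fun z => k (t, z)))
      (inner ℂ (freeS σ t (tensor (schw θ) (schw ζ))) (toKern fun z => PairExcitation.evol σ k (t, z)))
      t := by
  have hlin : HasDerivAt (fun t : ℝ => -(σ * t)) (-σ) t := by
    exact (((hasDerivAt_id' t).const_mul σ).neg).congr_deriv (by simp)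
  have h1 : HasDerivAt (fun t => tensorL (freeU t (schw θ)) (freeU (-(σ * t)) (schw ζ)))
      (tensorL (freeU t (schw θ))
          ((-σ) • ((-Complex.I) • freeU (-(σ * t)) (schw (Δ ζ))))
        + tensorL ((-Complex.I) • freeU t (schw (Δ θ))) (freeU (-(σ * t)) (schw ζ))) t :=
    ContinuousLinearMap.hasDerivAt_of_bilinear (fun _ => hasDerivAt_freeU θ t)
      (fun _ => HasDerivAt.scomp (g₁ := fun s => freeU s (schw ζ)) t
        (hasDerivAt_freeU ζ (-(σ * t))) hlin)
  have h2 := h1.inner ℂ (hk.hasDerivAt_toKern t)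
  simp only [tensorL_apply] at h2
  simp only [freeS_tensor]
  refine h2.congr_deriv ?_
  have hs := hk.slice t
  have hx := (hk.dirLap inclX).slice t
  have hy := (hk.dirLap inclY).slice t
  have ht := (hk.fderiv_apply (1, 0)).slice t
  have e : (toKern fun z => PairExcitation.evol σ k (t, z)) =
      (toKern fun z => fderiv ℝ k (t, z) (1, 0))
        + (Complex.I • (toKern fun z => PairExcitation.dirLap inclX k (t, z))
        + ((σ : ℂ) * Complex.I) • (toKern fun z => PairExcitation.dirLap inclY k (t, z))) := by
    rw [← toKern_const_mul hx.memLp, ← toKern_const_mul hy.memLp,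
      ← toKern_add (hx.const_mul _).memLp (hy.const_mul _).memLp,
      ← toKern_add ht.memLp ((hx.const_mul _).add (hy.const_mul _)).memLp]
    rfl
  have e2 : (-σ) • ((-Complex.I) • freeU (-(σ * t)) (schw (Δ ζ)))
      = ((σ : ℂ) * Complex.I) • freeU (-(σ * t)) (schw (Δ ζ)) := by
    rw [neg_smul, neg_smul, smul_neg, neg_neg, mul_smul]
    rfl
  have hX := inner_tensor_laplacian_left hs hx (fun x y => hk.laplacian_fst t x y) θ t
    (freeU (-(σ * t)) (schw ζ))
  have hY := inner_tensor_laplacian_right hs hy (fun x y => hk.laplacian_snd t x y) ζ (-(σ * t))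
    (freeU t (schw θ))
  rw [e, e2, tensor_smul_right, tensor_smul_left, inner_add_left, inner_smul_left, inner_smul_left,
    hX, hY, inner_add_right, inner_add_right, inner_smul_right, inner_smul_right]
  simp
  ring

/-- The test function in the interaction picture. Only its pairings with Schwartz tensors are
differentiated; since those determine a kernel, the integral identity holds in L². -/
lemma SmoothCc.isPrimitive_freeS (hk : SmoothCc k) (σ : ℝ) (T : ℝ) :
    IsPrimitive T (fun t => freeS σ (-t) (toKern fun z => k (t, z)))
      (fun t => freeS σ (-t) (toKern fun z => PairExcitation.evol σ k (t, z))) := by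
  have hc : Continuous fun t => freeS σ (-t) (toKern fun z => PairExcitation.evol σ k (t, z)) := by
    have h1 := continuousOn_freeS_apply σ (s := univ)
      (((hk.evol σ).continuous_toKern.comp continuous_neg).continuousOn)
    have h2 := (continuousOn_univ.1 h1).comp continuous_neg
    simpa [Function.comp_def] using h2
  refine ⟨hc.intervalIntegrable _ _, fun t _ => kern_ext_schwartz fun θ ζ => ?_⟩
  have hd : ∀ s ∈ uIcc 0 t, HasDerivAt
      (fun t => inner ℂ (tensor (schw θ) (schw ζ)) (freeS σ (-t) (toKern fun z => k (t, z))))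
      (inner ℂ (tensor (schw θ) (schw ζ))
        (freeS σ (-s) (toKern fun z => PairExcitation.evol σ k (s, z)))) s := fun s _ => by
    have := hk.hasDerivAt_inner σ s θ ζ
    simpa only [inner_freeS_left] using this
  have hci : Continuous fun s => inner ℂ (tensor (schw θ) (schw ζ))
      (freeS σ (-s) (toKern fun z => PairExcitation.evol σ k (s, z))) := continuous_const.inner hc
  have h := intervalIntegral.integral_eq_sub_of_hasDerivAt hd (hci.intervalIntegrable _ _)
  have h3 := ContinuousLinearMap.intervalIntegral_comp_comm
    ((innerSL ℂ (tensor (schw θ) (schw ζ))).restrictScalars ℝ)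
    (hc.intervalIntegrable (μ := volume) 0 t)
  simp only [ContinuousLinearMap.coe_restrictScalars', innerSL_apply_apply] at h3
  rw [inner_add_right, ← h3, h]
  ring

end Test

lemma inner_toKern {k : E3 × E3 → ℂ} (hk : MemLp k 2 volume) (K : Kern) :
    inner ℂ (toKern k) K = ∫ z, K z * (starRingEnd ℂ) (k z) := by
  rw [L2.inner_def]
  refine integral_congr_ae ?_
  filter_upwards [toKern_ae hk] with z hz
  rw [hz, RCLike.inner_apply]

/-- The inner product conjugates its first argument, so the test function enters as its conjugate;
this recovers the formal transpose of the Schrödinger operator applied to ψ itself. -/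
lemma SmoothCc.conj_evol_conj {ψ : ℝ × E3 × E3 → ℂ} (hψ : SmoothCc ψ) (σ t : ℝ) (z : E3 × E3) :
    -Complex.I * (starRingEnd ℂ) (PairExcitation.evol σ (fun p => (starRingEnd ℂ) (ψ p)) (t, z)) =
      -(Complex.I * deriv (fun s : ℝ => ψ (s, z.1, z.2)) t)
        - Laplacian.laplacian (fun x : E3 => ψ (t, x, z.2)) z.1
        - (σ : ℂ) * Laplacian.laplacian (fun y : E3 => ψ (t, z.1, y)) z.2 := by
  have hk := hψ.conj
  have h1 : fderiv ℝ (fun p => (starRingEnd ℂ) (ψ p)) (t, z) (1, 0) =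
      (starRingEnd ℂ) (deriv (fun s : ℝ => ψ (s, z.1, z.2)) t) := by
    have hd := hψ.hasDerivAt t z
    have hd2 := (Complex.conjCLE.toContinuousLinearMap.hasFDerivAt.comp_hasDerivAt t hd)
    rw [show deriv (fun s : ℝ => ψ (s, z.1, z.2)) t = _ from hd.deriv]
    exact (hk.hasDerivAt t z).unique hd2
  have h2 := hk.laplacian_fst t z.1 z.2
  have h3 := hk.laplacian_snd t z.1 z.2
  have h2' := congrFun (InnerProductSpace.laplacian_CLE_comp_left (f := fun x => ψ (t, x, z.2))
    (l := Complex.conjCLE)) z.1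
  have h3' := congrFun (InnerProductSpace.laplacian_CLE_comp_left (f := fun y => ψ (t, z.1, y))
    (l := Complex.conjCLE)) z.2
  have h2'' := h2.symm.trans h2'
  have h3'' := h3.symm.trans h3'
  rw [Prod.mk.eta] at h2'' h3''
  rw [PairExcitation.evol, h1, h2'', h3'']
  simp only [Function.comp, Complex.conjCLE_apply, map_add, map_mul, Complex.conj_conj,
    Complex.conj_I, Complex.conj_ofReal]
  linear_combination (Laplacian.laplacian (fun x : E3 => ψ (t, x, z.2)) z.1
    + (σ : ℂ) * Laplacian.laplacian (fun y : E3 => ψ (t, z.1, y)) z.2) * Complex.I_sq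

/-- The complex inner product as a real bilinear map. -/
def innerBilin : Kern →L[ℝ] Kern →L[ℝ] ℂ :=
  LinearMap.mkContinuous₂
    (LinearMap.mk₂ ℝ (fun K L => inner ℂ K L) (fun K K' L => inner_add_left K K' L)
      (fun c K L => by
        rw [show c • K = (c : ℂ) • K from rfl, inner_smul_left, Complex.conj_ofReal]; rfl)
      (fun K L L' => inner_add_right K L L')
      (fun c K L => by rw [show c • L = (c : ℂ) • L from rfl, inner_smul_right]; rfl))
    1 (fun K L => by rw [one_mul]; exact norm_inner_le_norm K L)

lemma innerBilin_apply (K L : Kern) : innerBilin K L = inner ℂ K L := rfl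

/-- The free evolution of a primitive of `g` solves the Schrödinger equation with right-hand side
the free evolution of `i g`. -/
theorem IsPrimitive.schrodingerEq {T : ℝ} (hT : 0 ≤ T) {a g : ℝ → Kern} (H : IsPrimitive T a g)
    (σ : ℝ) :
    SchrodingerEq σ T (fun t => freeS σ t (a t)) (fun t => Complex.I • freeS σ t (g t)) := by
  have hgi : IntegrableOn g (Icc 0 T) :=
    (intervalIntegrable_iff_integrableOn_Icc_of_le hT).1 H.integrable
  refine ⟨?_, ?_, ?_⟩
  · exact (continuousOn_freeS_apply σ (H.continuousOn hT)).integrableOn_Icc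
  · refine Integrable.mono' hgi.norm ?_ (ae_of_all _ fun t => ?_)
    · have := aestronglyMeasurable_freeS σ 1 hgi.aestronglyMeasurable
      simp only [one_mul] at this
      exact this.const_smul Complex.I
    · rw [norm_smul, Complex.norm_I, one_mul]
      exact norm_freeS_apply_le _ _ _
  · intro ψ hψ
    set χ : ℝ × E3 × E3 → ℂ := fun p => (starRingEnd ℂ) (ψ p) with hχ
    have hψc : SmoothCc ψ := ⟨hψ.smooth, hψ.compact⟩
    have hk : SmoothCc χ := hψc.conj
    have hb := hk.isPrimitive_freeS σ T
    have hbil := hb.bilin H hT innerBilin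
    -- No boundary terms: integrating the product rule for ⟨S(-t)χ, a⟩ over [0, T] gives zero, and
    -- unitarity moves the free evolution onto a and g.
    have hbdry : ∀ t, t ∉ Ioo 0 T → (toKern fun z => χ (t, z)) = 0 := by
      intro t ht
      have h0 : (fun z => χ (t, z)) = fun _ => 0 * (0 : ℂ) := by
        funext z
        have : ψ (t, z) = 0 := by
          by_contra hcon
          exact ht (hψ.support (subset_tsupport _ hcon)).1
        simp [hχ, this]
      rw [h0, toKern_const_mul (k := fun _ => 0) MemLp.zero', zero_smul]
    have heq := hbil.eq_add T ⟨hT, le_rfl⟩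
    simp only [hbdry T (by simp), hbdry 0 (by simp), map_zero, innerBilin_apply, zero_add,
      zero_apply] at heq
    have hb1 : ∀ t, inner ℂ (freeS σ (-t) (toKern fun z => χ (t, z))) (g t)
        = inner ℂ (toKern fun z => χ (t, z)) (freeS σ t (g t)) := fun t => by
      rw [inner_freeS_left, neg_neg]
    have hb2 : ∀ t, inner ℂ (freeS σ (-t) (toKern fun z => evol σ χ (t, z))) (a t)
        = inner ℂ (toKern fun z => evol σ χ (t, z)) (freeS σ t (a t)) := fun t => by
      rw [inner_freeS_left, neg_neg]
    have hbi := hbil.integrable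
    simp only [innerBilin_apply, hb1, hb2] at heq hbi
    have hi2 : IntervalIntegrable (fun t => inner ℂ (toKern fun z => evol σ χ (t, z))
        (freeS σ t (a t))) volume 0 T := by
      rw [intervalIntegrable_iff_integrableOn_Icc_of_le hT]
      exact ((hk.evol σ).continuous_toKern.continuousOn.inner
        (continuousOn_freeS_apply σ (H.continuousOn hT))).integrableOn_Icc
    have hi1 : IntervalIntegrable (fun t => inner ℂ (toKern fun z => χ (t, z))
        (freeS σ t (g t))) volume 0 T := by
      simpa using hbi.sub hi2
    rw [intervalIntegral.integral_add hi1 hi2] at heq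
    have hL : ∀ t, (∫ z : E3 × E3, (freeS σ t (a t)) z *
        (-(Complex.I * deriv (fun s : ℝ => ψ (s, z.1, z.2)) t)
          - Laplacian.laplacian (fun x : E3 => ψ (t, x, z.2)) z.1
          - (σ : ℂ) * Laplacian.laplacian (fun y : E3 => ψ (t, z.1, y)) z.2)) =
        -Complex.I * inner ℂ (toKern fun z => evol σ χ (t, z)) (freeS σ t (a t)) := fun t => by
      rw [inner_toKern ((hk.evol σ).slice t).memLp, ← integral_const_mul]
      refine integral_congr_ae (ae_of_all _ fun z => ?_)
      simp only
      rw [← hψc.conj_evol_conj σ t z]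
      ring
    have hR : ∀ t, (∫ z : E3 × E3, (Complex.I • freeS σ t (g t) : Kern) z * ψ (t, z.1, z.2)) =
        Complex.I * inner ℂ (toKern fun z => χ (t, z)) (freeS σ t (g t)) := fun t => by
      rw [inner_toKern (hk.slice t).memLp, ← integral_const_mul]
      refine integral_congr_ae ?_
      filter_upwards [Lp.coeFn_smul Complex.I (freeS σ t (g t))] with z hz
      rw [hz, Pi.smul_apply, smul_eq_mul, hχ]
      simp only [Complex.conj_conj]
      ring
    simp only [hL, hR]
    rw [integral_Icc_eq_integral_Ioc, integral_Icc_eq_integral_Ioc,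
      ← intervalIntegral.integral_of_le hT, ← intervalIntegral.integral_of_le hT,
      intervalIntegral.integral_const_mul, intervalIntegral.integral_const_mul]
    linear_combination Complex.I * heq

/-! ### Measurability of families of kernels -/

/-- Balls generate the Borel sets of a second countable space. For L²-valued maps this reduces
measurability to measurability of parametric integrals. -/
lemma measurable_of_measurable_dist {α X : Type*} [MeasurableSpace α] [PseudoMetricSpace X]
    [SecondCountableTopology X] [MeasurableSpace X] [BorelSpace X] {f : α → X}
    (hf : ∀ c, Measurable fun a => dist (f a) c) : Measurable f := by
  have hb : TopologicalSpace.IsTopologicalBasis {s : Set X | ∃ c r, s = Metric.ball c r} := by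
    refine TopologicalSpace.isTopologicalBasis_of_isOpen_of_nhds ?_ ?_
    · rintro _ ⟨c, r, rfl⟩
      exact Metric.isOpen_ball
    · intro a u ha hu
      obtain ⟨r, hr, hru⟩ := Metric.isOpen_iff.1 hu a ha
      exact ⟨_, ⟨a, r, rfl⟩, Metric.mem_ball_self hr, hru⟩
  have hg := hb.borel_eq_generateFrom
  rw [← BorelSpace.measurable_eq (α := X)] at hg
  rw [hg]
  refine measurable_generateFrom ?_
  rintro _ ⟨c, r, rfl⟩
  exact measurableSet_lt (hf c) measurable_const

instance secondCountableTopology_kern : SecondCountableTopology Kern :=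
  haveI : MeasureTheory.IsSeparable (volume : Measure (E3 × E3)) :=
    isSeparable_of_sigmaFinite _
  inferInstance

lemma measurable_eLpNorm_two {G : ℝ → E3 × E3 → ℂ} (hG : Measurable (Function.uncurry G)) :
    Measurable fun t => eLpNorm (G t) 2 volume := by
  have h1 : Measurable fun t => ∫⁻ z, ‖G t z‖ₑ ^ 2 :=
    Measurable.lintegral_prod_right' (f := fun p : ℝ × E3 × E3 => ‖G p.1 p.2‖ₑ ^ 2)
      (hG.enorm.pow_const 2)
  have h2 : (fun t => eLpNorm (G t) 2 volume) = fun t => (∫⁻ z, ‖G t z‖ₑ ^ 2) ^ (2⁻¹ : ℝ) := by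
    funext t
    rw [← sq_eLpNorm_two, ← ENNReal.rpow_natCast, ← ENNReal.rpow_mul]
    norm_num
  rw [h2]
  exact h1.pow_const _

lemma stronglyMeasurable_toKern {F : ℝ → E3 × E3 → ℂ} (hF : Measurable (Function.uncurry F)) :
    StronglyMeasurable fun t => toKern (F t) := by
  borelize Kern
  refine Measurable.stronglyMeasurable (measurable_of_measurable_dist fun L => ?_)
  have hFt : ∀ t, Measurable (F t) := fun t => hF.comp measurable_prodMk_left
  have hLm : Measurable (L : E3 × E3 → ℂ) := (Lp.stronglyMeasurable L).measurable
  have hS : MeasurableSet {t | MemLp (F t) 2 volume} := by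
    have : {t | MemLp (F t) 2 volume} = {t | eLpNorm (F t) 2 volume < ⊤} := by
      ext t
      exact ⟨fun h => h.2, fun h => ⟨(hFt t).aestronglyMeasurable, h⟩⟩
    rw [this]
    exact measurableSet_lt (measurable_eLpNorm_two hF) measurable_const
  classical
  have e : (fun t => dist (toKern (F t)) L) = fun t => if t ∈ {t | MemLp (F t) 2 volume} then
      (eLpNorm (fun z => F t z - L z) 2 volume).toReal else dist 0 L := by
    funext t
    split_ifs with h
    · have h : MemLp (F t) 2 volume := h
      rw [toKern, dif_pos h, Lp.dist_def]
      congr 1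
      refine eLpNorm_congr_ae ?_
      filter_upwards [h.coeFn_toLp] with z hz
      rw [Pi.sub_apply, hz]
    · have h : ¬MemLp (F t) 2 volume := h
      rw [toKern, dif_neg h]
  rw [e]
  refine Measurable.ite hS ?_ measurable_const
  exact (measurable_eLpNorm_two (G := fun t z => F t z - L z) (hF.sub (hLm.comp measurable_snd))).ennreal_toReal

lemma toKern_congr {k l : E3 × E3 → ℂ} (h : k =ᵐ[volume] l) : toKern k = toKern l := by
  by_cases hk : MemLp k 2 volume
  · have hl := (memLp_congr_ae h).1 hk
    rw [toKern, toKern, dif_pos hk, dif_pos hl]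
    exact MemLp.toLp_congr hk hl h
  · have hl := fun hl => hk ((memLp_congr_ae h).2 hl)
    rw [toKern, toKern, dif_neg hk, dif_neg hl]

lemma enorm_toKern_le (k : E3 × E3 → ℂ) : ‖toKern k‖ₑ ≤ eLpNorm k 2 volume := by
  by_cases hk : MemLp k 2 volume
  · rw [toKern, dif_pos hk, Lp.enorm_toLp]
  · rw [toKern, dif_neg hk]
    simp

/-! ### The coefficients -/

/-- A measurable even potential in `L²` and a measurable condensate. -/
structure Coefficients (v : E3 → ℝ) (φ : ℝ → E3 → ℂ) : Prop where
  measurable_v : Measurable v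
  even : ∀ x, v (-x) = v x
  memLp : MemLp v 2 volume
  measurable_φ : Measurable (Function.uncurry φ)

section Coefficients

variable {v : E3 → ℝ} {φ : ℝ → E3 → ℂ}

/-- The exchange kernel `v(x - y) φ(t, x) φ̄(t, y)` in `L²(ℝ⁶)`. -/
def wKern (v : E3 → ℝ) (φ : ℝ → E3 → ℂ) (t : ℝ) : Kern := toKern fun z => wFun v φ t z.1 z.2

/-- The kernel `m` in `L²(ℝ⁶)`. -/
def mKern (v : E3 → ℝ) (φ : ℝ → E3 → ℂ) (t : ℝ) : Kern := toKern (mFun v φ t)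

lemma enorm_wFun (t : ℝ) (z : E3 × E3) : ‖wFun v φ t z.1 z.2‖ₑ = ‖mFun v φ t z‖ₑ := by
  rw [wFun, mFun, enorm_neg]
  simp only [enorm_mul, Complex.star_def, RCLike.enorm_conj]

namespace Coefficients

lemma measurable_mFun (hc : Coefficients v φ) : Measurable (Function.uncurry (mFun v φ)) := by
  have hφ1 : Measurable fun p : ℝ × E3 × E3 => φ p.1 p.2.1 :=
    hc.measurable_φ.comp (measurable_fst.prodMk (measurable_fst.comp measurable_snd))
  have hφ2 : Measurable fun p : ℝ × E3 × E3 => φ p.1 p.2.2 :=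
    hc.measurable_φ.comp (measurable_fst.prodMk (measurable_snd.comp measurable_snd))
  have hv : Measurable fun p : ℝ × E3 × E3 => v (p.2.1 - p.2.2) :=
    hc.measurable_v.comp (by fun_prop)
  exact (((Complex.measurable_ofReal.comp hv).mul (continuous_star.measurable.comp hφ1)).mul (continuous_star.measurable.comp hφ2)).neg

lemma measurable_wFun (hc : Coefficients v φ) :
    Measurable (Function.uncurry fun t (z : E3 × E3) => wFun v φ t z.1 z.2) := by
  have hφ1 : Measurable fun p : ℝ × E3 × E3 => φ p.1 p.2.1 :=
    hc.measurable_φ.comp (measurable_fst.prodMk (measurable_fst.comp measurable_snd))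
  have hφ2 : Measurable fun p : ℝ × E3 × E3 => φ p.1 p.2.2 :=
    hc.measurable_φ.comp (measurable_fst.prodMk (measurable_snd.comp measurable_snd))
  have hv : Measurable fun p : ℝ × E3 × E3 => v (p.2.1 - p.2.2) :=
    hc.measurable_v.comp (by fun_prop)
  exact ((Complex.measurable_ofReal.comp hv).mul hφ1).mul (continuous_star.measurable.comp hφ2)

lemma stronglyMeasurable_mKern (hc : Coefficients v φ) : StronglyMeasurable (mKern v φ) :=
  stronglyMeasurable_toKern hc.measurable_mFun

lemma stronglyMeasurable_wKern (hc : Coefficients v φ) : StronglyMeasurable (wKern v φ) :=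
  stronglyMeasurable_toKern hc.measurable_wFun

lemma memLp_wFun_iff (hc : Coefficients v φ) (t : ℝ) :
    MemLp (fun z : E3 × E3 => wFun v φ t z.1 z.2) 2 volume ↔ MemLp (mFun v φ t) 2 volume := by
  have h1 : AEStronglyMeasurable (fun z : E3 × E3 => wFun v φ t z.1 z.2) volume :=
    (hc.measurable_wFun.comp measurable_prodMk_left).aestronglyMeasurable
  have h2 : AEStronglyMeasurable (mFun v φ t) volume :=
    (hc.measurable_mFun.comp measurable_prodMk_left).aestronglyMeasurable
  have h3 : eLpNorm (fun z : E3 × E3 => wFun v φ t z.1 z.2) 2 volume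
      = eLpNorm (mFun v φ t) 2 volume := eLpNorm_congr_enorm_ae (ae_of_all _ (enorm_wFun t))
  rw [MemLp, MemLp, h3]
  tauto

lemma norm_wKern (hc : Coefficients v φ) (t : ℝ) : ‖wKern v φ t‖ = ‖mKern v φ t‖ := by
  have hiff := hc.memLp_wFun_iff t
  rw [wKern, mKern]
  by_cases h : MemLp (mFun v φ t) 2 volume
  · rw [toKern, toKern, dif_pos h, dif_pos (hiff.2 h), Lp.norm_toLp, Lp.norm_toLp]
    congr 1
    exact eLpNorm_congr_enorm_ae (ae_of_all _ (enorm_wFun t))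
  · rw [toKern, toKern, dif_neg h, dif_neg (fun h' => h (hiff.1 h'))]

lemma isSymm_mKern (hc : Coefficients v φ) (t : ℝ) : IsSymm (mKern v φ t) := by
  rw [mKern]
  by_cases h : MemLp (mFun v φ t) 2 volume
  · have h1 := toKern_ae h
    filter_upwards [h1, ae_swap h1] with z h2 h3
    rw [h2, h3, mFun, mFun, Prod.fst_swap, Prod.snd_swap, ← hc.even (z.1 - z.2), neg_sub]
    ring
  · rw [toKern, dif_neg h, isSymm_iff, map_zero]

lemma adjK_wKern (hc : Coefficients v φ) (t : ℝ) : adjK (wKern v φ t) = wKern v φ t := by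
  rw [wKern]
  by_cases h : MemLp (fun z : E3 × E3 => wFun v φ t z.1 z.2) 2 volume
  · have h1 := toKern_ae h
    refine Lp.ext ?_
    filter_upwards [h1, ae_swap h1, adjK_ae (toKern fun z : E3 × E3 => wFun v φ t z.1 z.2)]
      with z h2 h3 h4
    rw [h4, h2, h3, wFun, wFun, Prod.fst_swap, Prod.snd_swap, ← hc.even (z.1 - z.2), neg_sub]
    simp only [map_mul, Complex.conj_ofReal, Complex.star_def, Complex.conj_conj]
    ring
  · rw [toKern, dif_neg h, ← norm_eq_zero, norm_adjK, norm_zero]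

end Coefficients

lemma lintegral_enorm_sq_eq {α : Type*} [MeasurableSpace α] {μ : Measure α} {X : Type*}
    [NormedAddCommGroup X] (f : α → X) : ∫⁻ x, ‖f x‖ₑ ^ 2 ∂μ = eLpNorm f 2 μ ^ 2 := by
  have h := eLpNorm_nnreal_pow_eq_lintegral (μ := μ) (f := f) (p := 2) (by norm_num)
  simpa using h.symm

lemma lintegral_enorm_pow_four_eq {α : Type*} [MeasurableSpace α] {μ : Measure α} {X : Type*}
    [NormedAddCommGroup X] (f : α → X) : ∫⁻ x, ‖f x‖ₑ ^ 4 ∂μ = eLpNorm f 4 μ ^ 4 := by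
  have h := eLpNorm_nnreal_pow_eq_lintegral (μ := μ) (f := f) (p := 4) (by norm_num)
  have e1 : ∀ y : ℝ≥0∞, y ^ (((4 : ℝ≥0) : ℝ)) = y ^ 4 := fun y => by
    rw [← ENNReal.rpow_natCast]; norm_num
  simp only [e1] at h
  exact h.symm

open Classical in
/-- The potential `v * |φ|²`, set to zero at the times where `φ` is not in `L⁴`. -/
def hartTrunc (v : E3 → ℝ) (φ : ℝ → E3 → ℂ) (t : ℝ) (x : E3) : ℝ :=
  if eLpNorm (φ t) 4 volume = ⊤ then 0 else hartreePot v φ t x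

/-- The bound `‖v‖₂ ‖φ(t)‖₄²` of the potential `v * |φ|²`. -/
def hartBound (v : E3 → ℝ) (φ : ℝ → E3 → ℂ) (t : ℝ) : ℝ :=
  (eLpNorm v 2 volume * eLpNorm (φ t) 4 volume ^ 2).toReal

lemma hartBound_nonneg (t : ℝ) : 0 ≤ hartBound v φ t := ENNReal.toReal_nonneg

namespace Coefficients

/-- Cauchy–Schwarz in y, with translation and reflection invariance of the norm of v: ‖v * |φ|²‖_∞ ≤
‖v‖₂ ‖φ‖₄². -/
lemma abs_hartTrunc_le (hc : Coefficients v φ) (t : ℝ) (x : E3) :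
    |hartTrunc v φ t x| ≤ hartBound v φ t := by
  rw [hartTrunc]
  split_ifs with h
  · rw [abs_zero]
    exact hartBound_nonneg t
  have hfin : eLpNorm v 2 volume * eLpNorm (φ t) 4 volume ^ 2 ≠ ⊤ :=
    ENNReal.mul_ne_top hc.memLp.2.ne (ENNReal.pow_ne_top h)
  have hφt : Measurable (φ t) := hc.measurable_φ.comp measurable_prodMk_left
  have hvx : Measurable fun y => v (x - y) := hc.measurable_v.comp (by fun_prop)
  have h1 : ‖hartreePot v φ t x‖ₑ ≤ ∫⁻ y, ‖v (x - y)‖ₑ * ‖φ t y‖ₑ ^ 2 := by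
    refine (enorm_integral_le_lintegral_enorm _).trans (le_of_eq ?_)
    refine lintegral_congr fun y => ?_
    rw [enorm_mul, enorm_pow, enorm_norm]
  have h2 := sq_lintegral_mul_le (μ := (volume : Measure E3)) hvx.enorm.aemeasurable
    (hφt.enorm.pow_const 2).aemeasurable
  have h3 : ∫⁻ y, ‖v (x - y)‖ₑ ^ 2 = eLpNorm v 2 volume ^ 2 := by
    rw [← lintegral_enorm_sq_eq]
    exact lintegral_sub_left_eq_self (fun y => ‖v y‖ₑ ^ 2) x
  have h4 : ∫⁻ y, (‖φ t y‖ₑ ^ 2) ^ 2 = (eLpNorm (φ t) 4 volume ^ 2) ^ 2 := by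
    simp only [← pow_mul]
    exact lintegral_enorm_pow_four_eq (φ t)
  rw [h3, h4, ← mul_pow] at h2
  have h5 := h1.trans ((ENNReal.pow_le_pow_left_iff two_ne_zero).1 h2)
  have h6 := ENNReal.toReal_mono hfin h5
  rw [toReal_enorm, Real.norm_eq_abs] at h6
  exact h6

lemma measurable_eLpNorm_four (hc : Coefficients v φ) :
    Measurable fun t => eLpNorm (φ t) 4 volume := by
  have h1 : Measurable fun t => ∫⁻ x, ‖φ t x‖ₑ ^ 4 :=
    Measurable.lintegral_prod_right' (f := fun p : ℝ × E3 => ‖φ p.1 p.2‖ₑ ^ 4)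
      (hc.measurable_φ.enorm.pow_const 4)
  have h2 : (fun t => eLpNorm (φ t) 4 volume) = fun t => (∫⁻ z, ‖φ t z‖ₑ ^ 4) ^ (4⁻¹ : ℝ) := by
    funext t
    rw [lintegral_enorm_pow_four_eq, ← ENNReal.rpow_natCast, ← ENNReal.rpow_mul]
    norm_num
  rw [h2]
  exact h1.pow_const _

lemma measurable_hartTrunc (hc : Coefficients v φ) :
    Measurable (Function.uncurry (hartTrunc v φ)) := by
  have h1 : Measurable fun q : (ℝ × E3) × E3 => v (q.1.2 - q.2) * ‖φ q.1.1 q.2‖ ^ 2 := by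
    have ha : Measurable fun q : (ℝ × E3) × E3 => v (q.1.2 - q.2) :=
      hc.measurable_v.comp (by fun_prop)
    have hb : Measurable fun q : (ℝ × E3) × E3 => φ q.1.1 q.2 :=
      hc.measurable_φ.comp ((measurable_fst.comp measurable_fst).prodMk measurable_snd)
    exact ha.mul (hb.norm.pow_const 2)
  have h2 : StronglyMeasurable fun p : ℝ × E3 => hartreePot v φ p.1 p.2 :=
    h1.stronglyMeasurable.integral_prod_right'
  have hs : MeasurableSet {p : ℝ × E3 | eLpNorm (φ p.1) 4 volume = ⊤} :=
    measurableSet_eq_fun (hc.measurable_eLpNorm_four.comp measurable_fst) measurable_const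
  classical
  have e : Function.uncurry (hartTrunc v φ) = fun p : ℝ × E3 =>
      if p ∈ {p : ℝ × E3 | eLpNorm (φ p.1) 4 volume = ⊤} then 0 else hartreePot v φ p.1 p.2 := by
    funext p
    rw [Function.uncurry, hartTrunc]
    congr
  rw [e]
  exact Measurable.ite hs measurable_const h2.measurable

lemma measurable_hartSum (hc : Coefficients v φ) : Measurable (Function.uncurry
    fun t (z : E3 × E3) => ((hartTrunc v φ t z.1 : ℂ) + (hartTrunc v φ t z.2 : ℂ))) := by
  have h1 : Measurable fun p : ℝ × E3 × E3 => hartTrunc v φ p.1 p.2.1 :=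
    hc.measurable_hartTrunc.comp (f := fun p : ℝ × E3 × E3 => (p.1, p.2.1))
      (measurable_fst.prodMk (measurable_fst.comp measurable_snd))
  have h2 : Measurable fun p : ℝ × E3 × E3 => hartTrunc v φ p.1 p.2.2 :=
    hc.measurable_hartTrunc.comp (f := fun p : ℝ × E3 × E3 => (p.1, p.2.2))
      (measurable_fst.prodMk (measurable_snd.comp measurable_snd))
  exact (Complex.measurable_ofReal.comp h1).add (Complex.measurable_ofReal.comp h2)

lemma measurable_hartSum_apply (hc : Coefficients v φ) (t : ℝ) : Measurable
    fun z : E3 × E3 => ((hartTrunc v φ t z.1 : ℂ) + (hartTrunc v φ t z.2 : ℂ)) :=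
  Measurable.of_uncurry_left (f := fun t (z : E3 × E3) =>
    ((hartTrunc v φ t z.1 : ℂ) + (hartTrunc v φ t z.2 : ℂ))) hc.measurable_hartSum

lemma norm_hartSum_le (hc : Coefficients v φ) (t : ℝ) (z : E3 × E3) :
    ‖(hartTrunc v φ t z.1 : ℂ) + (hartTrunc v φ t z.2 : ℂ)‖ ≤ 2 * hartBound v φ t := by
  refine (norm_add_le _ _).trans ?_
  rw [Complex.norm_real, Complex.norm_real, Real.norm_eq_abs, Real.norm_eq_abs]
  linarith [hc.abs_hartTrunc_le t z.1, hc.abs_hartTrunc_le t z.2]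

/-- Multiplication by `(v * |φ|²)(x) + (v * |φ|²)(y)`. -/
def hartOp (hc : Coefficients v φ) (t : ℝ) : Kern →L[ℂ] Kern :=
  mulL (fun z : E3 × E3 => (hartTrunc v φ t z.1 : ℂ) + (hartTrunc v φ t z.2 : ℂ))
    (hc.measurable_hartSum_apply t) (2 * hartBound v φ t) (hc.norm_hartSum_le t)

lemma hartOp_ae (hc : Coefficients v φ) (t : ℝ) (K : Kern) :
    (hc.hartOp t K : E3 × E3 → ℂ) =ᵐ[volume]
      fun z => ((hartTrunc v φ t z.1 : ℂ) + (hartTrunc v φ t z.2 : ℂ)) * K z :=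
  mulL_ae _ _ _ _ K

/-- The operator `u ↦ g u + u gᵀ` without the Laplacians. -/
def lowerOp (hc : Coefficients v φ) (t : ℝ) : Kern →L[ℂ] Kern :=
  lmul (kernelOp (wKern v φ t)) + rmul (kernelOp (star (wKern v φ t))) + hc.hartOp t

lemma lowerOp_apply (hc : Coefficients v φ) (t : ℝ) (K : Kern) : hc.lowerOp t K =
    lmul (kernelOp (wKern v φ t)) K + rmul (kernelOp (star (wKern v φ t))) K + hc.hartOp t K := rfl

/-- The bound of the operator `lowerOp`. -/
def lowerBound (v : E3 → ℝ) (φ : ℝ → E3 → ℂ) (t : ℝ) : ℝ :=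
  2 * ‖mKern v φ t‖ + 2 * hartBound v φ t

lemma norm_lowerOp_apply_le (hc : Coefficients v φ) (t : ℝ) (K : Kern) :
    ‖hc.lowerOp t K‖ ≤ lowerBound v φ t * ‖K‖ := by
  have h1 : ‖lmul (kernelOp (wKern v φ t)) K‖ ≤ ‖mKern v φ t‖ * ‖K‖ := by
    rw [← hc.norm_wKern]
    exact (norm_lmul_apply_le _ _).trans
      (mul_le_mul_of_nonneg_right (norm_kernelOp_le _) (norm_nonneg _))
  have h2 : ‖rmul (kernelOp (star (wKern v φ t))) K‖ ≤ ‖mKern v φ t‖ * ‖K‖ := by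
    rw [← hc.norm_wKern]
    exact (norm_rmul_apply_le _ _).trans (mul_le_mul_of_nonneg_right
      ((norm_kernelOp_le _).trans_eq (norm_star_Lp (wKern v φ t))) (norm_nonneg _))
  have h3 : ‖hc.hartOp t K‖ ≤ 2 * hartBound v φ t * ‖K‖ := norm_mulL_apply_le _ _ _ _ K
  rw [lowerOp_apply, lowerBound]
  refine (norm_add₃_le).trans ?_
  linarith

/-- The exchange kernel is Hermitian and the direct potential is real. This symmetry is what removes
V from the energy estimate, so V need not be small. -/
lemma inner_lowerOp (hc : Coefficients v φ) (t : ℝ) (K L : Kern) :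
    inner ℂ (hc.lowerOp t K) L = inner ℂ K (hc.lowerOp t L) := by
  have hw : star (kernelOp (wKern v φ t)) = kernelOp (wKern v φ t) := by
    rw [star_kernelOp, hc.adjK_wKern]
  have hw' : star (kernelOp (star (wKern v φ t))) = kernelOp (star (wKern v φ t)) := by
    rw [kernelOp_star, star_barOp, hw]
  have h3 : inner ℂ (hc.hartOp t K) L = inner ℂ K (hc.hartOp t L) := by
    rw [L2.inner_def, L2.inner_def]
    refine integral_congr_ae ?_
    filter_upwards [hc.hartOp_ae t K, hc.hartOp_ae t L] with z h1 h2
    rw [h1, h2]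
    simp only [RCLike.inner_apply, map_mul, map_add, Complex.conj_ofReal]
    ring
  rw [lowerOp_apply, lowerOp_apply, inner_add_left, inner_add_left, inner_add_right,
    inner_add_right, h3, inner_lmul_right, inner_rmul_right, hw, hw']

lemma isSymm_lowerOp (hc : Coefficients v φ) (t : ℝ) {K : Kern} (hK : IsSymm K) :
    IsSymm (hc.lowerOp t K) := by
  have hw : star (kernelOp (wKern v φ t)) = kernelOp (wKern v φ t) := by
    rw [star_kernelOp, hc.adjK_wKern]
  have h1 : IsSymm (lmul (kernelOp (wKern v φ t)) K + rmul (kernelOp (star (wKern v φ t))) K) := by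
    rw [isSymm_iff_kernelOp] at hK ⊢
    rw [kernelOp_add, kernelOp_lmul, kernelOp_rmul, kernelOp_star, star_add, star_mul, star_mul,
      star_barOp, hw, hK, barOp_add, barOp_mul, barOp_mul, barOp_barOp]
    exact add_comm _ _
  have h2 : IsSymm (hc.hartOp t K) := by
    have h := hc.hartOp_ae t K
    filter_upwards [h, ae_swap h, hK] with z h1 h2 h3
    rw [h1, h2, h3, Prod.fst_swap, Prod.snd_swap, add_comm]
  rw [isSymm_iff] at h1 h2 ⊢
  rw [lowerOp_apply, map_add, h1, h2]

lemma stronglyMeasurable_lowerOp (hc : Coefficients v φ) (K : Kern) :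
    StronglyMeasurable fun t => hc.lowerOp t K := by
  have hw := hc.stronglyMeasurable_wKern
  have h1 : StronglyMeasurable fun t => lmul (kernelOp (wKern v φ t)) K :=
    (((ContinuousLinearMap.apply ℂ Kern K).continuous.comp lmul.continuous).comp
      kernelOpL.continuous).comp_stronglyMeasurable hw
  have hs : Continuous fun K : Kern => star K := conjL.continuous
  have h2 : StronglyMeasurable fun t => rmul (kernelOp (star (wKern v φ t))) K :=
    ((((ContinuousLinearMap.apply ℂ Kern K).continuous.comp rmul.continuous).comp
      kernelOpL.continuous).comp hs).comp_stronglyMeasurable hw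
  have h3 : StronglyMeasurable fun t => hc.hartOp t K := by
    have e : (fun t => hc.hartOp t K) = fun t => toKern fun z =>
        ((hartTrunc v φ t z.1 : ℂ) + (hartTrunc v φ t z.2 : ℂ)) * K z := by
      funext t
      have h := hc.hartOp_ae t K
      have hm : MemLp (fun z : E3 × E3 =>
          ((hartTrunc v φ t z.1 : ℂ) + (hartTrunc v φ t z.2 : ℂ)) * K z) 2 volume :=
        (memLp_congr_ae h).1 (Lp.memLp _)
      refine Lp.ext ?_
      filter_upwards [h, toKern_ae hm] with z h1 h2
      rw [h1, h2]
    rw [e]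
    refine stronglyMeasurable_toKern (F := fun t z =>
        ((hartTrunc v φ t z.1 : ℂ) + (hartTrunc v φ t z.2 : ℂ)) * K z) ?_
    exact hc.measurable_hartSum.mul
      ((Lp.stronglyMeasurable K).measurable.comp measurable_snd)
  exact (h1.add h2).add h3

/-- At times where m is square-integrable and φ is in L⁴, the default values in `toKern` and
`hartTrunc` play no role, and the abstract operator is the literal lower-order part of the equation.
-/
lemma lowerOp_ae (hc : Coefficients v φ) {t : ℝ} (hm : MemLp (mFun v φ t) 2 volume)
    (hφ : eLpNorm (φ t) 4 volume ≠ ⊤) (K : Kern) :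
    (hc.lowerOp t K : E3 × E3 → ℂ) =ᵐ[volume] fun z => lowerOrder v φ t K z.1 z.2 := by
  have hw := toKern_ae ((hc.memLp_wFun_iff t).2 hm)
  have hw1 : ∀ᵐ x : E3, ∀ᵐ y : E3, wKern v φ t (x, y) = wFun v φ t x y :=
    Measure.ae_ae_of_ae_prod hw
  have hw2 : ∀ᵐ z : E3 × E3, ∀ᵐ y : E3, wKern v φ t (z.1, y) = wFun v φ t z.1 y :=
    Measure.quasiMeasurePreserving_fst.ae hw1
  have hs : ∀ᵐ z : E3 × E3, (star (wKern v φ t) : Kern) z.swap = wFun v φ t z.1 z.2 := by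
    filter_upwards [ae_swap (star_ae_eq (wKern v φ t)), adjK_ae (wKern v φ t), hw] with z h1 h2 h3
    rw [h1, ← h2, hc.adjK_wKern]
    exact h3
  have hs1 : ∀ᵐ x : E3, ∀ᵐ y : E3, (star (wKern v φ t) : Kern) (y, x) = wFun v φ t x y :=
    Measure.ae_ae_of_ae_prod hs
  have hs2 : ∀ᵐ z : E3 × E3, ∀ᵐ y : E3,
      (star (wKern v φ t) : Kern) (y, z.2) = wFun v φ t z.2 y :=
    Measure.quasiMeasurePreserving_snd.ae hs1
  filter_upwards [Lp.coeFn_add (lmul (kernelOp (wKern v φ t)) K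
      + rmul (kernelOp (star (wKern v φ t))) K) (hc.hartOp t K),
    Lp.coeFn_add (lmul (kernelOp (wKern v φ t)) K) (rmul (kernelOp (star (wKern v φ t))) K),
    lmul_kernelOp_ae (wKern v φ t) K, rmul_kernelOp_ae (star (wKern v φ t)) K,
    hc.hartOp_ae t K, hw2, hs2] with z h1 h2 h3 h4 h5 h6 h7
  rw [lowerOp_apply, h1, Pi.add_apply, h2, Pi.add_apply, h3, h4, h5, lowerOrder, hartTrunc,
    hartTrunc, if_neg hφ, if_neg hφ]
  congr 2
  · refine integral_congr_ae ?_
    filter_upwards [h6] with y hy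
    rw [hy]
  · refine integral_congr_ae ?_
    filter_upwards [h7] with y hy
    rw [hy]

end Coefficients

end Coefficients

/-! ### The square root along a primitive -/

/-- The real bilinear map `(a, b) ↦ b a*` on kernels. -/
def mulAdj : Kern →L[ℝ] Kern →L[ℝ] Kern :=
  toReal.comp ((rmul.restrictScalars ℝ).comp ((kernelOpL.restrictScalars ℝ).comp adjR))

lemma mulAdj_apply (a b : Kern) : mulAdj a b = rmul (kernelOp (adjK a)) b := rfl

lemma mulAdj_self (a : Kern) : mulAdj a a = qKern a := by
  rw [mulAdj_apply, qKern, star_kernelOp]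

lemma norm_mulAdj_le (a b : Kern) : ‖mulAdj a b‖ ≤ ‖a‖ * ‖b‖ := by
  rw [mulAdj_apply, ← norm_adjK a]
  exact (norm_rmul_apply_le _ _).trans
    (mul_le_mul_of_nonneg_right (norm_kernelOp_le _) (norm_nonneg _))

/-- Differentiability is within the set of positive kernels, where the square root estimates hold;
the path Q = aa* never leaves it. -/
lemma hasFDerivWithinAt_pKern {Q : Kern} (hQ : 0 ≤ kernelOp Q) :
    HasFDerivWithinAt pKern (toReal (sylvInv (sqrtOneAdd Q) (sqrtOneAdd Q)))
      {Q | 0 ≤ kernelOp Q} Q := by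
  rw [hasFDerivWithinAt_iff_isLittleO]
  refine Asymptotics.IsBigO.trans_isLittleO (g := fun Q' => ‖Q' - Q‖ ^ 2) ?_ ?_
  · refine Asymptotics.IsBigO.of_bound 1 ?_
    filter_upwards [self_mem_nhdsWithin] with Q' hQ'
    rw [one_mul, norm_pow, norm_norm]
    exact norm_pKern_sub_sub_le hQ hQ'
  · have h : Filter.Tendsto (fun Q' : Kern => Q' - Q) (nhdsWithin Q {Q | 0 ≤ kernelOp Q})
        (nhds 0) := by
      have : Filter.Tendsto (fun Q' : Kern => Q' - Q) (nhds Q) (nhds (Q - Q)) :=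
        (continuous_id.sub continuous_const).tendsto Q
      rw [sub_self] at this
      exact this.mono_left nhdsWithin_le_nhds
    have h2 := (Asymptotics.isLittleO_norm_pow_id (E' := Kern) one_lt_two).comp_tendsto h
    exact h2

lemma BddLip.continuousOn {X Y : Type*} [NormedAddCommGroup X] [NormedAddCommGroup Y] {S : Set X}
    {f : X → Y} (hf : BddLip S f) : ContinuousOn f S := by
  obtain ⟨C, hC0, -, hC⟩ := hf
  refine (LipschitzOnWith.of_dist_le_mul (K := ⟨C, hC0⟩) fun x hx y hy => ?_).continuousOn
  rw [dist_eq_norm, dist_eq_norm]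
  exact hC x hx y hy

/-- Chain rule: (aa*)' = ga* + ag* has norm at most 2R‖g‖, and the derivative of the square root has
norm at most 1. -/
lemma IsPrimitive.exists_pKern {T R : ℝ} (hT : 0 ≤ T) {a g : ℝ → Kern} (H : IsPrimitive T a g)
    (hR : ∀ t ∈ Icc 0 T, ‖a t‖ ≤ R) :
    ∃ h : ℝ → Kern, IsPrimitive T (fun t => pKern (qKern (a t))) h ∧
      ∀ t ∈ Icc 0 T, ‖h t‖ ≤ 2 * R * ‖g t‖ := by
  have hq := H.bilin H hT mulAdj
  simp only [mulAdj_self] at hq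
  have hp := hq.comp hT (S := {Q | 0 ≤ kernelOp Q}) (fun t _ => kernelOp_qKern_nonneg (a t))
    (fun t _ => hasFDerivWithinAt_pKern (kernelOp_qKern_nonneg (a t)))
    ((bddLip_sylvInv (R := R)).toReal.continuousOn.comp (H.continuousOn hT) hR)
  refine ⟨_, hp, fun t ht => ?_⟩
  have h1 : ‖sylvInv (cOp (a t)) (cOp (a t)) (mulAdj (a t) (g t) + mulAdj (g t) (a t))‖
      ≤ 1 * ‖mulAdj (a t) (g t) + mulAdj (g t) (a t)‖ :=
    (ContinuousLinearMap.le_opNorm _ _).trans (mul_le_mul_of_nonneg_right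
      (norm_sylvInv_le (one_le_cOp _) (one_le_cOp _)) (norm_nonneg _))
  refine h1.trans ?_
  rw [one_mul]
  refine (norm_add_le _ _).trans ?_
  have h2 := (norm_mulAdj_le (a t) (g t)).trans
    (mul_le_mul_of_nonneg_right (hR t ht) (norm_nonneg _))
  have h3 := (norm_mulAdj_le (g t) (a t)).trans
    (mul_le_mul_of_nonneg_left (hR t ht) (norm_nonneg _))
  linarith

lemma opSqrt_conj {X : Type*} [NormedAddCommGroup X] [InnerProductSpace ℂ X] [CompleteSpace X]
    {U Q : X →L[ℂ] X} (hU : star U * U = 1) (hU' : U * star U = 1) (hQ : 0 ≤ Q) :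
    opSqrt (1 + U * Q * star U) = U * opSqrt (1 + Q) * star U := by
  have h1 : (0 : X →L[ℂ] X) ≤ 1 + Q := add_nonneg zero_le_one hQ
  refine opSqrt_unique ?_ ?_
  · calc U * opSqrt (1 + Q) * star U * (U * opSqrt (1 + Q) * star U)
        = U * opSqrt (1 + Q) * (star U * U) * opSqrt (1 + Q) * star U := by noncomm_ring
      _ = U * (opSqrt (1 + Q) * opSqrt (1 + Q)) * star U := by rw [hU]; noncomm_ring
      _ = U * star U + U * Q * star U := by rw [opSqrt_mul_self h1]; noncomm_ring
      _ = _ := by rw [hU']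
  · exact star_right_conjugate_nonneg
      (zero_le_one.trans (one_le_opSqrt (le_add_of_nonneg_right hQ))) U

/-- With U = e^{-itΔ} and u = UaU one has uu* = U aa* U*, so p is conjugated by U. This is why p
evolves with -Δ_x + Δ_y, that is σ = -1, while u has σ = 1. -/
lemma kernelOp_freeS_pKern {t : ℝ} {a : Kern} (ha : IsSymm (freeS 1 t a)) :
    kernelOp (freeS (-1) t (pKern (qKern a))) = chOp (freeS 1 t a) - 1 := by
  have hs : star (freeU t) = freeU (-t) := star_freeU t
  have hq : kernelOp (qKern (freeS 1 t a)) = freeU t * kernelOp (qKern a) * star (freeU t) := by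
    rw [kernelOp_qKern, kernelOp_qKern, kernelOp_freeS, one_mul, star_mul, star_mul]
    calc _ = freeU t * kernelOp a * (freeU t * star (freeU t)) * star (kernelOp a)
          * star (freeU t) := by noncomm_ring
      _ = _ := by rw [hs, freeU_mul_neg]; noncomm_ring
  rw [ha.chOp_eq, cOp, sqrtOneAdd, hq, opSqrt_conj (by rw [hs, freeU_neg_mul])
    (by rw [hs, freeU_mul_neg]) (kernelOp_qKern_nonneg a), kernelOp_freeS,
    kernelOp_pKern (kernelOp_qKern_nonneg a), sqrtOneAdd, hs, neg_one_mul, mul_sub, sub_mul,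
    mul_one, freeU_mul_neg]

/-! ### The vector field -/

/-- The radial retraction onto the ball of radius `R`. -/
def radial {X : Type*} [NormedAddCommGroup X] [NormedSpace ℝ X] (R : ℝ) (x : X) : X :=
  (R / max R ‖x‖) • x

section Radial

variable {X : Type*} [NormedAddCommGroup X] [NormedSpace ℝ X] {R : ℝ}

lemma radial_eq_self (hR : 0 < R) {x : X} (hx : ‖x‖ ≤ R) : radial R x = x := by
  rw [radial, max_eq_left hx, div_self hR.ne', one_smul]

lemma norm_radial_le (hR : 0 < R) (x : X) : ‖radial R x‖ ≤ R := by
  have hM : 0 < max R ‖x‖ := hR.trans_le (le_max_left _ _)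
  rw [radial, norm_smul, Real.norm_of_nonneg (by positivity), div_mul_eq_mul_div,
    div_le_iff₀ hM]
  exact mul_le_mul_of_nonneg_left (le_max_right _ _) hR.le

/-- One contribution ‖x - y‖ comes from moving the point and one from changing the scaling factor.
-/
lemma norm_radial_sub_le (hR : 0 < R) (x y : X) : ‖radial R x - radial R y‖ ≤ 2 * ‖x - y‖ := by
  set M := max R ‖x‖ with hM
  set N := max R ‖y‖ with hN
  have hM0 : 0 < M := hR.trans_le (le_max_left _ _)
  have hN0 : 0 < N := hR.trans_le (le_max_left _ _)
  have e : radial R x - radial R y = (R / M) • (x - y) + ((R / M) * ((N - M) / N)) • y := by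
    rw [radial, radial, smul_sub, ← hM, ← hN]
    have : (R / M) * ((N - M) / N) = R / M - R / N := by field_simp
    rw [this, sub_smul]
    abel
  have h1 : R / M ≤ 1 := (div_le_one hM0).2 (le_max_left _ _)
  have h2 : |N - M| ≤ ‖x - y‖ := by
    refine (abs_max_sub_max_le_max R ‖y‖ R ‖x‖).trans ?_
    rw [sub_self, abs_zero, max_eq_right (abs_nonneg _), norm_sub_rev]
    exact abs_norm_sub_norm_le y x
  have h3 : ‖y‖ ≤ N := le_max_right _ _
  rw [e]
  refine (norm_add_le _ _).trans ?_
  rw [norm_smul, norm_smul, norm_mul, norm_div (N - M), Real.norm_of_nonneg (by positivity : 0 ≤ R / M),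
    Real.norm_of_nonneg hN0.le, Real.norm_eq_abs]
  have h4 : R / M * ‖x - y‖ ≤ ‖x - y‖ := mul_le_of_le_one_left (norm_nonneg _) h1
  have h5 : R / M * (|N - M| / N) * ‖y‖ ≤ ‖x - y‖ := by
    have h6 : |N - M| / N * ‖y‖ ≤ ‖x - y‖ := by
      rw [div_mul_eq_mul_div, div_le_iff₀ hN0]
      exact mul_le_mul h2 h3 (norm_nonneg _) (norm_nonneg _)
    rw [mul_assoc]
    exact (mul_le_of_le_one_left (by positivity) h1).trans h6
  linarith

lemma continuous_radial (hR : 0 < R) : Continuous (radial R : X → X) :=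
  (LipschitzWith.of_dist_le_mul (K := 2) fun x y => by
    rw [dist_eq_norm, dist_eq_norm]
    exact norm_radial_sub_le hR x y).continuous

end Radial

lemma isSymm_smul {K : Kern} (hK : IsSymm K) (c : ℂ) : IsSymm (c • K) := by
  rw [isSymm_iff] at hK ⊢
  rw [map_smul, hK]

lemma isSymm_sub {K L : Kern} (hK : IsSymm K) (hL : IsSymm L) : IsSymm (K - L) := by
  rw [isSymm_iff] at hK hL ⊢
  rw [map_sub, hK, hL]

lemma isSymm_radial {K : Kern} (hK : IsSymm K) (R : ℝ) : IsSymm (radial R K) :=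
  isSymm_smul hK ((R / max R ‖K‖ : ℝ) : ℂ)

lemma isSymm_freeS {K : Kern} (hK : IsSymm K) (t : ℝ) : IsSymm (freeS 1 t K) := by
  rw [isSymm_iff_kernelOp] at hK ⊢
  rw [kernelOp_freeS, one_mul, star_mul, star_mul, barOp_mul, barOp_mul, hK, star_freeU, barOp_freeU,
    mul_assoc]

/-- The symmetric part of a kernel. -/
def symPart : Kern →L[ℂ] Kern :=
  (1 / 2 : ℂ) • (ContinuousLinearMap.id ℂ Kern + transK.toContinuousLinearMap)

lemma symPart_apply (K : Kern) : symPart K = (1 / 2 : ℂ) • (K + transK K) := rfl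

lemma transK_symPart (K : Kern) : transK (symPart K) = symPart K := by
  rw [symPart_apply, map_smul, map_add, transK_transK, add_comm]

lemma symPart_eq_self {K : Kern} (hK : IsSymm K) : symPart K = K := by
  rw [symPart_apply, isSymm_iff.1 hK, ← two_smul ℂ, smul_smul]
  norm_num

lemma norm_symPart_le (K : Kern) : ‖symPart K‖ ≤ ‖K‖ := by
  rw [symPart_apply, norm_smul]
  have h := norm_add_le K (transK K)
  rw [LinearIsometry.norm_map] at h
  have : ‖(1 / 2 : ℂ)‖ = 1 / 2 := by norm_num
  rw [this]
  linarith

/-! ### Integrability of the coefficients -/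

namespace Coefficients

variable {v : E3 → ℝ} {φ : ℝ → E3 → ℂ}

lemma integrableOn_mKern (hc : Coefficients v φ) {T ε : ℝ}
    (h : (∫⁻ t in Icc 0 T, eLpNorm (mFun v φ t) 2 volume) ≤ ENNReal.ofReal ε) :
    IntegrableOn (mKern v φ) (Icc 0 T) := by
  refine ⟨hc.stronglyMeasurable_mKern.aestronglyMeasurable, ?_⟩
  refine lt_of_le_of_lt ?_ (h.trans_lt ENNReal.ofReal_lt_top)
  exact lintegral_mono fun t => enorm_toKern_le _

lemma integral_norm_mKern_le (hc : Coefficients v φ) {T ε : ℝ} (hε : 0 ≤ ε)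
    (h : (∫⁻ t in Icc 0 T, eLpNorm (mFun v φ t) 2 volume) ≤ ENNReal.ofReal ε) :
    ∫ t in Icc 0 T, ‖mKern v φ t‖ ≤ ε := by
  rw [integral_norm_eq_lintegral_enorm hc.stronglyMeasurable_mKern.aestronglyMeasurable]
  refine ENNReal.toReal_le_of_le_ofReal hε (le_trans ?_ h)
  exact lintegral_mono fun t => enorm_toKern_le _

lemma lintegral_hartBound_le {T : ℝ} {A : ℝ≥0} (hc : Coefficients v φ)
    (h : (∫⁻ t in Icc 0 T, eLpNorm (φ t) 4 volume ^ 2) ≤ A) :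
    (∫⁻ t in Icc 0 T, eLpNorm v 2 volume * eLpNorm (φ t) 4 volume ^ 2)
      ≤ eLpNorm v 2 volume * A := by
  rw [lintegral_const_mul _ (hc.measurable_eLpNorm_four.pow_const 2)]
  exact mul_le_mul_right h _

lemma integrableOn_hartBound {T : ℝ} {A : ℝ≥0} (hc : Coefficients v φ)
    (h : (∫⁻ t in Icc 0 T, eLpNorm (φ t) 4 volume ^ 2) ≤ A) :
    IntegrableOn (hartBound v φ) (Icc 0 T) := by
  refine integrable_toReal_of_lintegral_ne_top
    ((hc.measurable_eLpNorm_four.pow_const 2).const_mul _).aemeasurable ?_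
  exact ne_top_of_le_ne_top (ENNReal.mul_ne_top hc.memLp.2.ne ENNReal.coe_ne_top)
    (hc.lintegral_hartBound_le h)

lemma integral_hartBound_le {T : ℝ} {A : ℝ≥0} (hc : Coefficients v φ)
    (h : (∫⁻ t in Icc 0 T, eLpNorm (φ t) 4 volume ^ 2) ≤ A) :
    ∫ t in Icc 0 T, hartBound v φ t ≤ (eLpNorm v 2 volume).toReal * A := by
  have hm : Measurable fun t => eLpNorm v 2 volume * eLpNorm (φ t) 4 volume ^ 2 :=
    (hc.measurable_eLpNorm_four.pow_const 2).const_mul _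
  have htop : eLpNorm v 2 volume * (A : ℝ≥0∞) ≠ ⊤ :=
    ENNReal.mul_ne_top hc.memLp.2.ne ENNReal.coe_ne_top
  have hle := hc.lintegral_hartBound_le h
  have e : ∫ t in Icc 0 T, hartBound v φ t
      = (∫⁻ t in Icc 0 T, eLpNorm v 2 volume * eLpNorm (φ t) 4 volume ^ 2).toReal :=
    integral_toReal hm.aemeasurable (ae_lt_top hm (ne_top_of_le_ne_top htop hle))
  rw [e]
  refine (ENNReal.toReal_mono htop hle).trans_eq ?_
  rw [ENNReal.toReal_mul, ENNReal.coe_toReal]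

lemma ae_good {T ε : ℝ} {A : ℝ≥0} (hc : Coefficients v φ)
    (h : (∫⁻ t in Icc 0 T, eLpNorm (φ t) 4 volume ^ 2) ≤ A)
    (h' : (∫⁻ t in Icc 0 T, eLpNorm (mFun v φ t) 2 volume) ≤ ENNReal.ofReal ε) :
    ∀ᵐ t ∂(volume.restrict (Icc 0 T)),
      MemLp (mFun v φ t) 2 volume ∧ eLpNorm (φ t) 4 volume ≠ ⊤ := by
  have h1 := ae_lt_top (hc.measurable_eLpNorm_four.pow_const 2)
    (ne_top_of_le_ne_top ENNReal.coe_ne_top h)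
  have h2 := ae_lt_top (measurable_eLpNorm_two hc.measurable_mFun)
    (ne_top_of_le_ne_top ENNReal.ofReal_ne_top h')
  filter_upwards [h1, h2] with t h3 h4
  refine ⟨⟨(hc.measurable_mFun.comp measurable_prodMk_left).aestronglyMeasurable, h4⟩, fun htop => ?_⟩
  simp [htop] at h3

lemma lowerBound_nonneg (t : ℝ) : 0 ≤ lowerBound v φ t := by
  have := hartBound_nonneg (v := v) (φ := φ) t
  rw [lowerBound]
  positivity

lemma integrableOn_lowerBound {T ε : ℝ} {A : ℝ≥0} (hc : Coefficients v φ)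
    (h : (∫⁻ t in Icc 0 T, eLpNorm (φ t) 4 volume ^ 2) ≤ A)
    (h' : (∫⁻ t in Icc 0 T, eLpNorm (mFun v φ t) 2 volume) ≤ ENNReal.ofReal ε) :
    IntegrableOn (lowerBound v φ) (Icc 0 T) :=
  ((hc.integrableOn_mKern h').norm.const_mul 2).add ((hc.integrableOn_hartBound h).const_mul 2)

lemma integral_lowerBound_le {T ε : ℝ} {A : ℝ≥0} (hε : 0 ≤ ε) (hc : Coefficients v φ)
    (h : (∫⁻ t in Icc 0 T, eLpNorm (φ t) 4 volume ^ 2) ≤ A)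
    (h' : (∫⁻ t in Icc 0 T, eLpNorm (mFun v φ t) 2 volume) ≤ ENNReal.ofReal ε) :
    ∫ t in Icc 0 T, lowerBound v φ t ≤ 2 * ε + 2 * ((eLpNorm v 2 volume).toReal * A) := by
  have e : ∫ t in Icc 0 T, lowerBound v φ t
      = 2 * (∫ t in Icc 0 T, ‖mKern v φ t‖) + 2 * ∫ t in Icc 0 T, hartBound v φ t := by
    rw [← integral_const_mul, ← integral_const_mul, ← integral_add
      ((hc.integrableOn_mKern h').norm.const_mul 2) ((hc.integrableOn_hartBound h).const_mul 2)]
    rfl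
  rw [e]
  have h1 := hc.integral_norm_mKern_le hε h'
  have h2 := hc.integral_hartBound_le h
  linarith

/-! ### Solution in the interaction picture -/

/-- The right-hand side `N(u, m) - V u` at `u = e^{-itΔ} x e^{-itΔ}`, with the argument of the
nonlinearity cut off at radius `R`. -/
def force (hc : Coefficients v φ) (R t : ℝ) (x : Kern) : Kern :=
  NMap (radial R (freeS 1 t x)) (mKern v φ t) - hc.lowerOp t (freeS 1 t x)

variable {R C : ℝ}

/-- The cut-off turns the Lipschitz bound on a ball into a global one. Only the nonlinearity is cut
off: V is already linear, and leaving it intact preserves its symmetry for the energy estimate. -/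
lemma norm_force_sub_le (hc : Coefficients v φ) (hR : 0 < R)
    (hC : ∀ x ∈ {u : Kern | ‖u‖ ≤ R}, ∀ y ∈ {u : Kern | ‖u‖ ≤ R},
      ‖NMap x - NMap y‖ ≤ C * ‖x - y‖) (hC0 : 0 ≤ C) (t : ℝ) (x y : Kern) :
    ‖hc.force R t x - hc.force R t y‖
      ≤ (2 * C * ‖mKern v φ t‖ + lowerBound v φ t) * ‖x - y‖ := by
  set x' := freeS 1 t x with hx'
  set y' := freeS 1 t y with hy'
  have hxy : ‖x' - y'‖ = ‖x - y‖ := by rw [hx', hy', ← map_sub, norm_freeS_apply]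
  have e : hc.force R t x - hc.force R t y =
      (NMap (radial R x') - NMap (radial R y')) (mKern v φ t) - hc.lowerOp t (x' - y') := by
    rw [force, force, sub_apply, map_sub]
    abel
  have h1 : ‖(NMap (radial R x') - NMap (radial R y')) (mKern v φ t)‖
      ≤ C * (2 * ‖x' - y'‖) * ‖mKern v φ t‖ := by
    refine (ContinuousLinearMap.le_opNorm _ _).trans (mul_le_mul_of_nonneg_right ?_ (norm_nonneg _))
    refine (hC _ (norm_radial_le hR x') _ (norm_radial_le hR y')).trans ?_
    exact mul_le_mul_of_nonneg_left (norm_radial_sub_le hR x' y') hC0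
  have h2 := hc.norm_lowerOp_apply_le t (x' - y')
  rw [e]
  refine (norm_sub_le _ _).trans ?_
  rw [hxy] at h1 h2
  linarith

lemma norm_force_le (hc : Coefficients v φ) (hR : 0 < R)
    (hC : ∀ x ∈ {u : Kern | ‖u‖ ≤ R}, ‖NMap x‖ ≤ C) (t : ℝ) (x : Kern) :
    ‖hc.force R t x‖ ≤ C * ‖mKern v φ t‖ + lowerBound v φ t * ‖x‖ := by
  refine (norm_sub_le _ _).trans (add_le_add ?_ ?_)
  · exact (ContinuousLinearMap.le_opNorm _ _).trans
      (mul_le_mul_of_nonneg_right (hC _ (norm_radial_le hR _)) (norm_nonneg _))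
  · refine (hc.norm_lowerOp_apply_le t _).trans_eq ?_
    rw [norm_freeS_apply]

lemma aestronglyMeasurable_NMap {S : Set ℝ} (hS : MeasurableSet S) (hc : Coefficients v φ)
    {u : ℝ → Kern} (hu : ContinuousOn u S) (hR : ∀ t ∈ S, ‖u t‖ ≤ R) :
    AEStronglyMeasurable (fun t => NMap (u t) (mKern v φ t)) (volume.restrict S) := by
  have h1 : ContinuousOn (fun t => NMap (u t)) S :=
    (bddLip_NMap (R := R)).continuousOn.comp hu hR
  exact (ContinuousLinearMap.id ℝ (Kern →L[ℝ] Kern)).aestronglyMeasurable_comp₂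
    (h1.aestronglyMeasurable hS) hc.stronglyMeasurable_mKern.aestronglyMeasurable

lemma aestronglyMeasurable_lowerOp {μ : Measure ℝ} (hc : Coefficients v φ) {u : ℝ → Kern}
    (hu : AEStronglyMeasurable u μ) : AEStronglyMeasurable (fun t => hc.lowerOp t (u t)) μ :=
  aestronglyMeasurable_comp_of_lipschitz (f := fun t K => hc.lowerOp t K)
    (fun K => (hc.stronglyMeasurable_lowerOp K).aestronglyMeasurable)
    (fun t K L => by rw [← map_sub]; exact hc.norm_lowerOp_apply_le t (K - L)) hu

lemma aestronglyMeasurable_force (hc : Coefficients v φ) (hR : 0 < R) (T : ℝ) (x : Kern) :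
    AEStronglyMeasurable (fun t => hc.force R t x) (volume.restrict (Icc 0 T)) := by
  have hcont : Continuous fun t => freeS 1 t x := continuous_freeS 1 x
  refine (hc.aestronglyMeasurable_NMap (R := R) measurableSet_Icc
    ((continuous_radial hR).comp hcont).continuousOn (fun t _ => norm_radial_le hR _)).sub ?_
  exact hc.aestronglyMeasurable_lowerOp hcont.aestronglyMeasurable

lemma isSymm_force (hc : Coefficients v φ) (R t : ℝ) {x : Kern} (hx : IsSymm x) :
    IsSymm (hc.force R t x) :=
  isSymm_sub (isSymm_NMap (isSymm_radial (isSymm_freeS hx t) R) (hc.isSymm_mKern t))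
    (hc.isSymm_lowerOp t (isSymm_freeS hx t))

/-- The equation is first solved with the field projected onto symmetric kernels, which makes the
solution symmetric automatically. On symmetric kernels the projection acts trivially, so it can then
be removed. -/
lemma exists_interaction {T ε : ℝ} {A : ℝ≥0} (hT : 0 ≤ T) (hR : 0 < R) (hc : Coefficients v φ)
    (h : (∫⁻ t in Icc 0 T, eLpNorm (φ t) 4 volume ^ 2) ≤ A)
    (h' : (∫⁻ t in Icc 0 T, eLpNorm (mFun v φ t) 2 volume) ≤ ENNReal.ofReal ε)
    {u₀ : Kern} (hu₀ : IsSymm u₀) :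
    ∃ a : ℝ → Kern, a 0 = u₀ ∧ (∀ t ∈ Icc 0 T, IsSymm (a t)) ∧
      IsPrimitive T a (fun t => (-Complex.I) • freeS 1 (-t) (hc.force R t (a t))) := by
  obtain ⟨C, hC0, hC1, hC2⟩ := bddLip_NMap (R := R)
  have hnorm : ∀ t (K : Kern), ‖symPart ((-Complex.I) • freeS 1 (-t) K)‖ ≤ ‖K‖ := fun t K => by
    refine (norm_symPart_le _).trans ?_
    rw [norm_smul, norm_neg, Complex.norm_I, one_mul, norm_freeS_apply]
  have hmeas : ∀ x : Kern, AEStronglyMeasurable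
      (fun t => symPart ((-Complex.I) • freeS 1 (-t) (hc.force R t x)))
      (volume.restrict (Icc 0 T)) := fun x => by
    have h1 := aestronglyMeasurable_freeS 1 (-1) (hc.aestronglyMeasurable_force hR T x)
    simp only [neg_one_mul] at h1
    exact symPart.continuous.comp_aestronglyMeasurable (h1.const_smul (-Complex.I))
  obtain ⟨a, ha0, ha⟩ := exists_isPrimitive_of_lipschitz (E := Kern) hT
    (f := fun t x => symPart ((-Complex.I) • freeS 1 (-t) (hc.force R t x)))
    (ℓ := fun t => 2 * C * ‖mKern v φ t‖ + lowerBound v φ t) hmeas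
    (fun t x y => by
      rw [← map_sub, ← smul_sub, ← map_sub]
      exact (hnorm t _).trans (hc.norm_force_sub_le hR hC2 hC0 t x y))
    (fun t => by
      have := lowerBound_nonneg (v := v) (φ := φ) t
      positivity)
    (((hc.integrableOn_mKern h').norm.const_mul _).add (hc.integrableOn_lowerBound h h'))
    (by
      refine Integrable.mono' ((hc.integrableOn_mKern h').norm.const_mul C) (hmeas 0)
        (ae_of_all _ fun t => (hnorm t _).trans ?_)
      have := hc.norm_force_le hR hC1 t 0
      simpa using this) u₀
  have hsym : ∀ t ∈ Icc 0 T, IsSymm (a t) := fun t ht => by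
    have h1 := ha.clm hT (transK.toContinuousLinearMap.restrictScalars ℝ)
    have h2 := h1.eq_add t ht
    have e : ∀ K, (transK.toContinuousLinearMap.restrictScalars ℝ) K = transK K := fun K => rfl
    simp only [e, transK_symPart] at h2
    rw [isSymm_iff, h2, ha0, isSymm_iff.1 hu₀, ha.eq_add t ht, ha0]
  refine ⟨a, ha0, hsym, ?_⟩
  have hcongr : ∀ t ∈ Icc 0 T, symPart ((-Complex.I) • freeS 1 (-t) (hc.force R t (a t)))
      = (-Complex.I) • freeS 1 (-t) (hc.force R t (a t)) := fun t ht =>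
    symPart_eq_self (isSymm_smul (isSymm_freeS (hc.isSymm_force R t (hsym t ht)) (-t)) _)
  refine ⟨?_, fun t ht => ?_⟩
  · refine ha.integrable.congr fun t ht => ?_
    rw [uIoc_of_le hT] at ht
    exact hcongr t ⟨ht.1.le, ht.2⟩
  · rw [ha.eq_add t ht]
    congr 1
    refine intervalIntegral.integral_congr fun s hs => ?_
    rw [uIcc_of_le ht.1] at hs
    exact hcongr s ⟨hs.1, hs.2.trans ht.2⟩

end Coefficients

/-! ### Energy estimate and conclusion -/

lemma norm_neg_I_mul_add_le {a b z : ℂ} (hz : z = a - b) (hb : (starRingEnd ℂ) b = b) :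
    ‖-Complex.I * z + (starRingEnd ℂ) (-Complex.I * z)‖ ≤ 2 * ‖a‖ := by
  have e : -Complex.I * z + (starRingEnd ℂ) (-Complex.I * z)
      = -Complex.I * a + Complex.I * (starRingEnd ℂ) a := by
    rw [hz, map_mul, map_sub, hb, map_neg, Complex.conj_I]
    ring
  rw [e]
  refine (norm_add_le _ _).trans ?_
  rw [norm_mul, norm_mul, norm_neg, Complex.norm_I, RCLike.norm_conj]
  linarith

namespace Coefficients

variable {v : E3 → ℝ} {φ : ℝ → E3 → ℂ} {R C T ε : ℝ} {A : ℝ≥0} {u₀ : Kern} {a : ℝ → Kern}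

/-- This is d/dt ‖x‖² along the flow. Since ⟨u, Vu⟩ is real, multiplication by -i makes its real
part vanish and only the nonlinearity contributes. -/
lemma norm_inner_force_le (hc : Coefficients v φ) (hR : 0 < R)
    (hC : ∀ x ∈ {u : Kern | ‖u‖ ≤ R}, ‖NMap x‖ ≤ C) (t : ℝ) (x : Kern) :
    ‖inner ℂ x ((-Complex.I) • freeS 1 (-t) (hc.force R t x))
      + inner ℂ ((-Complex.I) • freeS 1 (-t) (hc.force R t x)) x‖
      ≤ 2 * (‖x‖ * (C * ‖mKern v φ t‖)) := by
  set u := freeS 1 t x with hu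
  have h1 : inner ℂ x ((-Complex.I) • freeS 1 (-t) (hc.force R t x))
      = -Complex.I * inner ℂ u (hc.force R t x) := by
    rw [inner_smul_right, hu, inner_freeS_left]
  have h2 : inner ℂ ((-Complex.I) • freeS 1 (-t) (hc.force R t x)) x
      = (starRingEnd ℂ) (-Complex.I * inner ℂ u (hc.force R t x)) := by
    rw [← inner_conj_symm, h1]
  have h3 : inner ℂ u (hc.force R t x) = inner ℂ u (NMap (radial R u) (mKern v φ t))
      - inner ℂ u (hc.lowerOp t u) := by
    rw [force, inner_sub_right]
  have h4 : (starRingEnd ℂ) (inner ℂ u (hc.lowerOp t u)) = inner ℂ u (hc.lowerOp t u) := by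
    rw [inner_conj_symm, hc.inner_lowerOp]
  rw [h2, h1]
  refine (norm_neg_I_mul_add_le h3 h4).trans ?_
  refine mul_le_mul_of_nonneg_left ((norm_inner_le_norm _ _).trans ?_) zero_le_two
  rw [hu, norm_freeS_apply]
  refine mul_le_mul_of_nonneg_left ?_ (norm_nonneg _)
  exact (ContinuousLinearMap.le_opNorm _ _).trans
    (mul_le_mul_of_nonneg_right (hC _ (norm_radial_le hR _)) (norm_nonneg _))

/-- The energy estimate: the solution stays in the ball where the cut-off is inactive. -/
lemma norm_interaction_le (hc : Coefficients v φ) (hT : 0 ≤ T) (hε : 0 ≤ ε)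
    (hR : R = ‖u₀‖ + 1) (hC0 : 0 ≤ C) (hC : ∀ x ∈ {u : Kern | ‖u‖ ≤ R}, ‖NMap x‖ ≤ C)
    (hCε : 2 * C * ε ≤ 1)
    (h' : (∫⁻ t in Icc 0 T, eLpNorm (mFun v φ t) 2 volume) ≤ ENNReal.ofReal ε)
    (ha0 : a 0 = u₀)
    (ha : IsPrimitive T a (fun t => (-Complex.I) • freeS 1 (-t) (hc.force R t (a t)))) :
    ∀ t ∈ Icc 0 T, ‖a t‖ ≤ R := by
  have hR0 : 0 < R := by rw [hR]; positivity
  have hac := ha.continuousOn hT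
  -- Evaluating the energy identity at the time of maximal norm M gives M² ≤ ‖u₀‖² + 2MCε ≤ ‖u₀‖² +
  -- M without a Gronwall argument.
  obtain ⟨s, hs, hmax⟩ := isCompact_Icc.exists_isMaxOn (nonempty_Icc.2 hT) hac.norm
  set M := ‖a s‖ with hM
  have hM0 : 0 ≤ M := norm_nonneg _
  have hle : ∀ t ∈ Icc 0 T, ‖a t‖ ≤ M := fun t ht => hmax ht
  have hprim := ha.bilin ha hT innerBilin
  have heq := hprim.eq_add s hs
  simp only [innerBilin_apply, inner_self_eq_norm_sq_to_K] at heq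
  rw [ha0] at heq
  have hmi : IntegrableOn (fun t => 2 * (M * (C * ‖mKern v φ t‖))) (Icc 0 T) :=
    (((hc.integrableOn_mKern h').norm.const_mul C).const_mul M).const_mul 2
  have hint : ‖∫ t in (0 : ℝ)..s,
      (inner ℂ (a t) ((-Complex.I) • freeS 1 (-t) (hc.force R t (a t)))
        + inner ℂ ((-Complex.I) • freeS 1 (-t) (hc.force R t (a t))) (a t))‖ ≤ M := by
    have h1 : ‖∫ t in (0 : ℝ)..s,
        (inner ℂ (a t) ((-Complex.I) • freeS 1 (-t) (hc.force R t (a t)))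
          + inner ℂ ((-Complex.I) • freeS 1 (-t) (hc.force R t (a t))) (a t))‖
        ≤ ∫ t in (0 : ℝ)..s, 2 * (M * (C * ‖mKern v φ t‖)) := by
      refine intervalIntegral.norm_integral_le_of_norm_le hs.1
        (Filter.Eventually.of_forall fun t ht => ?_) ?_
      · refine (hc.norm_inner_force_le hR0 hC t (a t)).trans ?_
        have := hle t ⟨ht.1.le, ht.2.trans hs.2⟩
        gcongr
      · rw [intervalIntegrable_iff_integrableOn_Icc_of_le hs.1]
        exact hmi.mono_set (Icc_subset_Icc_right hs.2)
    refine h1.trans ?_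
    rw [intervalIntegral.integral_of_le hs.1, ← integral_Icc_eq_integral_Ioc]
    have h2 : ∫ t in Icc 0 s, 2 * (M * (C * ‖mKern v φ t‖))
        ≤ ∫ t in Icc 0 T, 2 * (M * (C * ‖mKern v φ t‖)) :=
      setIntegral_mono_set hmi (ae_of_all _ fun t => by positivity)
        (Icc_subset_Icc_right hs.2).eventuallyLE
    refine h2.trans ?_
    rw [integral_const_mul, integral_const_mul, integral_const_mul]
    have h3 := hc.integral_norm_mKern_le hε h'
    calc 2 * (M * (C * ∫ t in Icc 0 T, ‖mKern v φ t‖)) ≤ 2 * (M * (C * ε)) := by gcongr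
      _ = M * (2 * C * ε) := by ring
      _ ≤ M := mul_le_of_le_one_right hM0 hCε
  have hsq : M ^ 2 ≤ ‖u₀‖ ^ 2 + M := by
    have h1 : ‖((M : ℂ)) ^ 2‖ = M ^ 2 := by
      rw [norm_pow, Complex.norm_real, Real.norm_of_nonneg hM0]
    have h2 : ‖((‖u₀‖ : ℝ) : ℂ) ^ 2‖ = ‖u₀‖ ^ 2 := by
      rw [norm_pow, Complex.norm_real, norm_norm]
    have h3 := congrArg norm heq
    rw [← h1]
    refine h3.le.trans ((norm_add_le _ _).trans (add_le_add h2.le hint))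
  -- If M > ‖u₀‖ + 1 then M(M - 1) > ‖u₀‖(‖u₀‖ + 1) ≥ ‖u₀‖², contradicting the previous inequality.
  have hMR : M ≤ R := by
    by_contra hcon
    rw [not_le, hR] at hcon
    nlinarith [norm_nonneg u₀]
  exact fun t ht => (hle t ht).trans hMR

/-- B bounds the L¹L² norm of the force: C‖m‖ from the nonlinearity plus R times the norm of V.
Since ‖u‖ ≤ R, the radial cut-off is the identity along the solution and the original equation
holds. -/
theorem exists_solution (hc : Coefficients v φ) (hT : 0 < T) (hε : 0 ≤ ε)
    (hu₀ : IsSymm u₀) (hR : R = ‖u₀‖ + 1) (hC0 : 0 ≤ C)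
    (hC : ∀ x ∈ {u : Kern | ‖u‖ ≤ R}, ‖NMap x‖ ≤ C) (hCε : 2 * C * ε ≤ 1)
    (h : (∫⁻ t in Icc 0 T, eLpNorm (φ t) 4 volume ^ 2) ≤ A)
    (h' : (∫⁻ t in Icc 0 T, eLpNorm (mFun v φ t) 2 volume) ≤ ENNReal.ofReal ε)
    {B : ℝ} (hB : B = C * ε + (2 * ε + 2 * ((eLpNorm v 2 volume).toReal * A)) * R) :
    ∃ u : ℝ → Kern, ContinuousOn u (Icc 0 T) ∧ u 0 = u₀ ∧ (∀ t ∈ Icc 0 T, IsSymm (u t)) ∧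
      (∀ t ∈ Icc 0 T, ‖u t‖ ≤ R) ∧ SolvesSemilinear v φ T u ∧
      (∃ G : ℝ → Kern, SchrodingerEq 1 T u G ∧ (∫ t in Icc 0 T, ‖G t‖) ≤ B) ∧
      (∃ p P : ℝ → Kern, (∀ t ∈ Icc 0 T, kernelOp (p t) = chOp (u t) - 1) ∧
        SchrodingerEq (-1) T p P ∧ (∫ t in Icc 0 T, ‖P t‖) ≤ 2 * R * B) := by
  have hR0 : 0 < R := by rw [hR]; positivity
  obtain ⟨a, ha0, hsym, ha⟩ := hc.exists_interaction hT.le hR0 h h' hu₀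
  have hbd := hc.norm_interaction_le hT.le hε hR hC0 hC hCε h' ha0 ha
  have hac := ha.continuousOn hT.le
  set u : ℝ → Kern := fun t => freeS 1 t (a t) with hu
  have huc : ContinuousOn u (Icc 0 T) := continuousOn_freeS_apply 1 hac
  have hus : ∀ t ∈ Icc 0 T, IsSymm (u t) := fun t ht => isSymm_freeS (hsym t ht) t
  have hun : ∀ t ∈ Icc 0 T, ‖u t‖ ≤ R := fun t ht => by
    rw [hu, norm_freeS_apply]
    exact hbd t ht
  set G : ℝ → Kern := fun t => hc.force R t (a t) with hG
  have hGeq : ∀ t, Complex.I • freeS 1 t ((-Complex.I) • freeS 1 (-t) (G t)) = G t := fun t => by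
    rw [map_smul, freeS_freeS_neg, smul_smul]
    simp
  have hSch : SchrodingerEq 1 T u G := by
    have := ha.schrodingerEq hT.le 1
    exact (funext hGeq : (fun t => Complex.I • freeS 1 t ((-Complex.I) • freeS 1 (-t) (G t))) = G)
      ▸ this
  have hmaj : IntegrableOn (fun t => C * ‖mKern v φ t‖ + lowerBound v φ t * R) (Icc 0 T) :=
    ((hc.integrableOn_mKern h').norm.const_mul C).add ((hc.integrableOn_lowerBound h h').mul_const R)
  have hGle : ∀ t ∈ Icc 0 T, ‖G t‖ ≤ C * ‖mKern v φ t‖ + lowerBound v φ t * R := fun t ht =>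
    (hc.norm_force_le hR0 hC t (a t)).trans (add_le_add le_rfl
      (mul_le_mul_of_nonneg_left (hbd t ht) (lowerBound_nonneg t)))
  have hGB : ∫ t in Icc 0 T, ‖G t‖ ≤ B := by
    refine (setIntegral_mono_on hSch.2.1.norm hmaj measurableSet_Icc hGle).trans ?_
    rw [integral_add ((hc.integrableOn_mKern h').norm.const_mul C)
      ((hc.integrableOn_lowerBound h h').mul_const R), integral_const_mul, integral_mul_const, hB]
    have h1 := hc.integral_norm_mKern_le hε h'
    have h2 := hc.integral_lowerBound_le hε h h'
    gcongr
  refine ⟨u, huc, ?_, hus, hun, ?_, ⟨G, hSch, hGB⟩, ?_⟩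
  · rw [hu]
    simp only [freeS_zero, ha0]
  · refine ⟨fun t => NMap (u t) (mKern v φ t), G, ?_, ?_, hSch, ?_⟩
    · refine Integrable.mono' ((hc.integrableOn_mKern h').norm.const_mul C)
        (hc.aestronglyMeasurable_NMap measurableSet_Icc huc hun)
        ((ae_restrict_iff' measurableSet_Icc).2 (ae_of_all _ fun t ht => ?_))
      exact (ContinuousLinearMap.le_opNorm _ _).trans
        (mul_le_mul_of_nonneg_right (hC _ (hun t ht)) (norm_nonneg _))
    · filter_upwards [hc.ae_good h h', ae_restrict_mem measurableSet_Icc] with t ht htI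
      exact ⟨ht.1, ((hus t htI).rhsOp_eq (hc.isSymm_mKern t)).symm⟩
    · filter_upwards [hc.ae_good h h', ae_restrict_mem measurableSet_Icc] with t ht htI
      have e : G t + hc.lowerOp t (u t) = NMap (u t) (mKern v φ t) := by
        rw [hG]
        simp only [force]
        rw [radial_eq_self hR0 (hun t htI), sub_add_cancel]
      filter_upwards [hc.lowerOp_ae ht.1 ht.2 (u t), Lp.coeFn_add (G t) (hc.lowerOp t (u t))]
        with z h1 h2
      rw [← e, h2, Pi.add_apply, h1]
  · obtain ⟨p', hp', hp'le⟩ := ha.exists_pKern hT.le hbd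
    have hP := hp'.schrodingerEq hT.le (-1)
    refine ⟨_, _, fun t ht => kernelOp_freeS_pKern (hus t ht), hP, ?_⟩
    have hle : ∀ t ∈ Icc 0 T, ‖Complex.I • freeS (-1) t (p' t)‖ ≤ 2 * R * ‖G t‖ := fun t ht => by
      rw [norm_smul, Complex.norm_I, one_mul, norm_freeS_apply]
      refine (hp'le t ht).trans_eq ?_
      rw [norm_smul, norm_neg, Complex.norm_I, one_mul, norm_freeS_apply]
    refine (setIntegral_mono_on hP.2.1.norm (hSch.2.1.norm.const_mul _) measurableSet_Icc hle).trans ?_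
    rw [integral_const_mul]
    gcongr

end Coefficients

/-! ### Measurable representatives of the potential -/

/-- The representative is averaged with its reflection, so that it is even at every point. The
equation sees v only through almost everywhere classes and integrals, so replacing v is harmless. -/
lemma exists_measurable_even {v : E3 → ℝ} (hv : MemLp v 2 volume) (heven : ∀ x, v (-x) = v x) :
    ∃ w : E3 → ℝ, Measurable w ∧ (∀ x, w (-x) = w x) ∧ v =ᵐ[volume] w := by
  set w := hv.1.mk v with hw
  have hwm : Measurable w := hv.1.stronglyMeasurable_mk.measurable
  have hvw : v =ᵐ[volume] w := hv.1.ae_eq_mk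
  have hneg : ∀ᵐ x : E3, v (-x) = w (-x) :=
    (Measure.measurePreserving_neg (volume : Measure E3)).quasiMeasurePreserving.ae hvw
  refine ⟨fun x => (w x + w (-x)) / 2, (hwm.add (hwm.comp measurable_neg)).div_const 2,
    fun x => by simp only [neg_neg, add_comm], ?_⟩
  filter_upwards [hvw, hneg] with x h1 h2
  rw [← h1, ← h2, heven]
  ring

section Congr

variable {v w : E3 → ℝ}

lemma ae_sub_left (hvw : v =ᵐ[volume] w) (x : E3) : ∀ᵐ y : E3, v (x - y) = w (x - y) :=
  (quasiMeasurePreserving_sub_left (volume : Measure E3) x).ae hvw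

lemma mFun_congr (hvw : v =ᵐ[volume] w) (φ : ℝ → E3 → ℂ) (t : ℝ) :
    mFun v φ t =ᵐ[volume] mFun w φ t := by
  have h : ∀ᵐ z : E3 × E3, v (z.1 - z.2) = w (z.1 - z.2) :=
    (quasiMeasurePreserving_sub (volume : Measure E3) (volume : Measure E3)).ae hvw
  filter_upwards [h] with z hz
  rw [mFun, mFun, hz]

lemma lowerOrder_congr (hvw : v =ᵐ[volume] w) (φ : ℝ → E3 → ℂ) (t : ℝ) (u : Kern) (x y : E3) :
    lowerOrder v φ t u x y = lowerOrder w φ t u x y := by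
  have h1 : ∀ x, hartreePot v φ t x = hartreePot w φ t x := fun x => by
    refine integral_congr_ae ?_
    filter_upwards [ae_sub_left hvw x] with y hy
    rw [hy]
  rw [lowerOrder, lowerOrder, h1, h1]
  congr 2
  · refine integral_congr_ae ?_
    filter_upwards [ae_sub_left hvw x] with z hz
    rw [wFun, wFun, hz]
  · refine integral_congr_ae ?_
    filter_upwards [ae_sub_left hvw y] with z hz
    rw [wFun, wFun, hz]

lemma SolvesSemilinear.congr (hvw : v =ᵐ[volume] w) {φ : ℝ → E3 → ℂ} {T : ℝ} {u : ℝ → Kern}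
    (h : SolvesSemilinear w φ T u) : SolvesSemilinear v φ T u := by
  obtain ⟨N, G, h1, h2, h3, h4⟩ := h
  refine ⟨N, G, h1, ?_, h3, ?_⟩
  · filter_upwards [h2] with t ht
    rw [toKern_congr (mFun_congr hvw φ t)]
    exact ⟨(memLp_congr_ae (mFun_congr hvw φ t)).2 ht.1, ht.2⟩
  · filter_upwards [h4] with t ht
    filter_upwards [ht] with z hz
    rw [lowerOrder_congr hvw, hz]

end Congr

end PairExcitation

end

/-! ### Choice of the constants and conclusion. -/

theorem theorem7 (u₀ : PairExcitation.Kern) (hu₀ : PairExcitation.IsSymm u₀) :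
    ∃ ε₀ : ℝ, 0 < ε₀ ∧
      ∀ v : PairExcitation.E3 → ℝ, MemLp v 2 volume → (∀ x, v (-x) = v x) →
      ∀ A : ℝ≥0, ∃ C : ℝ,
      ∀ T : ℝ, 0 < T →
      ∀ φ : ℝ → PairExcitation.E3 → ℂ, Measurable (Function.uncurry φ) →
        (∫⁻ t in Icc 0 T, eLpNorm (φ t) 4 volume ^ 2) ≤ A →
        (∫⁻ t in Icc 0 T, eLpNorm (PairExcitation.mFun v φ t) 2 volume) ≤ ENNReal.ofReal ε₀ →
        ∃ u : ℝ → PairExcitation.Kern,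
          ContinuousOn u (Icc 0 T) ∧ u 0 = u₀ ∧
          (∀ t ∈ Icc 0 T, PairExcitation.IsSymm (u t)) ∧
          (∀ t ∈ Icc 0 T, ‖u t‖ ≤ C) ∧
          PairExcitation.SolvesSemilinear v φ T u ∧
          (∃ G : ℝ → PairExcitation.Kern,
            PairExcitation.SchrodingerEq 1 T u G ∧ (∫ t in Icc 0 T, ‖G t‖) ≤ C) ∧
          (∃ p P : ℝ → PairExcitation.Kern,
            (∀ t ∈ Icc 0 T,
              PairExcitation.kernelOp (p t) = PairExcitation.chOp (u t) - 1) ∧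
            PairExcitation.SchrodingerEq (-1) T p P ∧ (∫ t in Icc 0 T, ‖P t‖) ≤ C) := by
  obtain ⟨K, hK0, hK, -⟩ := PairExcitation.bddLip_NMap (R := ‖u₀‖ + 1)
  -- K bounds the nonlinearity on the ball of radius ‖u₀‖ + 1 and involves u₀ only. The choice
  -- guarantees 2Kε₀ ≤ 1, the smallness used in the energy estimate; K + 1 covers K = 0.
  refine ⟨1 / (2 * (K + 1)), by positivity, fun v hv heven A => ?_⟩
  obtain ⟨w, hwm, hweven, hvw⟩ := PairExcitation.exists_measurable_even hv heven
  have hw : MemLp w 2 volume := (memLp_congr_ae hvw).1 hv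
  set ε : ℝ := 1 / (2 * (K + 1)) with hε
  have hε0 : 0 ≤ ε := by positivity
  have hKε : 2 * K * ε ≤ 1 := by
    rw [hε, mul_one_div, div_le_one (by positivity)]
    linarith
  set R : ℝ := ‖u₀‖ + 1 with hR
  have hR0 : 0 ≤ R := by positivity
  set B : ℝ := K * ε + (2 * ε + 2 * ((eLpNorm w 2 volume).toReal * A)) * R with hB
  have hB0 : 0 ≤ B := by positivity
  have hRB : 0 ≤ 2 * R * B := by positivity
  -- The sum dominates at once the bound R for u, the bound B for its force and 2RB for the force of
  -- p.
  refine ⟨R + B + 2 * R * B, fun T hT φ hφ h h' => ?_⟩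
  have hm : (∫⁻ t in Icc 0 T, eLpNorm (PairExcitation.mFun w φ t) 2 volume)
      ≤ ENNReal.ofReal ε := by
    refine le_of_eq_of_le (lintegral_congr fun t => ?_) h'
    exact (eLpNorm_congr_ae (PairExcitation.mFun_congr hvw φ t)).symm
  obtain ⟨u, hu1, hu2, hu3, hu4, hu5, ⟨G, hG1, hG2⟩, p, P, hp1, hp2, hp3⟩ :=
    PairExcitation.Coefficients.exists_solution ⟨hwm, hweven, hw, hφ⟩ hT hε0 hu₀ hR hK0 hK hKε h hm hB
  exact ⟨u, hu1, hu2, hu3, fun t ht => (hu4 t ht).trans (by linarith), hu5.congr hvw,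
    ⟨G, hG1, hG2.trans (by linarith)⟩, p, P, hp1, hp2, hp3.trans (by linarith)⟩
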